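/- Let $(V_4,g)$ be an oriented (smooth) space-time of signature $(-,+,+,+)$ with Levi-Civita connection $\nabla$, metric volume element $\eta$, Riemann tensor $R_{abcd}$ (with $\nabla_a\nabla_bX^d-\nabla_b\nabla_aX^d=R^d{}_{cab}X^c$), Ricci tensor $R_{bd}=R^a{}_{bad}$, scalar curvature $R$ and Weyl tensor $W$. For 2-forms $F,H$ put $(F,H)=\frac12F_{ab}H^{ab}$, $(*F)_{ab}=\frac12\eta_{abmn}F^{mn}$, and let $[A,B]=A\cdot B-B\cdot A$ with $(A\cdot B)_{ab}=A_a{}^mB_{mb}$. Double 2-forms act on 2-forms by $P(F)_{ab}=\frac12P_{ab}{}^{mn}F_{mn}$ and are composed by $(P\circ Q)_{abcd}=\frac12P_{ab}{}^{mn}Q_{mncd}$. Let $G_{abcd}=g_{ac}g_{bd}-g_{ad}g_{bc}$ and ${\cal G}=\frac12(G-{\rm i}\,\eta)$. A complex 2-form $F$ is self-dual if $*F={\rm i}F$. The self-dual Weyl tensor is ${\cal W}={\cal G}\circ W\circ{\cal G}$. On forms, $\delta$ is the codifferential, $\delta\alpha=-\nabla^a\alpha_a$ on 1-forms and $(\delta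 F)_b=-\nabla^aF_{ab}$ on 2-forms. Let $V$ be a time-like 2-plane distribution with smooth volume element $U$ (the wedge $e_0\wedge e_1$ of the 1-forms dual under $g$ to an orthonormal basis of $V$), let $H=V^\perp$, and let $v,h$ be the orthogonal projectors on $V$ and $H$. Suppose that the 2+2 structure $(V,H)$ is umbilical: the traceless parts of the symmetrized second fundamental forms $Q_v(x,y)=h(\nabla_{v(x)}v(y))$ and $Q_h(x,y)=v(\nabla_{h(x)}h(y))$ vanish, i.e. their symmetric parts are $S_v=\frac12v\otimes{\rm tr}\,S_v$ and $S_h=\frac12h\otimes{\rm tr}\,S_h$. Let $${\cal U}=\tfrac1{\sqrt2}(U-{\rm i}*U),\qquad \xi=\delta{\cal U},\qquad \chi_b=\xi^a{\cal U}_{ab},$$ $$\Omega=\tfrac12(\chi^2-\delta\chi)-\tfrac{R}{12},\qquad {\cal Z}=\tfrac12[{\rm d}\chi,{\cal U}],$$ where $\chi^2=g^{ab}\chi_a\chi_b$ and $({\rm d}\chi)_{ab}=\partial_a\chi_b-\partial_b\chi_a$. Then at every point $${\cal W}=3\Omega\,{\cal U}\otimes{\cal U}+\Omega\,{\cal G}+{\cal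 U}\otimes{\cal Z}+{\cal Z}\otimes{\cal U}.$$ Moreover ${\cal W}$ maps the space of self-dual 2-forms into itself, and, as an endomorphism of that space, it has the invariants $${\rm tr}\,{\cal W}^2=2\big(3\Omega^2-({\cal Z},{\cal Z})\big),\qquad {\rm tr}\,{\cal W}^3=3\Omega\big(({\cal Z},{\cal Z})-2\Omega^2\big),$$ and its eigenvalues, listed with algebraic multiplicity, are $$\Omega,\qquad \tfrac12\Big(-\Omega\pm\sqrt{9\Omega^2-4({\cal Z},{\cal Z})}\Big),$$ where $\sqrt{\ }$ is either complex square root. -/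

import Mathlib

open scoped Manifold ContDiff
open Complex (I)

noncomputable section

/-! Tensor calculus in coordinates. All tensors are given by their components; indices run over
`Fin 4`, and lower indices are used unless something else is said. -/

/-- The coordinate space of a four-dimensional manifold. -/
abbrev Coord := EuclideanSpace ℝ (Fin 4)

/-- Components of a 2-tensor at a point. -/
abbrev Tensor2 (R : Type*) := Matrix (Fin 4) (Fin 4) R

/-- Components of a 4-tensor (in particular of a double 2-form) at a point. -/
abbrev Tensor4 (R : Type*) := Fin 4 → Fin 4 → Fin 4 → Fin 4 → R

/-- Complexification of a real 2-tensor. -/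
def cplx2 (A : Tensor2 ℝ) : Tensor2 ℂ := fun a b => (A a b : ℂ)

/-- Complexification of a real 4-tensor. -/
def cplx4 (P : Tensor4 ℝ) : Tensor4 ℂ := fun a b c d => (P a b c d : ℂ)

/-! ### Differentiation -/

/-- The partial derivative `∂_i f` at `y`. -/
def pd {V : Type*} [NormedAddCommGroup V] [NormedSpace ℝ V]
    (i : Fin 4) (f : Coord → V) (y : Coord) : V :=
  fderiv ℝ f y (EuclideanSpace.single i 1)

/-- The Christoffel symbol `Γ^c_{ab}` of the Levi-Civita connection of `g`. -/
def christoffel (g : Coord → Tensor2 ℝ) (y : Coord) (c a b : Fin 4) : ℝ :=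
  (1 / 2) * ∑ d, (g y)⁻¹ c d *
    (pd a (fun z => g z d b) y + pd b (fun z => g z d a) y - pd d (fun z => g z a b) y)

/-- The covariant derivative `∇_a X^c` of a vector field. -/
def nablaVec (g : Coord → Tensor2 ℝ) (X : Coord → Fin 4 → ℝ) (y : Coord) (a c : Fin 4) : ℝ :=
  pd a (fun z => X z c) y + ∑ d, christoffel g y c a d * X y d

/-- The covariant derivative `∇_a α_b` of a complex 1-form. -/
def nabla1 (g : Coord → Tensor2 ℝ) (α : Coord → Fin 4 → ℂ) (y : Coord) (a b : Fin 4) : ℂ :=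
  pd a (fun z => α z b) y - ∑ d, (christoffel g y d a b : ℂ) * α y d

/-- The covariant derivative `∇_a F_{bc}` of a complex 2-tensor. -/
def nabla2 (g : Coord → Tensor2 ℝ) (F : Coord → Tensor2 ℂ) (y : Coord) (a b c : Fin 4) : ℂ :=
  pd a (fun z => F z b c) y - ∑ d, (christoffel g y d a b : ℂ) * F y d c
    - ∑ d, (christoffel g y d a c : ℂ) * F y b d

/-- The codifferential of a complex 1-form, `δα = -∇^a α_a`. -/
def codiff1 (g : Coord → Tensor2 ℝ) (α : Coord → Fin 4 → ℂ) (y : Coord) : ℂ :=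
  -∑ a, ∑ b, cplx2 (g y)⁻¹ a b * nabla1 g α y a b

/-- The codifferential of a complex 2-form, `(δF)_b = -∇^a F_{ab}`. -/
def codiff2 (g : Coord → Tensor2 ℝ) (F : Coord → Tensor2 ℂ) (y : Coord) (b : Fin 4) : ℂ :=
  -∑ a, ∑ c, cplx2 (g y)⁻¹ a c * nabla2 g F y c a b

/-- The exterior derivative of a complex 1-form, `(dα)_{ab} = ∂_a α_b - ∂_b α_a`. -/
def extDeriv1 (α : Coord → Fin 4 → ℂ) (y : Coord) : Tensor2 ℂ :=
  fun a b => pd a (fun z => α z b) y - pd b (fun z => α z a) y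

/-! ### Curvature -/

/-- The Riemann tensor `R^d_{cab}`, so that
`∇_a ∇_b X^d - ∇_b ∇_a X^d = R^d_{cab} X^c`. -/
def riemannUp (g : Coord → Tensor2 ℝ) (y : Coord) (d c a b : Fin 4) : ℝ :=
  pd a (fun z => christoffel g z d b c) y - pd b (fun z => christoffel g z d a c) y
    + ∑ e, (christoffel g y d a e * christoffel g y e b c
      - christoffel g y d b e * christoffel g y e a c)

/-- The Riemann tensor `R_{abcd}` with all indices lowered. -/
def riemann (g : Coord → Tensor2 ℝ) (y : Coord) : Tensor4 ℝ :=
  fun a b c d => ∑ e, g y a e * riemannUp g y e b c d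

/-- The Ricci tensor `R_{bd} = R^a_{bad}`. -/
def ricci (g : Coord → Tensor2 ℝ) (y : Coord) : Tensor2 ℝ :=
  fun b d => ∑ a, riemannUp g y a b a d

/-- The scalar curvature. -/
def scalarCurv (g : Coord → Tensor2 ℝ) (y : Coord) : ℝ :=
  ∑ a, ∑ b, (g y)⁻¹ a b * ricci g y a b

/-- The Weyl tensor of a four-dimensional metric. -/
def weyl (g : Coord → Tensor2 ℝ) (y : Coord) : Tensor4 ℝ :=
  fun a b c d => riemann g y a b c d
    - (1 / 2) * (g y a c * ricci g y b d - g y a d * ricci g y b c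
        + g y b d * ricci g y a c - g y b c * ricci g y a d)
    + scalarCurv g y / 6 * (g y a c * g y b d - g y a d * g y b c)

/-! ### Algebra of 2-forms and double 2-forms; `q` is the inverse metric `g^{ab}` -/

/-- `(P(F))_{ab} = ½ P_{ab}^{mn} F_{mn}`. -/
def applyForm (q : Tensor2 ℂ) (P : Tensor4 ℂ) : Tensor2 ℂ →ₗ[ℂ] Tensor2 ℂ where
  toFun F := Matrix.of fun a b => (1 / 2) * ∑ m, ∑ n, ∑ r, ∑ s, P a b m n * q m r * q n s * F r s
  map_add' F H := by
    ext a b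
    simp only [Matrix.of_apply, Matrix.add_apply, mul_add, Finset.sum_add_distrib]
  map_smul' z F := by
    ext a b
    simp only [Matrix.of_apply, Matrix.smul_apply, smul_eq_mul, RingHom.id_apply, Finset.mul_sum]
    refine Finset.sum_congr rfl fun m _ => Finset.sum_congr rfl fun n _ =>
      Finset.sum_congr rfl fun r _ => Finset.sum_congr rfl fun s _ => by ring

/-- `(P ∘ Q)_{abcd} = ½ P_{ab}^{mn} Q_{mncd}`. -/
def compForm (q : Tensor2 ℂ) (P Q : Tensor4 ℂ) : Tensor4 ℂ :=
  fun a b c d => (1 / 2) * ∑ m, ∑ n, ∑ r, ∑ s, P a b m n * q m r * q n s * Q r s c d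

/-- The product of 2-forms, `(F, H) = ½ F_{ab} H^{ab}`. -/
def formProd (q : Tensor2 ℂ) (F H : Tensor2 ℂ) : ℂ :=
  (1 / 2) * ∑ a, ∑ b, ∑ c, ∑ d, F a b * q a c * q b d * H c d

/-- The commutator `[A, B] = A · B - B · A`, where `(A · B)_{ab} = A_a^m B_{mb}`. -/
def tensorComm (q : Tensor2 ℂ) (A B : Tensor2 ℂ) : Tensor2 ℂ := A * q * B - B * q * A

/-- The tensor product `(A ⊗ B)_{abcd} = A_{ab} B_{cd}`. -/
def tensorProd (A B : Tensor2 ℂ) : Tensor4 ℂ := fun a b c d => A a b * B c d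

/-- The metric `G = ½ g ∧ g` on the space of 2-forms. -/
def formMetric (g : Tensor2 ℝ) : Tensor4 ℂ :=
  fun a b c d => (g a c * g b d - g a d * g b c : ℝ)

/-- The metric `𝒢 = ½ (G - i η)` on the space of self-dual 2-forms. -/
def sdMetric (g : Tensor2 ℝ) (η : Tensor4 ℝ) : Tensor4 ℂ :=
  fun a b c d => (1 / 2) * (formMetric g a b c d - I * cplx4 η a b c d)

/-- The Hodge dual of a 2-form, `(*F)_{ab} = ½ η_{ab}^{mn} F_{mn}`. -/
def hodge (g : Tensor2 ℝ) (η : Tensor4 ℝ) : Tensor2 ℂ →ₗ[ℂ] Tensor2 ℂ :=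
  applyForm (cplx2 g⁻¹) (cplx4 η)

/-- The space of self-dual 2-forms: antisymmetric complex 2-tensors with `*F = i F`. -/
def sdForms (g : Tensor2 ℝ) (η : Tensor4 ℝ) : Submodule ℂ (Tensor2 ℂ) where
  carrier := {F | F.transpose = -F ∧ hodge g η F = I • F}
  add_mem' := by
    rintro F H ⟨hF, hF'⟩ ⟨hH, hH'⟩
    exact ⟨by rw [Matrix.transpose_add, hF, hH, neg_add],
      by rw [map_add, hF', hH', smul_add]⟩
  zero_mem' := ⟨by simp, by simp⟩
  smul_mem' := by
    rintro z F ⟨hF, hF'⟩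
    exact ⟨by rw [Matrix.transpose_smul, hF, smul_neg],
      by rw [map_smul, hF', smul_comm]⟩

/-- The self-dual Weyl tensor `𝒲 = 𝒢 ∘ W ∘ 𝒢`. -/
def sdWeyl (g : Coord → Tensor2 ℝ) (η : Coord → Tensor4 ℝ) (y : Coord) : Tensor4 ℂ :=
  compForm (cplx2 (g y)⁻¹)
    (compForm (cplx2 (g y)⁻¹) (sdMetric (g y) (η y)) (cplx4 (weyl g y))) (sdMetric (g y) (η y))

/-- The self-dual Weyl tensor as an endomorphism of the space of 2-tensors. -/
def sdWeylEnd (g : Coord → Tensor2 ℝ) (η : Coord → Tensor4 ℝ) (y : Coord) :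
    Tensor2 ℂ →ₗ[ℂ] Tensor2 ℂ :=
  applyForm (cplx2 (g y)⁻¹) (sdWeyl g η y)

/-! ### Concomitants of the canonical 2-form `U` of a 2+2 structure -/

/-- The canonical self-dual bivector `𝒰 = (U - i *U) / √2`. -/
def canonSD (g : Coord → Tensor2 ℝ) (η : Coord → Tensor4 ℝ) (U : Coord → Tensor2 ℝ)
    (y : Coord) : Tensor2 ℂ :=
  ((1 / Real.sqrt 2 : ℝ) : ℂ) • (cplx2 (U y) - I • hodge (g y) (η y) (cplx2 (U y)))

/-- The complex 1-form `χ = i_ξ 𝒰`, where `ξ = δ𝒰`; that is, `χ_b = ξ^a 𝒰_{ab}`. -/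
def chi (g : Coord → Tensor2 ℝ) (η : Coord → Tensor4 ℝ) (U : Coord → Tensor2 ℝ)
    (y : Coord) (b : Fin 4) : ℂ :=
  ∑ a, ∑ c, cplx2 (g y)⁻¹ a c * codiff2 g (canonSD g η U) y c * canonSD g η U y a b

/-- The square `χ² = g^{ab} χ_a χ_b`. -/
def chiSq (g : Coord → Tensor2 ℝ) (η : Coord → Tensor4 ℝ) (U : Coord → Tensor2 ℝ)
    (y : Coord) : ℂ :=
  ∑ a, ∑ b, cplx2 (g y)⁻¹ a b * chi g η U y a * chi g η U y b

/-- The scalar `Ω = ½ (χ² - δχ) - R / 12`. -/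
def omegaScalar (g : Coord → Tensor2 ℝ) (η : Coord → Tensor4 ℝ) (U : Coord → Tensor2 ℝ)
    (y : Coord) : ℂ :=
  (1 / 2) * (chiSq g η U y - codiff1 g (chi g η U) y) - (scalarCurv g y : ℂ) / 12

/-- The 2-form `𝒵 = ½ [dχ, 𝒰]`. -/
def zForm (g : Coord → Tensor2 ℝ) (η : Coord → Tensor4 ℝ) (U : Coord → Tensor2 ℝ)
    (y : Coord) : Tensor2 ℂ :=
  (1 / 2 : ℂ) • tensorComm (cplx2 (g y)⁻¹) (extDeriv1 (chi g η U) y) (canonSD g η U y)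

/-! ### Umbilical distributions -/

/-- The generalized second fundamental form `Q(x, y) = p^⊥ (∇_{p x} (p y))` of the distribution
with orthogonal projector `p = (p^c_b)`, evaluated on coordinate fields: the component
`Q(∂_a, ∂_b)^c`. -/
def secondFund (g : Coord → Tensor2 ℝ) (p : Coord → Tensor2 ℝ) (y : Coord)
    (a b c : Fin 4) : ℝ :=
  ∑ d, (1 - p y) c d * ∑ m, p y m a * nablaVec g (fun z e => p z e b) y m d

/-- The symmetric part `S` of the second fundamental form. -/
def secondFundSymm (g : Coord → Tensor2 ℝ) (p : Coord → Tensor2 ℝ) (y : Coord)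
    (a b c : Fin 4) : ℝ :=
  (1 / 2) * (secondFund g p y a b c + secondFund g p y b a c)

/-- The traceless part `S^T = S - ½ p ⊗ tr S` of `S`, for a distribution of 2-planes. -/
def secondFundTraceless (g : Coord → Tensor2 ℝ) (p : Coord → Tensor2 ℝ) (y : Coord)
    (a b c : Fin 4) : ℝ :=
  secondFundSymm g p y a b c
    - (1 / 2) * (g y * p y) a b * ∑ m, ∑ n, (g y)⁻¹ m n * secondFundSymm g p y m n c

/-- The projector `v = U²` on the plane with volume element `U`, as `v^a_b`. -/
def planeProj (g : Coord → Tensor2 ℝ) (U : Coord → Tensor2 ℝ) (y : Coord) : Tensor2 ℝ :=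
  (g y)⁻¹ * (U y * (g y)⁻¹ * U y)

/-! ### Space-times -/

/-- The Minkowski metric of signature `(-, +, +, +)`. -/
def minkowski (i j : Fin 4) : ℝ := if i = j then (if i = 0 then -1 else 1) else 0

/-- Tangent vectors of the model space are vectors of the model space; this is the coordinate
vector `∂_i` at the point with coordinates `y` in the chart `φ`. -/
def coordVec {M : Type*} [TopologicalSpace M] [ChartedSpace Coord M]
    (φ : OpenPartialHomeomorph M Coord) (y : Coord) (i : Fin 4) :
    TangentSpace (𝓡 4) (φ.symm y) :=
  mfderiv (𝓡 4) (𝓡 4) φ.symm y (EuclideanSpace.single i (1 : ℝ) : Coord)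

/-- A field of bilinear forms on the tangent spaces of `M`. -/
abbrev BilinField (M : Type*) [TopologicalSpace M] [ChartedSpace Coord M] :=
  ∀ x : M, TangentSpace (𝓡 4) x →ₗ[ℝ] TangentSpace (𝓡 4) x →ₗ[ℝ] ℝ

/-- Components of a field of bilinear forms in a chart. -/
def BilinField.comps {M : Type*} [TopologicalSpace M] [ChartedSpace Coord M]
    (T : BilinField M) (φ : OpenPartialHomeomorph M Coord) (y : Coord) : Tensor2 ℝ :=
  fun a b => T (φ.symm y) (coordVec φ y a) (coordVec φ y b)

/-- A field of bilinear forms is smooth if its components in every chart are. -/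
def BilinField.IsSmooth {M : Type*} [TopologicalSpace M] [ChartedSpace Coord M]
    (T : BilinField M) : Prop :=
  ∀ φ ∈ IsManifold.maximalAtlas (𝓡 4) ∞ M, ∀ a b : Fin 4,
    ContDiffOn ℝ ∞ (fun y => T.comps φ y a b) φ.target

/-- A field of alternating 4-forms on the tangent spaces of `M`. -/
abbrev FourForm (M : Type*) [TopologicalSpace M] [ChartedSpace Coord M] :=
  ∀ x : M, TangentSpace (𝓡 4) x [⋀^Fin 4]→ₗ[ℝ] ℝ

/-- Components of a 4-form in a chart. -/
def FourForm.comps {M : Type*} [TopologicalSpace M] [ChartedSpace Coord M]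
    (T : FourForm M) (φ : OpenPartialHomeomorph M Coord) (y : Coord) : Tensor4 ℝ :=
  fun a b c d => T (φ.symm y) ![coordVec φ y a, coordVec φ y b, coordVec φ y c, coordVec φ y d]

/-- A 4-form is smooth if its components in every chart are. -/
def FourForm.IsSmooth {M : Type*} [TopologicalSpace M] [ChartedSpace Coord M]
    (T : FourForm M) : Prop :=
  ∀ φ ∈ IsManifold.maximalAtlas (𝓡 4) ∞ M, ∀ a b c d : Fin 4,
    ContDiffOn ℝ ∞ (fun y => T.comps φ y a b c d) φ.target

/-- An oriented space-time: a smooth Lorentzian metric of signature `(-, +, +, +)` on `M`,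
together with an orientation, given by its metric volume element `η`. -/
structure OrientedSpacetime (M : Type*) [TopologicalSpace M] [ChartedSpace Coord M] where
  /-- the metric `g` -/
  metric : BilinField M
  metric_symm : ∀ x u w, metric x u w = metric x w u
  metric_signature : ∀ x, ∃ e : Fin 4 → TangentSpace (𝓡 4) x,
    ∀ i j, metric x (e i) (e j) = minkowski i j
  metric_smooth : metric.IsSmooth
  /-- the volume element `η` -/
  vol : FourForm M
  vol_unit : ∀ x (e : Fin 4 → TangentSpace (𝓡 4) x),
    (∀ i j, metric x (e i) (e j) = minkowski i j) → |vol x e| = 1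
  vol_smooth : vol.IsSmooth

/-- `U` is the canonical 2-form of a 2+2 almost-product structure: it is smooth, and at each
point it is the volume element `e₀ ∧ e₁` of a time-like plane with orthonormal basis
`(e₀, e₁)`. -/
def OrientedSpacetime.IsCanonical {M : Type*} [TopologicalSpace M] [ChartedSpace Coord M]
    (S : OrientedSpacetime M) (U : BilinField M) : Prop :=
  U.IsSmooth ∧ ∀ x, ∃ e₀ e₁ : TangentSpace (𝓡 4) x,
    S.metric x e₀ e₀ = -1 ∧ S.metric x e₁ e₁ = 1 ∧ S.metric x e₀ e₁ = 0 ∧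
    ∀ u w, U x u w =
      S.metric x e₀ u * S.metric x e₁ w - S.metric x e₁ u * S.metric x e₀ w

/-- The 2+2 structure with canonical 2-form `U` is umbilical: the traceless symmetric parts of
the second fundamental forms of the time-like plane (with projector `v = U²`) and of its
orthogonal complement (with projector `h = 1 - v`) vanish. -/
def OrientedSpacetime.IsUmbilical {M : Type*} [TopologicalSpace M] [ChartedSpace Coord M]
    (S : OrientedSpacetime M) (U : BilinField M) : Prop :=
  S.IsCanonical U ∧
  ∀ φ ∈ IsManifold.maximalAtlas (𝓡 4) ∞ M, ∀ y ∈ φ.target, ∀ a b c : Fin 4,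
    secondFundTraceless (S.metric.comps φ)
      (planeProj (S.metric.comps φ) (U.comps φ)) y a b c = 0 ∧
    secondFundTraceless (S.metric.comps φ)
      (fun z => 1 - planeProj (S.metric.comps φ) (U.comps φ) z) y a b c = 0

end

/-! Rescale the canonical form to J = U − i*U = √2 𝒰 (`unitSD`). With one index raised J is an
involution commuting with the projector v on V, and χ = ½ i_{δJ} J. In a complex null frame adapted
to (V,H) the mixed J is diag(1,−1,1,−1), and the self-dual 2-forms are spanned by J and two null
forms M, L, with entries in the slots (0,2) and (1,3).

Differentiating J² = 1 leaves ∇J with M and L components only: eight functions. Umbilicity says that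
the second fundamental forms vanish on the null vectors of each plane, which kills four of them; in
Lorentzian terms, the two null directions of V are geodesic and shear-free. The four that survive
are exactly the components of δJ, so ∇J is algebraic in g, J and δJ (`cov2_canon`).

This equation holds on an open set and can be differentiated again. The Ricci identity then gives
the commutator of the curvature with J in terms of χ and ∇χ (`curvature_identity`). Bracketing with
J annihilates J and keeps M and L, so in the self-dual curvature the coefficients of M⊗M and L⊗L
vanish, the mixed M, L coefficient gives χ² − δχ, and those mixing J with M or L give dχ
(`frame_riemann`). In the Weyl components the Ricci tensor enters these only through R, and the one
unseen coefficient, that of J⊗J, is fixed because 𝒲 is trace-free. This is the formula with Ω and 𝒵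
(`frame_sdWeyl`).

For the spectrum, 𝒲 is a 3×3 matrix in the basis J, M, L (`spectrum_frameTypeI`): Ω belongs to the
self-dual forms orthogonal to both 𝒰 and 𝒵, and the other two eigenvalues solve a quadratic equation
with root sum −Ω.

All derivatives are taken of tensor components in coordinates; frames only evaluate tensor
identities at a point. Hence a null frame is needed at each point separately, and no smooth frame
field is constructed. -/

open scoped Kronecker

/-! ### Matrix-valued functions and their partial derivatives -/

open Matrix in
/-- The entrywise partial derivative of a matrix field. -/
noncomputable def matPd {m n : Type*} (a : Fin 4) (A : Coord → Matrix m n ℂ) (y : Coord) :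
    Matrix m n ℂ :=
  Matrix.of fun i j => pd a (fun z => A z i j) y

/-- The entrywise partial derivative of a covector field. -/
noncomputable def vecPd (a : Fin 4) (u : Coord → Fin 4 → ℂ) (y : Coord) : Fin 4 → ℂ :=
  fun i => pd a (fun z => u z i) y

/-- All entries of a matrix field are smooth at a point. -/
def MatSmoothAt {m n : Type*} (A : Coord → Matrix m n ℂ) (y : Coord) : Prop :=
  ∀ i j, ContDiffAt ℝ ∞ (fun z => A z i j) y

/-- All components of a covector field are smooth at a point. -/
def VecSmoothAt (u : Coord → Fin 4 → ℂ) (y : Coord) : Prop :=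
  ∀ i, ContDiffAt ℝ ∞ (fun z => u z i) y

section Pd

variable {V : Type*} [NormedAddCommGroup V] [NormedSpace ℝ V]

theorem ContDiffAt.pd {f : Coord → V} {y : Coord} (hf : ContDiffAt ℝ ∞ f y) (a : Fin 4) :
    ContDiffAt ℝ ∞ (fun z => pd a f z) y :=
  (hf.fderiv_right (m := ∞) (by simp)).clm_apply contDiffAt_const

theorem ContDiffAt.diffAt {f : Coord → V} {y : Coord} (hf : ContDiffAt ℝ ∞ f y) :
    DifferentiableAt ℝ f y :=
  hf.differentiableAt (by simp)

theorem pd_congr {f h : Coord → V} {y : Coord} (e : f =ᶠ[nhds y] h) (a : Fin 4) :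
    pd a f y = pd a h y := by
  unfold pd; rw [e.fderiv_eq]

theorem pd_comm {f : Coord → V} {y : Coord} (hf : ContDiffAt ℝ ∞ f y) (a b : Fin 4) :
    pd a (fun z => pd b f z) y = pd b (fun z => pd a f z) y := by
  have hd : DifferentiableAt ℝ (fderiv ℝ f) y :=
    (hf.fderiv_right (m := ∞) (by simp)).differentiableAt (by simp)
  have key : ∀ a b : Fin 4, pd a (fun z => pd b f z) y =
      fderiv ℝ (fderiv ℝ f) y (EuclideanSpace.single a 1) (EuclideanSpace.single b 1) := by
    intro a b
    unfold pd
    rw [fderiv_clm_apply hd (differentiableAt_const _)]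
    simp
  rw [key, key]
  have := hf.isSymmSndFDerivAt
    (by simp only [minSmoothness_of_isRCLikeNormedField]; exact WithTop.coe_le_coe.2 le_top)
  exact this _ _

theorem pd_add {f h : Coord → V} {y : Coord} (hf : DifferentiableAt ℝ f y)
    (hh : DifferentiableAt ℝ h y) (a : Fin 4) :
    pd a (fun z => f z + h z) y = pd a f y + pd a h y := by
  unfold pd; rw [fderiv_fun_add hf hh]; rfl

theorem pd_sub {f h : Coord → V} {y : Coord} (hf : DifferentiableAt ℝ f y)
    (hh : DifferentiableAt ℝ h y) (a : Fin 4) :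
    pd a (fun z => f z - h z) y = pd a f y - pd a h y := by
  unfold pd; rw [fderiv_fun_sub hf hh]; rfl

theorem pd_neg (f : Coord → V) (y : Coord) (a : Fin 4) :
    pd a (fun z => - f z) y = - pd a f y := by
  unfold pd; rw [fderiv_fun_neg]; rfl

theorem pd_const (c : V) (y : Coord) (a : Fin 4) : pd a (fun _ => c) y = 0 := by
  unfold pd; simp

theorem pd_sum {ι : Type*} (s : Finset ι) {f : ι → Coord → V} {y : Coord}
    (hf : ∀ i ∈ s, DifferentiableAt ℝ (f i) y) (a : Fin 4) :
    pd a (fun z => ∑ i ∈ s, f i z) y = ∑ i ∈ s, pd a (f i) y := by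
  unfold pd; rw [fderiv_fun_sum hf]; simp

theorem pd_mul {f h : Coord → ℂ} {y : Coord} (hf : DifferentiableAt ℝ f y)
    (hh : DifferentiableAt ℝ h y) (a : Fin 4) :
    pd a (fun z => f z * h z) y = pd a f y * h y + f y * pd a h y := by
  unfold pd; rw [fderiv_fun_mul hf hh]; simp; ring

theorem pd_ofReal {f : Coord → ℝ} {y : Coord} (hf : DifferentiableAt ℝ f y) (a : Fin 4) :
    pd a (fun z => (f z : ℂ)) y = ((pd a f y : ℝ) : ℂ) := by
  unfold pd
  have := (Complex.ofRealCLM.hasFDerivAt.comp y hf.hasFDerivAt).fderiv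
  simp only [Function.comp_def, Complex.ofRealCLM_apply] at this
  rw [this]; simp

end Pd

theorem ContDiffAt.ofReal {f : Coord → ℝ} {y : Coord} (hf : ContDiffAt ℝ ∞ f y) :
    ContDiffAt ℝ ∞ (fun z => (f z : ℂ)) y :=
  Complex.ofRealCLM.contDiff.contDiffAt.comp y hf

section MatPd

variable {l m n : Type*} {y : Coord}

theorem MatSmoothAt.matPd {A : Coord → Matrix m n ℂ} (hA : MatSmoothAt A y) (a : Fin 4) :
    MatSmoothAt (fun z => matPd a A z) y := fun i j => (hA i j).pd a

theorem MatSmoothAt.sub {A B : Coord → Matrix m n ℂ} (hA : MatSmoothAt A y)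
    (hB : MatSmoothAt B y) : MatSmoothAt (fun z => A z - B z) y :=
  fun i j => (hA i j).sub (hB i j)

theorem MatSmoothAt.const (A : Matrix m n ℂ) : MatSmoothAt (fun _ => A) y :=
  fun _ _ => contDiffAt_const

theorem MatSmoothAt.smul (c : ℂ) {A : Coord → Matrix m n ℂ} (hA : MatSmoothAt A y) :
    MatSmoothAt (fun z => c • A z) y :=
  fun i j => contDiffAt_const.mul (hA i j)

theorem MatSmoothAt.transpose {A : Coord → Matrix m n ℂ} (hA : MatSmoothAt A y) :
    MatSmoothAt (fun z => (A z).transpose) y :=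
  fun i j => hA j i

theorem MatSmoothAt.mul [Fintype m] {A : Coord → Matrix l m ℂ} {B : Coord → Matrix m n ℂ}
    (hA : MatSmoothAt A y) (hB : MatSmoothAt B y) : MatSmoothAt (fun z => A z * B z) y := by
  intro i j
  simp only [Matrix.mul_apply]
  exact ContDiffAt.sum fun k _ => (hA i k).mul (hB k j)

theorem MatSmoothAt.det [Fintype m] [DecidableEq m] {A : Coord → Matrix m m ℂ}
    (hA : MatSmoothAt A y) : ContDiffAt ℝ ∞ (fun z => (A z).det) y := by
  simp only [Matrix.det_apply']
  exact ContDiffAt.sum fun σ _ => contDiffAt_const.mul (contDiffAt_prod fun k _ => hA _ _)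

/-- Cramer's rule: an entry of the inverse is a determinant with one row replaced, divided by `det
A`. -/
theorem MatSmoothAt.inv [Fintype m] [DecidableEq m] {A : Coord → Matrix m m ℂ}
    (hA : MatSmoothAt A y) (h : (A y).det ≠ 0) : MatSmoothAt (fun z => (A z)⁻¹) y := by
  intro i j
  simp only [Matrix.inv_def, Matrix.smul_apply, smul_eq_mul, Ring.inverse_eq_inv',
    Matrix.adjugate_apply]
  refine (hA.det.inv h).mul ?_
  refine MatSmoothAt.det (A := fun z => (A z).updateRow j (Pi.single i 1)) fun r s => ?_
  by_cases hr : r = j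
  · subst hr; simpa using contDiffAt_const
  · simpa [hr] using hA r s

theorem VecSmoothAt.vecMul {u : Coord → Fin 4 → ℂ} {A : Coord → Tensor2 ℂ}
    (hu : VecSmoothAt u y) (hA : MatSmoothAt A y) :
    VecSmoothAt (fun z => Matrix.vecMul (u z) (A z)) y := by
  intro i
  simp only [Matrix.vecMul, dotProduct]
  exact ContDiffAt.sum fun k _ => (hu k).mul (hA k i)

theorem MatSmoothAt.row {A : Coord → Tensor2 ℂ} (hA : MatSmoothAt A y) (b : Fin 4) :
    VecSmoothAt (fun z => A z b) y := fun i => hA b i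

theorem VecSmoothAt.vecMulVec {u w : Coord → Fin 4 → ℂ}
    (hu : VecSmoothAt u y) (hw : VecSmoothAt w y) :
    MatSmoothAt (fun z => Matrix.vecMulVec (u z) (w z)) y :=
  fun i j => (hu i).mul (hw j)

theorem matPd_congr {A B : Coord → Matrix m n ℂ} (e : A =ᶠ[nhds y] B) (a : Fin 4) :
    matPd a A y = matPd a B y := by
  ext i j
  exact pd_congr (e.mono fun z hz => by simp only [hz]) a

theorem matPd_add {A B : Coord → Matrix m n ℂ} (hA : MatSmoothAt A y)
    (hB : MatSmoothAt B y) (a : Fin 4) :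
    matPd a (fun z => A z + B z) y = matPd a A y + matPd a B y := by
  ext i j; exact pd_add (hA i j).diffAt (hB i j).diffAt a

theorem matPd_sub {A B : Coord → Matrix m n ℂ} (hA : MatSmoothAt A y)
    (hB : MatSmoothAt B y) (a : Fin 4) :
    matPd a (fun z => A z - B z) y = matPd a A y - matPd a B y := by
  ext i j; exact pd_sub (hA i j).diffAt (hB i j).diffAt a

theorem matPd_neg (A : Coord → Matrix m n ℂ) (a : Fin 4) :
    matPd a (fun z => - A z) y = - matPd a A y := by
  ext i j; exact pd_neg _ y a

theorem matPd_const (A : Matrix m n ℂ) (a : Fin 4) : matPd a (fun _ => A) y = 0 := by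
  ext i j; exact pd_const _ y a

theorem matPd_smul (c : ℂ) {A : Coord → Matrix m n ℂ} (hA : MatSmoothAt A y) (a : Fin 4) :
    matPd a (fun z => c • A z) y = c • matPd a A y := by
  ext i j
  have := pd_mul (differentiableAt_const c) (hA i j).diffAt a (y := y)
  rw [pd_const] at this
  simpa [matPd] using this

theorem matPd_transpose (A : Coord → Matrix m n ℂ) (a : Fin 4) :
    matPd a (fun z => (A z).transpose) y = (matPd a A y).transpose := rfl

theorem matPd_mul [Fintype m] {A : Coord → Matrix l m ℂ} {B : Coord → Matrix m n ℂ}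
    (hA : MatSmoothAt A y) (hB : MatSmoothAt B y) (a : Fin 4) :
    matPd a (fun z => A z * B z) y = matPd a A y * B y + A y * matPd a B y := by
  ext i j
  simp only [matPd, Matrix.of_apply, Matrix.add_apply, Matrix.mul_apply]
  rw [pd_sum _ fun k _ => ((hA i k).mul (hB k j)).diffAt, ← Finset.sum_add_distrib]
  exact Finset.sum_congr rfl fun k _ => pd_mul (hA i k).diffAt (hB k j).diffAt a

theorem matPd_comm {A : Coord → Matrix m n ℂ} (hA : MatSmoothAt A y) (a b : Fin 4) :
    matPd a (fun z => matPd b A z) y = matPd b (fun z => matPd a A z) y := by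
  ext i j; exact pd_comm (hA i j) a b

theorem vecPd_vecMul {u : Coord → Fin 4 → ℂ} {A : Coord → Tensor2 ℂ}
    (hu : VecSmoothAt u y) (hA : MatSmoothAt A y) (a : Fin 4) :
    vecPd a (fun z => Matrix.vecMul (u z) (A z)) y =
      Matrix.vecMul (vecPd a u y) (A y) + Matrix.vecMul (u y) (matPd a A y) := by
  ext i
  simp only [vecPd, Matrix.vecMul, dotProduct, Pi.add_apply, matPd, Matrix.of_apply]
  rw [pd_sum _ fun k _ => ((hu k).mul (hA k i)).diffAt, ← Finset.sum_add_distrib]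
  exact Finset.sum_congr rfl fun k _ => pd_mul (hu k).diffAt (hA k i).diffAt a

theorem matPd_vecMulVec {u w : Coord → Fin 4 → ℂ}
    (hu : VecSmoothAt u y) (hw : VecSmoothAt w y) (a : Fin 4) :
    matPd a (fun z => Matrix.vecMulVec (u z) (w z)) y =
      Matrix.vecMulVec (vecPd a u y) (w y) + Matrix.vecMulVec (u y) (vecPd a w y) := by
  ext i j; exact pd_mul (hu i).diffAt (hw j).diffAt a

end MatPd

theorem cplx2_inv (A : Tensor2 ℝ) : cplx2 A⁻¹ = (cplx2 A)⁻¹ := by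
  have h : ∀ B : Tensor2 ℝ, cplx2 B = Complex.ofRealHom.mapMatrix B := fun B => rfl
  by_cases hA : IsUnit A.det
  · refine (Matrix.inv_eq_right_inv ?_).symm
    rw [h, h, ← map_mul, Matrix.mul_nonsing_inv _ hA, map_one]
  -- Both inverses are 0 by convention when the determinant vanishes.
  · rw [Matrix.nonsing_inv_apply_not_isUnit _ hA, Matrix.nonsing_inv_apply_not_isUnit, h, map_zero]
    rw [h, ← RingHom.map_det]
    simpa [isUnit_iff_ne_zero] using hA

/-! ### The Levi-Civita connection and its curvature -/

/-- A smooth non-degenerate metric on an open subset of the coordinate space. -/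
structure IsSmoothMetric (g : Coord → Tensor2 ℝ) (D : Set Coord) : Prop where
  isOpen : IsOpen D
  symm : ∀ z a b, g z a b = g z b a
  smooth : ∀ z ∈ D, ∀ a b, ContDiffAt ℝ ∞ (fun x => g x a b) z
  det_ne : ∀ z ∈ D, (g z).det ≠ 0

/-- The complexified connection matrix `(Γ_a)^d_b`. -/
noncomputable def gam (g : Coord → Tensor2 ℝ) (y : Coord) (a : Fin 4) : Tensor2 ℂ :=
  Matrix.of fun d b => (christoffel g y d a b : ℂ)

/-- The complexified curvature matrix `(R_{ab})^d_c`. -/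
noncomputable def curvMat (g : Coord → Tensor2 ℝ) (y : Coord) (a b : Fin 4) : Tensor2 ℂ :=
  Matrix.of fun d c => (riemannUp g y d c a b : ℂ)

/-- The covariant derivative of a covector field, as a covector. -/
noncomputable def cov1 (g : Coord → Tensor2 ℝ) (u : Coord → Fin 4 → ℂ) (y : Coord) (a : Fin 4) :
    Fin 4 → ℂ :=
  vecPd a u y - Matrix.vecMul (u y) (gam g y a)

/-- The covariant derivative of a covariant 2-tensor, as a matrix. -/
noncomputable def cov2 (g : Coord → Tensor2 ℝ) (F : Coord → Tensor2 ℂ) (y : Coord) (a : Fin 4) :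
    Tensor2 ℂ :=
  matPd a F y - (gam g y a).transpose * F y - F y * gam g y a

/-- The covariant derivative of a field of endomorphisms, as a matrix. -/
noncomputable def covEnd (g : Coord → Tensor2 ℝ) (T : Coord → Tensor2 ℂ) (y : Coord) (a : Fin 4) :
    Tensor2 ℂ :=
  matPd a T y + gam g y a * T y - T y * gam g y a

section

variable {g : Coord → Tensor2 ℝ} {D : Set Coord} {y : Coord}

theorem cov1_apply (u : Coord → Fin 4 → ℂ) (a b : Fin 4) :
    cov1 g u y a b = nabla1 g u y a b := by
  simp [cov1, nabla1, vecPd, gam, Matrix.vecMul, dotProduct, mul_comm]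

theorem cov2_apply (F : Coord → Tensor2 ℂ) (a b c : Fin 4) :
    cov2 g F y a b c = nabla2 g F y a b c := by
  simp [cov2, nabla2, matPd, gam, Matrix.mul_apply, mul_comm]

namespace IsSmoothMetric

theorem cplx (hg : IsSmoothMetric g D) (hy : y ∈ D) : MatSmoothAt (fun z => cplx2 (g z)) y :=
  fun i j => (hg.smooth y hy i j).ofReal

theorem cplx_det_ne (hg : IsSmoothMetric g D) (hy : y ∈ D) : (cplx2 (g y)).det ≠ 0 := by
  have h : cplx2 (g y) = Complex.ofRealHom.mapMatrix (g y) := rfl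
  rw [h, ← RingHom.map_det]
  simpa using hg.det_ne y hy

theorem cplx_inv (hg : IsSmoothMetric g D) (hy : y ∈ D) :
    MatSmoothAt (fun z => cplx2 (g z)⁻¹) y := by
  simp only [cplx2_inv]
  exact (hg.cplx hy).inv (hg.cplx_det_ne hy)

theorem inv_smooth (hg : IsSmoothMetric g D) (hy : y ∈ D) (a b : Fin 4) :
    ContDiffAt ℝ ∞ (fun z => (g z)⁻¹ a b) y := by
  have := Complex.reCLM.contDiff.contDiffAt.comp y (hg.cplx_inv hy a b)
  simpa [Function.comp_def, cplx2] using this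

theorem christoffel_smooth (hg : IsSmoothMetric g D) (hy : y ∈ D) (c a b : Fin 4) :
    ContDiffAt ℝ ∞ (fun z => christoffel g z c a b) y := by
  unfold christoffel
  refine contDiffAt_const.mul (ContDiffAt.sum fun d _ => (hg.inv_smooth hy c d).mul ?_)
  exact (((hg.smooth y hy _ _).pd a).add ((hg.smooth y hy _ _).pd b)).sub
    ((hg.smooth y hy _ _).pd d)

theorem gam_smooth (hg : IsSmoothMetric g D) (hy : y ∈ D) (a : Fin 4) :
    MatSmoothAt (fun z => gam g z a) y :=
  fun c b => (hg.christoffel_smooth hy c a b).ofReal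

theorem christoffel_symm (hg : IsSmoothMetric g D) (z : Coord) (c a b : Fin 4) :
    christoffel g z c a b = christoffel g z c b a := by
  unfold christoffel
  congr 1
  refine Finset.sum_congr rfl fun d _ => ?_
  congr 1
  have : (fun z => g z a b) = fun z => g z b a := funext fun z => hg.symm z a b
  rw [this]; ring

theorem lower_christoffel (hg : IsSmoothMetric g D) (hy : y ∈ D) (c a b : Fin 4) :
    ∑ d, g y c d * christoffel g y d a b =
      (1 / 2) * (pd a (fun z => g z c b) y + pd b (fun z => g z c a) y
        - pd c (fun z => g z a b) y) := by
  set X : Fin 4 → ℝ := fun d =>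
    pd a (fun z => g z d b) y + pd b (fun z => g z d a) y - pd d (fun z => g z a b) y with hX
  have h1 : (g y).mulVec (fun d => christoffel g y d a b) = (1 / 2 : ℝ) • X := by
    have : (fun d => christoffel g y d a b) = (1 / 2 : ℝ) • (g y)⁻¹.mulVec X := by
      ext d; simp [christoffel, Matrix.mulVec, dotProduct, hX]
    rw [this, Matrix.mulVec_smul, Matrix.mulVec_mulVec,
      Matrix.mul_nonsing_inv _ (isUnit_iff_ne_zero.2 (hg.det_ne y hy)), Matrix.one_mulVec]
  have := congrFun h1 c
  simpa [Matrix.mulVec, dotProduct, hX] using this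

/-- This is ∇g = 0 in matrix form. In the sum of the two lowered Christoffel symbols two derivatives
of g cancel and ∂_a g remains. -/
theorem matPd_metric (hg : IsSmoothMetric g D) (hy : y ∈ D) (a : Fin 4) :
    matPd a (fun z => cplx2 (g z)) y =
      (gam g y a).transpose * cplx2 (g y) + cplx2 (g y) * gam g y a := by
  ext b c
  have h1 := hg.lower_christoffel hy c a b
  have h2 := hg.lower_christoffel hy b a c
  have s1 : (fun z => g z c b) = fun z => g z b c := funext fun z => hg.symm z c b
  have s2 : (fun z => g z c a) = fun z => g z a c := funext fun z => hg.symm z c a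
  have s3 : (fun z => g z b a) = fun z => g z a b := funext fun z => hg.symm z b a
  rw [s1, s2] at h1
  rw [s3] at h2
  have h3 : pd a (fun z => g z b c) y =
      ∑ d, christoffel g y d a b * g y d c + ∑ d, g y b d * christoffel g y d a c := by
    rw [h2]
    have : ∑ d, christoffel g y d a b * g y d c = ∑ d, g y c d * christoffel g y d a b :=
      Finset.sum_congr rfl fun d _ => by rw [hg.symm y d c]; ring
    rw [this, h1]; ring
  have h4 : matPd a (fun z => cplx2 (g z)) y b c = ((pd a (fun z => g z b c) y : ℝ) : ℂ) :=
    pd_ofReal (hg.smooth y hy b c).diffAt a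
  rw [h4, h3]
  simp [Matrix.mul_apply, gam, cplx2]

theorem cov2_metric (hg : IsSmoothMetric g D) (hy : y ∈ D) (a : Fin 4) :
    cov2 g (fun z => cplx2 (g z)) y a = 0 := by
  rw [cov2, hg.matPd_metric hy]; abel

/-- Curvature as dΓ + Γ∧Γ. In this form the Ricci identity becomes noncommutative matrix algebra. -/
theorem curvMat_eq (hg : IsSmoothMetric g D) (hy : y ∈ D) (a b : Fin 4) :
    curvMat g y a b = matPd a (fun z => gam g z b) y - matPd b (fun z => gam g z a) y
      + (gam g y a * gam g y b - gam g y b * gam g y a) := by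
  ext d c
  have h (a b : Fin 4) : matPd a (fun z => gam g z b) y d c =
      ((pd a (fun z => christoffel g z d b c) y : ℝ) : ℂ) :=
    pd_ofReal (hg.christoffel_smooth hy d b c).diffAt a
  rw [Matrix.add_apply, Matrix.sub_apply, h, h]
  simp only [Matrix.sub_apply, curvMat, Matrix.of_apply, riemannUp,
    Matrix.mul_apply, gam, Finset.sum_sub_distrib]
  push_cast
  rfl

theorem cov2_smooth (hg : IsSmoothMetric g D) (hy : y ∈ D) {F : Coord → Tensor2 ℂ}
    (hF : MatSmoothAt F y) (a : Fin 4) : MatSmoothAt (fun z => cov2 g F z a) y :=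
  ((hF.matPd a).sub ((hg.gam_smooth hy a).transpose.mul hF)).sub (hF.mul (hg.gam_smooth hy a))

/-- The Ricci identity for covariant 2-tensors. -/
theorem cov2_comm (hg : IsSmoothMetric g D) (hy : y ∈ D) {F : Coord → Tensor2 ℂ}
    (hF : MatSmoothAt F y) (a b : Fin 4) :
    cov2 g (fun z => cov2 g F z b) y a - cov2 g (fun z => cov2 g F z a) y b =
      -((curvMat g y a b).transpose * F y + F y * curvMat g y a b) := by
  have key : ∀ a b : Fin 4, matPd a (fun z => cov2 g F z b) y =
      matPd a (fun z => matPd b F z) y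
      - ((matPd a (fun z => gam g z b) y).transpose * F y
        + (gam g y b).transpose * matPd a F y)
      - (matPd a F y * gam g y b + F y * matPd a (fun z => gam g z b) y) := by
    intro a b
    have hG := hg.gam_smooth hy b
    unfold cov2
    rw [matPd_sub ((hF.matPd b).sub (hG.transpose.mul hF)) (hF.mul hG),
      matPd_sub (hF.matPd b) (hG.transpose.mul hF), matPd_mul hG.transpose hF, matPd_mul hF hG,
      matPd_transpose]
  -- In the commutator ∂∂F and all terms with ∂F cancel, leaving ∂Γ and ΓΓ in the combination of the
  -- curvature. The derivative index is a mere label in `cov2`; without torsion its connection term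
  -- would drop out of the commutator anyway.
  rw [hg.curvMat_eq hy]
  simp only [cov2] at key ⊢
  rw [key, key, matPd_comm hF b a]
  simp only [Matrix.transpose_add, Matrix.transpose_sub, Matrix.transpose_mul]
  noncomm_ring

theorem lower_curvMat (a b c d : Fin 4) :
    (cplx2 (g y) * curvMat g y c d) a b = cplx4 (riemann g y) a b c d := by
  simp [Matrix.mul_apply, curvMat, cplx2, cplx4, riemann]

/-- The Ricci identity applied to g itself: ∇g vanishes on the whole open set `D`, so its second
covariant derivatives vanish too. -/
theorem curvMat_skew (hg : IsSmoothMetric g D) (hy : y ∈ D) (a b : Fin 4) :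
    (curvMat g y a b).transpose * cplx2 (g y) + cplx2 (g y) * curvMat g y a b = 0 := by
  have h : ∀ a, (fun z => cov2 g (fun z => cplx2 (g z)) z a) =ᶠ[nhds y] fun _ => 0 := fun a =>
    Filter.eventually_of_mem (hg.isOpen.mem_nhds hy) fun z hz => hg.cov2_metric hz a
  have h0 : ∀ a b, cov2 g (fun z => cov2 g (fun z => cplx2 (g z)) z b) y a = 0 := by
    intro a b
    rw [cov2, matPd_congr (h b), matPd_const, hg.cov2_metric hy]
    simp
  have := hg.cov2_comm hy (hg.cplx hy) a b
  rw [h0, h0, sub_zero] at this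
  exact neg_eq_zero.1 this.symm

theorem riemann_skew_left (hg : IsSmoothMetric g D) (hy : y ∈ D) (a b c d : Fin 4) :
    cplx4 (riemann g y) a b c d = - cplx4 (riemann g y) b a c d := by
  have h := congrFun (congrFun (hg.curvMat_skew hy c d) a) b
  have ht : (curvMat g y c d).transpose * cplx2 (g y) =
      (cplx2 (g y) * curvMat g y c d).transpose := by
    rw [Matrix.transpose_mul]
    congr 1
    ext i j
    exact congrArg _ (hg.symm y i j)
  rw [ht] at h
  simp only [Matrix.add_apply, Matrix.transpose_apply, lower_curvMat, Matrix.zero_apply] at h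
  exact eq_neg_of_add_eq_zero_right h

theorem riemannUp_skew (d c a b : Fin 4) : riemannUp g y d c a b = - riemannUp g y d c b a := by
  simp only [riemannUp, Finset.sum_sub_distrib]; ring

theorem riemann_skew_right (a b c d : Fin 4) :
    cplx4 (riemann g y) a b c d = - cplx4 (riemann g y) a b d c := by
  simp only [cplx4, riemann, riemannUp_skew (g := g) (y := y) _ b c d]
  simp

/-- The first Bianchi identity: by symmetry of the Christoffel symbols the derivative terms cancel
in the cyclic sum, and so do the quadratic ones. -/
theorem riemannUp_cyclic (hg : IsSmoothMetric g D) (d a b c : Fin 4) :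
    riemannUp g y d a b c + riemannUp g y d b c a + riemannUp g y d c a b = 0 := by
  have hs (a b c d : Fin 4) : pd a (fun z => christoffel g z d b c) y =
      pd a (fun z => christoffel g z d c b) y := by
    simp only [hg.christoffel_symm _ d b c]
  simp only [riemannUp]
  rw [hs b c a d, hs c a b d, hs a b c d]
  have : ∀ e, (christoffel g y d b e * christoffel g y e c a
      - christoffel g y d c e * christoffel g y e b a)
      + (christoffel g y d c e * christoffel g y e a b
      - christoffel g y d a e * christoffel g y e c b)
      + (christoffel g y d a e * christoffel g y e b c
      - christoffel g y d b e * christoffel g y e a c) = 0 := by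
    intro e
    rw [hg.christoffel_symm y e c a, hg.christoffel_symm y e b a, hg.christoffel_symm y e c b]
    ring
  have hsum := Finset.sum_eq_zero fun e (_ : e ∈ Finset.univ) => this e
  simp only [Finset.sum_add_distrib] at hsum
  linear_combination hsum

theorem riemann_cyclic (hg : IsSmoothMetric g D) (a b c d : Fin 4) :
    cplx4 (riemann g y) a b c d + cplx4 (riemann g y) a c d b + cplx4 (riemann g y) a d b c
      = 0 := by
  have h : riemann g y a b c d + riemann g y a c d b + riemann g y a d b c = 0 := by
    simp only [riemann, ← Finset.sum_add_distrib, ← mul_add, hg.riemannUp_cyclic]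
    simp
  simp only [cplx4]
  exact_mod_cast h

/-- Lowering an index commutes with covariant differentiation. -/
theorem cov2_lower (hg : IsSmoothMetric g D) (hy : y ∈ D) {T : Coord → Tensor2 ℂ}
    (hT : MatSmoothAt T y) (a : Fin 4) :
    cov2 g (fun z => cplx2 (g z) * T z) y a = cplx2 (g y) * covEnd g T y a := by
  simp only [cov2, covEnd, matPd_mul (hg.cplx hy) hT, hg.matPd_metric hy]
  noncomm_ring

end IsSmoothMetric

/-- The product rule for the contraction of a covector field with an endomorphism field. -/
theorem cov1_vecMul {u : Coord → Fin 4 → ℂ}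
    {T : Coord → Tensor2 ℂ} (hu : VecSmoothAt u y) (hT : MatSmoothAt T y) (a : Fin 4) :
    cov1 g (fun z => Matrix.vecMul (u z) (T z)) y a =
      Matrix.vecMul (cov1 g u y a) (T y) + Matrix.vecMul (u y) (covEnd g T y a) := by
  simp only [cov1, covEnd, vecPd_vecMul hu hT, Matrix.sub_vecMul, Matrix.vecMul_sub,
    Matrix.vecMul_add, Matrix.vecMul_vecMul]
  abel

theorem cov2_vecMulVec {u w : Coord → Fin 4 → ℂ} (hu : VecSmoothAt u y)
    (hw : VecSmoothAt w y) (a : Fin 4) :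
    cov2 g (fun z => Matrix.vecMulVec (u z) (w z)) y a =
      Matrix.vecMulVec (cov1 g u y a) (w y) + Matrix.vecMulVec (u y) (cov1 g w y a) := by
  rw [cov2, matPd_vecMulVec hu hw]
  simp only [cov1]
  have h1 : (gam g y a).transpose * Matrix.vecMulVec (u y) (w y) =
      Matrix.vecMulVec (Matrix.vecMul (u y) (gam g y a)) (w y) := by
    rw [Matrix.mul_vecMulVec, Matrix.mulVec_transpose]
  have h2 : Matrix.vecMulVec (u y) (w y) * gam g y a =
      Matrix.vecMulVec (u y) (Matrix.vecMul (w y) (gam g y a)) := by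
    rw [Matrix.vecMulVec_mul]
  rw [h1, h2, Matrix.sub_vecMulVec, Matrix.vecMulVec_sub]
  abel

theorem covEnd_mul {S T : Coord → Tensor2 ℂ}
    (hS : MatSmoothAt S y) (hT : MatSmoothAt T y) (a : Fin 4) :
    covEnd g (fun z => S z * T z) y a = covEnd g S y a * T y + S y * covEnd g T y a := by
  simp only [covEnd, matPd_mul hS hT]
  noncomm_ring

theorem covEnd_congr {S T : Coord → Tensor2 ℂ} (h : S =ᶠ[nhds y] T) (a : Fin 4) :
    covEnd g S y a = covEnd g T y a := by
  rw [covEnd, covEnd, matPd_congr h, h.self_of_nhds]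

theorem covEnd_one (a : Fin 4) : covEnd g (fun _ => 1) y a = 0 := by
  simp [covEnd, matPd_const]

theorem cov2_congr {S T : Coord → Tensor2 ℂ} (h : S =ᶠ[nhds y] T) (a : Fin 4) :
    cov2 g S y a = cov2 g T y a := by
  rw [cov2, cov2, matPd_congr h, h.self_of_nhds]

theorem cov2_transpose (F : Coord → Tensor2 ℂ) (a : Fin 4) :
    cov2 g (fun z => (F z).transpose) y a = (cov2 g F y a).transpose := by
  simp only [cov2, matPd_transpose, Matrix.transpose_sub, Matrix.transpose_mul,
    Matrix.transpose_transpose]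
  abel

theorem cov2_neg (F : Coord → Tensor2 ℂ) (a : Fin 4) :
    cov2 g (fun z => -(F z)) y a = -(cov2 g F y a) := by
  simp only [cov2, matPd_neg]
  noncomm_ring

/-- The covariant derivative of a row of a 2-tensor, the row index being inert. -/
theorem cov1_row (F : Coord → Tensor2 ℂ) (a b : Fin 4) :
    cov1 g (fun z => F z b) y a = cov2 g F y a b + ∑ d, gam g y a d b • F y d := by
  ext c
  simp only [cov1, cov2, Pi.sub_apply, Pi.add_apply, Finset.sum_apply, Pi.smul_apply,
    smul_eq_mul, Matrix.sub_apply, Matrix.mul_apply, Matrix.transpose_apply, vecPd, matPd,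
    Matrix.of_apply, Matrix.vecMul, dotProduct]
  ring

end

/-! ### Complex null frames adapted to a 2+2 structure -/

/-- The metric in a complex null frame. -/
def nullMetric : Tensor2 ℂ := !![0, 1, 0, 0; 1, 0, 0, 0; 0, 0, 0, 1; 0, 0, 1, 0]

/-- The canonical self-dual 2-form (normalised to have square one) in an adapted null frame. -/
def nullSD : Tensor2 ℂ := !![0, -1, 0, 0; 1, 0, 0, 0; 0, 0, 0, -1; 0, 0, 1, 0]

/-- The volume element of the time-like plane in an adapted null frame. -/
def nullPlane : Tensor2 ℂ := !![0, -1, 0, 0; 1, 0, 0, 0; 0, 0, 0, 0; 0, 0, 0, 0]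

/-- The columns of `E` form a complex null frame adapted to the metric `g`, the self-dual 2-form
`J` and the volume element `U` of a plane. -/
structure IsNullFrame (g J U E : Tensor2 ℂ) : Prop where
  metric : E.transpose * g * E = nullMetric
  canon : E.transpose * J * E = nullSD
  plane : E.transpose * U * E = nullPlane

theorem nullMetric_mul_self : nullMetric * nullMetric = 1 := by
  ext i j
  fin_cases i <;> fin_cases j <;> simp [nullMetric, Matrix.mul_apply, Fin.sum_univ_four]

theorem nullMetric_mul_nullSD :
    nullMetric * nullSD = Matrix.diagonal ![1, -1, 1, -1] := by
  ext i j
  fin_cases i <;> fin_cases j <;> simp [nullMetric, nullSD, Matrix.mul_apply, Fin.sum_univ_four]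

theorem nullMetric_mul_nullPlane :
    nullMetric * nullPlane = Matrix.diagonal ![1, -1, 0, 0] := by
  ext i j
  fin_cases i <;> fin_cases j <;> simp [nullMetric, nullPlane, Matrix.mul_apply, Fin.sum_univ_four]

/-- The components of a family of 2-tensors (a 3-tensor) in a frame. -/
def pull3 (E : Tensor2 ℂ) (A : Fin 4 → Tensor2 ℂ) (i : Fin 4) : Tensor2 ℂ :=
  E.transpose * (∑ a, E a i • A a) * E

/-- The inverse of a null frame. -/
def coframe (g E : Tensor2 ℂ) : Tensor2 ℂ := nullMetric * E.transpose * g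

namespace IsNullFrame

variable {g J U E : Tensor2 ℂ}

theorem coframe_mul (h : IsNullFrame g J U E) : coframe g E * E = 1 := by
  rw [coframe, mul_assoc, mul_assoc, ← mul_assoc E.transpose, h.metric, nullMetric_mul_self]

theorem mul_coframe (h : IsNullFrame g J U E) : E * coframe g E = 1 :=
  mul_eq_one_comm.1 h.coframe_mul

theorem inv_metric (h : IsNullFrame g J U E) : g⁻¹ = E * nullMetric * E.transpose := by
  refine Matrix.inv_eq_left_inv ?_
  have := h.mul_coframe
  rw [coframe] at this
  simpa only [mul_assoc] using this

theorem coframe_mul_inv (h : IsNullFrame g J U E) :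
    coframe g E * g⁻¹ = nullMetric * E.transpose := by
  rw [h.inv_metric, mul_assoc E, ← mul_assoc, h.coframe_mul, one_mul]

theorem transpose_mul_metric :
    E.transpose * g = nullMetric * coframe g E := by
  rw [coframe, ← mul_assoc, ← mul_assoc, nullMetric_mul_self, one_mul]

theorem conj_inj (h : IsNullFrame g J U E) {A B : Tensor2 ℂ}
    (e : coframe g E * A * E = coframe g E * B * E) : A = B := by
  have := congrArg (fun X => E * X * coframe g E) e
  simpa only [← mul_assoc, h.mul_coframe, one_mul, mul_assoc _ E, mul_one] using this

theorem pull_inj (h : IsNullFrame g J U E) {A B : Tensor2 ℂ}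
    (e : E.transpose * A * E = E.transpose * B * E) : A = B := by
  have h2 : (coframe g E).transpose * E.transpose = 1 := by
    rw [← Matrix.transpose_mul, h.mul_coframe, Matrix.transpose_one]
  have := congrArg (fun X => (coframe g E).transpose * X * coframe g E) e
  simpa only [← mul_assoc, h2, one_mul, mul_assoc _ E, h.mul_coframe, mul_one] using this

/-- `pull3` mixes the matrices `A a` through the columns of `E`; the coframe undoes this mixing in
the first slot. -/
theorem pull3_inj (h : IsNullFrame g J U E) {A B : Fin 4 → Tensor2 ℂ}
    (e : ∀ i, pull3 E A i = pull3 E B i) (a : Fin 4) : A a = B a := by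
  have h1 : ∀ i, ∑ a, E a i • A a = ∑ a, E a i • B a := fun i => h.pull_inj (e i)
  have key : ∀ A : Fin 4 → Tensor2 ℂ, A a = ∑ i, coframe g E i a • ∑ c, E c i • A c := by
    intro A
    simp only [Finset.smul_sum, smul_smul]
    rw [Finset.sum_comm]
    simp only [← Finset.sum_smul]
    have : ∀ c, ∑ i, coframe g E i a * E c i = (1 : Tensor2 ℂ) c a := fun c => by
      rw [← h.mul_coframe, Matrix.mul_apply]
      exact Finset.sum_congr rfl fun i _ => mul_comm _ _
    simp only [this, Matrix.one_apply, ite_smul, one_smul, zero_smul]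
    simp
  rw [key A, key B]
  simp only [h1]

/-- The mixed components of the canonical 2-form. -/
theorem conj_canon (h : IsNullFrame g J U E) :
    coframe g E * (g⁻¹ * J) * E = Matrix.diagonal ![1, -1, 1, -1] := by
  rw [← mul_assoc, h.coframe_mul_inv, mul_assoc, mul_assoc, ← mul_assoc E.transpose, h.canon,
    nullMetric_mul_nullSD]

theorem conj_plane (h : IsNullFrame g J U E) :
    coframe g E * (g⁻¹ * U) * E = Matrix.diagonal ![1, -1, 0, 0] := by
  rw [← mul_assoc, h.coframe_mul_inv, mul_assoc, mul_assoc, ← mul_assoc E.transpose, h.plane,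
    nullMetric_mul_nullPlane]

theorem conj_mul (h : IsNullFrame g J U E) (A B : Tensor2 ℂ) :
    coframe g E * (A * B) * E = (coframe g E * A * E) * (coframe g E * B * E) := by
  simp only [mul_assoc, ← mul_assoc E (coframe g E), h.mul_coframe, one_mul]

theorem conj_proj (h : IsNullFrame g J U E) :
    coframe g E * (g⁻¹ * (U * g⁻¹ * U)) * E = Matrix.diagonal ![1, 1, 0, 0] := by
  have : g⁻¹ * (U * g⁻¹ * U) = (g⁻¹ * U) * (g⁻¹ * U) := by simp only [mul_assoc]
  rw [this, h.conj_mul, h.conj_plane, Matrix.diagonal_mul_diagonal]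
  congr 1; ext i; fin_cases i <;> simp

/-- Together with `canon_comm_proj`, `canon_skew` and `proj_idem`, this is a frame-free consequence
of having a frame. The first three hold at every point of a domain and are later differentiated as
identities between fields. -/
theorem canon_sq (h : IsNullFrame g J U E) : (g⁻¹ * J) * (g⁻¹ * J) = 1 := by
  apply h.conj_inj
  rw [h.conj_mul, h.conj_canon, mul_one, h.coframe_mul, Matrix.diagonal_mul_diagonal,
    ← Matrix.diagonal_one]
  congr 1; ext i; fin_cases i <;> simp

theorem canon_comm_proj (h : IsNullFrame g J U E) :
    (g⁻¹ * J) * (g⁻¹ * (U * g⁻¹ * U)) = (g⁻¹ * (U * g⁻¹ * U)) * (g⁻¹ * J) := by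
  apply h.conj_inj
  rw [h.conj_mul (g⁻¹ * J), h.conj_mul _ (g⁻¹ * J), h.conj_canon, h.conj_proj,
    Matrix.diagonal_mul_diagonal, Matrix.diagonal_mul_diagonal]
  congr 1; ext i; fin_cases i <;> simp

theorem canon_skew (h : IsNullFrame g J U E) : J.transpose = -J := by
  apply h.pull_inj
  have h1 : E.transpose * J.transpose * E = (E.transpose * J * E).transpose := by
    simp only [Matrix.transpose_mul, Matrix.transpose_transpose, mul_assoc]
  rw [h1, mul_neg, neg_mul, h.canon]
  ext i j
  fin_cases i <;> fin_cases j <;> simp [nullSD]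

theorem proj_idem (h : IsNullFrame g J U E) :
    (g⁻¹ * (U * g⁻¹ * U)) * (g⁻¹ * (U * g⁻¹ * U)) = g⁻¹ * (U * g⁻¹ * U) := by
  apply h.conj_inj
  rw [h.conj_mul, h.conj_proj, Matrix.diagonal_mul_diagonal]
  congr 1; ext i; fin_cases i <;> simp

end IsNullFrame

/-! ### Umbilical distributions -/

section

variable {g : Coord → Tensor2 ℝ} {D : Set Coord} {y : Coord}

/-- `secondFund` differentiates the columns of `p` as vector fields, so compared with the covariant
derivative of the endomorphism it has an extra term p·Γ. The complementary projector kills that term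
since (1 − p)p = 0, and the tensorial expression is left. -/
theorem secondFund_cplx (p : Coord → Tensor2 ℝ)
    (hp : ∀ a b, ContDiffAt ℝ ∞ (fun z => p z a b) y)
    (hpp : cplx2 (p y) * cplx2 (p y) = cplx2 (p y)) (a b c : Fin 4) :
    (secondFund g p y a b c : ℂ) = ∑ m, cplx2 (p y) m a *
      ((1 - cplx2 (p y)) * covEnd g (fun z => cplx2 (p z)) y m) c b := by
  have h0 : (1 - cplx2 (p y)) * cplx2 (p y) = 0 := by rw [sub_mul, one_mul, hpp, sub_self]
  have h1 : ∀ m d, (nablaVec g (fun z e => p z e b) y m d : ℂ) =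
      (covEnd g (fun z => cplx2 (p z)) y m + cplx2 (p y) * gam g y m) d b := by
    intro m d
    have : matPd m (fun z => cplx2 (p z)) y d b = ((pd m (fun z => p z d b) y : ℝ) : ℂ) :=
      pd_ofReal (hp d b).diffAt m
    rw [covEnd, sub_add_cancel, Matrix.add_apply, this]
    simp [nablaVec, Matrix.mul_apply, gam, cplx2]
  have h2 : ∀ m, (1 - cplx2 (p y)) * covEnd g (fun z => cplx2 (p z)) y m =
      (1 - cplx2 (p y)) * (covEnd g (fun z => cplx2 (p z)) y m + cplx2 (p y) * gam g y m) := by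
    intro m
    rw [mul_add, ← mul_assoc, h0, zero_mul, add_zero]
  have h3 : ∀ d, (((1 - p y) c d : ℝ) : ℂ) = (1 - cplx2 (p y)) c d := by
    intro d
    simp [Matrix.sub_apply, Matrix.one_apply, cplx2, apply_ite (fun x : ℝ => (x : ℂ))]
  have h4 : ∀ m, ((1 - cplx2 (p y)) * covEnd g (fun z => cplx2 (p z)) y m) c b =
      ∑ d, (1 - cplx2 (p y)) c d *
        (covEnd g (fun z => cplx2 (p z)) y m + cplx2 (p y) * gam g y m) d b := by
    intro m
    rw [h2, Matrix.mul_apply]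
  simp only [h4, secondFund]
  push_cast
  simp only [h1, h3, Finset.mul_sum]
  rw [Finset.sum_comm]
  refine Finset.sum_congr rfl fun m _ => Finset.sum_congr rfl fun d _ => ?_
  simp only [cplx2]; ring

/-- Along a null direction of an umbilical plane the second fundamental form vanishes. -/
theorem umbilical_null (p : Coord → Tensor2 ℝ)
    (hp : ∀ a b, ContDiffAt ℝ ∞ (fun z => p z a b) y)
    (hpp : cplx2 (p y) * cplx2 (p y) = cplx2 (p y))
    (hum : ∀ a b c, secondFundTraceless g p y a b c = 0) (u : Fin 4 → ℂ)
    (hu : (cplx2 (p y)).mulVec u = u) (hn : dotProduct u ((cplx2 (g y)).mulVec u) = 0) :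
    (1 - cplx2 (p y)).mulVec
      ((∑ m, u m • covEnd g (fun z => cplx2 (p z)) y m).mulVec u) = 0 := by
  ext c
  have h1 : ∑ a, ∑ b, u a * u b * (secondFundTraceless g p y a b c : ℂ) = 0 := by
    simp [hum]
  -- The trace part of S, evaluated on (u, u), is a multiple of g(u, u) = 0; and on equal arguments
  -- S coincides with the unsymmetrized form. The vector may be complex, as the null vectors of the
  -- space-like plane are.
  have h2 : ∑ a, ∑ b, u a * u b * (((g y * p y) a b : ℝ) : ℂ) = 0 := by
    have e : cplx2 (g y) * cplx2 (p y) = cplx2 (g y * p y) :=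
      (map_mul Complex.ofRealHom.mapMatrix (g y) (p y)).symm
    rw [← hu, Matrix.mulVec_mulVec, e, hu] at hn
    rw [← hn]
    simp only [dotProduct, Matrix.mulVec, Finset.mul_sum, cplx2]
    exact Finset.sum_congr rfl fun a _ => Finset.sum_congr rfl fun b _ => by ring
  have h3 : ∑ a, ∑ b, u a * u b * (secondFund g p y a b c : ℂ) = 0 := by
    have hs : ∑ a, ∑ b, u a * u b * (secondFund g p y b a c : ℂ) =
        ∑ a, ∑ b, u a * u b * (secondFund g p y a b c : ℂ) := by
      rw [Finset.sum_comm]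
      exact Finset.sum_congr rfl fun a _ => Finset.sum_congr rfl fun b _ => by ring
    set τ : ℂ := ((∑ m, ∑ n, (g y)⁻¹ m n * secondFundSymm g p y m n c : ℝ) : ℂ) with hτ
    have h4 : ∀ a b, u a * u b * (secondFundTraceless g p y a b c : ℂ) =
        (1 / 2) * (u a * u b * (secondFund g p y a b c : ℂ))
        + (1 / 2) * (u a * u b * (secondFund g p y b a c : ℂ))
        - (1 / 2) * τ * (u a * u b * (((g y * p y) a b : ℝ) : ℂ)) := by
      intro a b
      rw [hτ, secondFundTraceless, secondFundSymm]
      push_cast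
      ring
    simp only [h4, Finset.sum_add_distrib, Finset.sum_sub_distrib, ← Finset.mul_sum, hs, h2] at h1
    linear_combination h1
  rw [Pi.zero_apply, ← h3]
  have hl : ∀ C : Fin 4 → Tensor2 ℂ, ((1 - cplx2 (p y)).mulVec ((∑ m, u m • C m).mulVec u)) c =
      ∑ m, u m * (((1 - cplx2 (p y)) * C m).mulVec u) c := by
    intro C
    rw [Matrix.mulVec_mulVec, Matrix.mul_sum]
    simp only [Matrix.mul_smul, Matrix.mulVec, dotProduct, Matrix.sum_apply, Matrix.smul_apply,
      smul_eq_mul, Finset.sum_mul, Finset.mul_sum, mul_assoc]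
    rw [Finset.sum_comm]
  rw [hl]
  simp only [secondFund_cplx p hp hpp]
  -- The projector acting on the direction of differentiation is absorbed by p u = u.
  have hu' : ∀ m, u m = ∑ a, cplx2 (p y) m a * u a := fun m => (congrFun hu m).symm
  calc _ = ∑ m, (∑ a, cplx2 (p y) m a * u a) *
        (((1 - cplx2 (p y)) * covEnd g (fun z => cplx2 (p z)) y m).mulVec u) c := by
        simp only [← hu']
    _ = _ := by
      simp only [Matrix.mulVec, dotProduct, Finset.sum_mul, Finset.mul_sum]
      rw [Finset.sum_congr rfl fun m _ => Finset.sum_comm, Finset.sum_comm]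
      refine Finset.sum_congr rfl fun a _ => ?_
      rw [Finset.sum_comm]
      refine Finset.sum_congr rfl fun b _ => Finset.sum_congr rfl fun m _ => ?_
      ring

end

theorem planeProj_cplx (g U : Coord → Tensor2 ℝ) (z : Coord) :
    cplx2 (planeProj g U z) =
      (cplx2 (g z))⁻¹ * (cplx2 (U z) * (cplx2 (g z))⁻¹ * cplx2 (U z)) := by
  have h : ∀ A B : Tensor2 ℝ, cplx2 (A * B) = cplx2 A * cplx2 B :=
    map_mul Complex.ofRealHom.mapMatrix
  rw [planeProj, h, h, h, cplx2_inv]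

theorem cplx2_one_sub (A : Tensor2 ℝ) : cplx2 (1 - A) = 1 - cplx2 A :=
  (map_sub Complex.ofRealHom.mapMatrix 1 A).trans (by rw [map_one]; rfl)

/-! ### Components of 3-tensors in a frame. -/

theorem pull3_vecMulVec_left (E A : Tensor2 ℂ) (w : Fin 4 → ℂ) (i : Fin 4) :
    pull3 E (fun a => Matrix.vecMulVec (A a) w) i =
      Matrix.vecMulVec ((E.transpose * A * E) i) (Matrix.vecMul w E) := by
  ext j k
  have h1 : ∑ a, E a i • Matrix.vecMulVec (A a) w = Matrix.vecMulVec ((E.transpose * A) i) w := by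
    ext b c
    simp [Matrix.sum_apply, Matrix.vecMulVec_apply, Matrix.mul_apply, Finset.sum_mul, mul_assoc]
  rw [pull3, h1, Matrix.mul_vecMulVec, Matrix.vecMulVec_mul]
  simp [Matrix.vecMulVec_apply, Matrix.mulVec, dotProduct, Matrix.mul_apply (N := E),
    mul_comm]

theorem pull3_vecMulVec_right (E A : Tensor2 ℂ) (w : Fin 4 → ℂ) (i : Fin 4) :
    pull3 E (fun a => Matrix.vecMulVec w (A a)) i =
      Matrix.vecMulVec (Matrix.vecMul w E) ((E.transpose * A * E) i) := by
  have h1 : (fun a => Matrix.vecMulVec w (A a)) =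
      fun a => (Matrix.vecMulVec (A a) w).transpose := by
    funext a; ext b c; simp [Matrix.vecMulVec_apply, mul_comm]
  have h2 : ∀ B : Fin 4 → Tensor2 ℂ, pull3 E (fun a => (B a).transpose) i =
      (pull3 E B i).transpose := by
    intro B
    simp only [pull3, Matrix.transpose_mul, Matrix.transpose_transpose, Matrix.transpose_sum,
      Matrix.transpose_smul, mul_assoc]
  rw [h1, h2, pull3_vecMulVec_left]
  ext b c; simp [Matrix.vecMulVec_apply, mul_comm]

theorem pull3_add (E : Tensor2 ℂ) (A B : Fin 4 → Tensor2 ℂ) (i : Fin 4) :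
    pull3 E (fun a => A a + B a) i = pull3 E A i + pull3 E B i := by
  simp only [pull3, smul_add, Finset.sum_add_distrib, mul_add, add_mul]

theorem pull3_sub (E : Tensor2 ℂ) (A B : Fin 4 → Tensor2 ℂ) (i : Fin 4) :
    pull3 E (fun a => A a - B a) i = pull3 E A i - pull3 E B i := by
  simp only [pull3, smul_sub, Finset.sum_sub_distrib, mul_sub, sub_mul]

theorem pull3_neg (E : Tensor2 ℂ) (A : Fin 4 → Tensor2 ℂ) (i : Fin 4) :
    pull3 E (fun a => -A a) i = -pull3 E A i := by
  simp only [pull3, smul_neg, Finset.sum_neg_distrib, mul_neg, neg_mul]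

theorem pull3_contract (E : Tensor2 ℂ) (A : Fin 4 → Tensor2 ℂ) (j : Fin 4) :
    Matrix.vecMul (fun b => ∑ a, ∑ c, (E * nullMetric * E.transpose) a c * A c a b) E j =
      ∑ p, ∑ r, nullMetric p r * pull3 E A r p j := by
  have h1 : ∀ r p, pull3 E A r p j = ∑ c, E c r * (E.transpose * A c * E) p j := by
    intro r p
    simp [pull3, Matrix.mul_sum, Matrix.sum_mul, Matrix.sum_apply]
  have h2 : ∀ p c, (nullMetric * E.transpose) p c = ∑ r, nullMetric p r * E c r :=
    fun p c => Matrix.mul_apply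
  have h3 : ∀ a c, (E * nullMetric * E.transpose) a c =
      ∑ p, E a p * (nullMetric * E.transpose) p c := by
    intro a c; rw [mul_assoc, Matrix.mul_apply]
  have h4 : ∀ c p, (E.transpose * A c * E) p j = ∑ a, E a p * (A c * E) a j := by
    intro c p; rw [mul_assoc, Matrix.mul_apply]; rfl
  calc _ = ∑ a, ∑ c, (E * nullMetric * E.transpose) a c * (A c * E) a j := by
        simp only [Matrix.vecMul, dotProduct, Finset.sum_mul, Matrix.mul_apply (M := A _),
          Finset.mul_sum]
        rw [Finset.sum_comm]
        refine Finset.sum_congr rfl fun a _ => ?_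
        rw [Finset.sum_comm]
        exact Finset.sum_congr rfl fun c _ => Finset.sum_congr rfl fun b _ => by ring
    _ = ∑ p, ∑ c, (nullMetric * E.transpose) p c * (E.transpose * A c * E) p j := by
        simp only [h3, h4, Finset.sum_mul, Finset.mul_sum]
        rw [Finset.sum_congr rfl fun a _ => Finset.sum_comm, Finset.sum_comm]
        refine Finset.sum_congr rfl fun p _ => ?_
        rw [Finset.sum_comm]
        exact Finset.sum_congr rfl fun c _ => Finset.sum_congr rfl fun b _ => by ring
    _ = _ := by
        simp only [h1, h2, Finset.sum_mul, Finset.mul_sum]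
        refine Finset.sum_congr rfl fun p _ => ?_
        rw [Finset.sum_comm]
        exact Finset.sum_congr rfl fun c _ => Finset.sum_congr rfl fun b _ => by ring

/-! ### The covariant derivative of the canonical 2-form. -/

/-- A smooth field of umbilical 2+2 structures on an open subset of the coordinate space, with the
volume element `U` of the time-like plane and the self-dual 2-form `J` of square one. -/
structure IsUmbilicalField (g : Coord → Tensor2 ℝ) (J : Coord → Tensor2 ℂ)
    (U : Coord → Tensor2 ℝ) (D : Set Coord) : Prop where
  metric : IsSmoothMetric g D
  canon_smooth : ∀ z ∈ D, MatSmoothAt J z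
  plane_smooth : ∀ z ∈ D, ∀ a b, ContDiffAt ℝ ∞ (fun x => U x a b) z
  frame : ∀ z ∈ D, ∃ E, IsNullFrame (cplx2 (g z)) (J z) (cplx2 (U z)) E
  umbilical : ∀ z ∈ D, ∀ a b c, secondFundTraceless g (planeProj g U) z a b c = 0
  umbilical_compl : ∀ z ∈ D, ∀ a b c,
    secondFundTraceless g (fun x => 1 - planeProj g U x) z a b c = 0

/-- The 1-form `½ δJ`. -/
noncomputable def leeForm (g : Coord → Tensor2 ℝ) (J : Coord → Tensor2 ℂ) (y : Coord) :
    Fin 4 → ℂ :=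
  fun b => (1 / 2) * codiff2 g J y b

/-- The 1-form `½ i_{δJ} J`. -/
noncomputable def dualLeeForm (g : Coord → Tensor2 ℝ) (J : Coord → Tensor2 ℂ) (y : Coord) :
    Fin 4 → ℂ :=
  Matrix.vecMul (leeForm g J y) (cplx2 (g y)⁻¹ * J y)

/-- Here `c i` and `p i` are the mixed components of ∇_i J and ∇_i v. Anticommutation with
diag(1,−1,1,−1) removes every entry of `c i` joining two equal signs, and skewness of the lowered
tensor leaves only the slots (0,2) and (1,3). Differentiating Jv = vJ identifies these, up to a
factor ±2, with entries of `p i`, where umbilicity supplies the four zeros. -/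
theorem frame_form_of_umbilical {c p : Fin 4 → Tensor2 ℂ}
    (hs : ∀ i, (nullMetric * c i).transpose = -(nullMetric * c i))
    (h1 : ∀ i, c i * Matrix.diagonal ![1, -1, 1, -1] + Matrix.diagonal ![1, -1, 1, -1] * c i = 0)
    (h2 : ∀ i, c i * Matrix.diagonal ![1, 1, 0, 0] + Matrix.diagonal ![1, -1, 1, -1] * p i =
      p i * Matrix.diagonal ![1, -1, 1, -1] + Matrix.diagonal ![1, 1, 0, 0] * c i)
    (p0 : p 0 3 0 = 0) (p1 : p 1 2 1 = 0) (p2 : p 2 1 2 = 0) (p3 : p 3 0 3 = 0) :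
    ∃ β γ : Fin 4 → ℂ, β 0 = 0 ∧ β 2 = 0 ∧ γ 1 = 0 ∧ γ 3 = 0 ∧ ∀ i, nullMetric * c i =
      !![0, 0, β i, 0; 0, 0, 0, γ i; -β i, 0, 0, 0; 0, -γ i, 0, 0] := by
  have e1 : ∀ i a b, c i a b * (![1, -1, 1, -1] : Fin 4 → ℂ) b
      + (![1, -1, 1, -1] : Fin 4 → ℂ) a * c i a b = 0 := by
    intro i a b
    simpa [Matrix.add_apply, Matrix.mul_diagonal, Matrix.diagonal_mul] using
      congrFun (congrFun (h1 i) a) b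
  have e2 : ∀ i a b, c i a b * (![1, 1, 0, 0] : Fin 4 → ℂ) b
      + (![1, -1, 1, -1] : Fin 4 → ℂ) a * p i a b =
      p i a b * (![1, -1, 1, -1] : Fin 4 → ℂ) b + (![1, 1, 0, 0] : Fin 4 → ℂ) a * c i a b := by
    intro i a b
    simpa [Matrix.add_apply, Matrix.mul_diagonal, Matrix.diagonal_mul] using
      congrFun (congrFun (h2 i) a) b
  have s : ∀ i a b, (nullMetric * c i) b a = -(nullMetric * c i) a b := fun i a b =>
    congrFun (congrFun (hs i) a) b
  have m0 : ∀ i b, (nullMetric * c i) 0 b = c i 1 b := fun i b => by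
    simp [nullMetric, Matrix.mul_apply, Fin.sum_univ_four]
  have m1 : ∀ i b, (nullMetric * c i) 1 b = c i 0 b := fun i b => by
    simp [nullMetric, Matrix.mul_apply, Fin.sum_univ_four]
  have m2 : ∀ i b, (nullMetric * c i) 2 b = c i 3 b := fun i b => by
    simp [nullMetric, Matrix.mul_apply, Fin.sum_univ_four]
  have m3 : ∀ i b, (nullMetric * c i) 3 b = c i 2 b := fun i b => by
    simp [nullMetric, Matrix.mul_apply, Fin.sum_univ_four]
  have diag : ∀ i a, (nullMetric * c i) a a = 0 := fun i a => by
    have := s i a a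
    linear_combination (1 / 2) * this
  have z11 : ∀ i, c i 1 1 = 0 := fun i => by
    simpa using e1 i 1 1
  have z13 : ∀ i, c i 1 3 = 0 := fun i => by
    simpa using e1 i 1 3
  have z02 : ∀ i, c i 0 2 = 0 := fun i => by
    simpa using e1 i 0 2
  have z33 : ∀ i, c i 3 3 = 0 := fun i => by
    simpa using e1 i 3 3
  have c30 : ∀ i, c i 3 0 = 2 * p i 3 0 := fun i => by
    have := e2 i 3 0; simp at this; linear_combination this
  have c21 : ∀ i, c i 2 1 = -2 * p i 2 1 := fun i => by
    have := e2 i 2 1; simp at this; linear_combination this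
  have c12 : ∀ i, c i 1 2 = -2 * p i 1 2 := fun i => by
    have := e2 i 1 2; simp at this; linear_combination -this
  have c03 : ∀ i, c i 0 3 = 2 * p i 0 3 := fun i => by
    have := e2 i 0 3; simp at this; linear_combination -this
  refine ⟨fun i => c i 1 2, fun i => c i 0 3, ?_, ?_, ?_, ?_, ?_⟩
  · have := s 0 0 2
    rw [m2, m0, c30, p0] at this
    show c 0 1 2 = 0
    linear_combination this
  · show c 2 1 2 = 0
    rw [c12, p2, mul_zero]
  · have := s 1 1 3
    rw [m3, m1, c21, p1] at this
    show c 1 0 3 = 0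
    linear_combination this
  · show c 3 0 3 = 0
    rw [c03, p3, mul_zero]
  · intro i
    ext a b
    fin_cases a <;> fin_cases b <;>
      simp only [Fin.zero_eta, Fin.mk_one, Fin.reduceFinMk, Matrix.of_apply, Matrix.cons_val]
    · exact diag i 0
    · rw [m0, z11]
    · rw [m0]
    · rw [m0, z13]
    · rw [s i 0 1, m0, z11, neg_zero]
    · exact diag i 1
    · rw [m1, z02]
    · rw [m1]
    · rw [s i 0 2, m0]
    · rw [s i 1 2, m1, z02, neg_zero]
    · exact diag i 2
    · rw [m2, z33]
    · rw [s i 0 3, m0, z13, neg_zero]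
    · rw [s i 1 3, m1]
    · rw [s i 2 3, m2, z33, neg_zero]
    · exact diag i 3

theorem sum_smul_mul_add_mul (w : Fin 4 → ℂ) (A B : Fin 4 → Tensor2 ℂ) (X Y : Tensor2 ℂ) :
    ∑ a, w a • (A a * X + Y * B a) = (∑ a, w a • A a) * X + Y * ∑ a, w a • B a := by
  simp only [smul_add, Finset.sum_add_distrib, Finset.sum_mul, Finset.mul_sum,
    Matrix.smul_mul, Matrix.mul_smul]

namespace IsUmbilicalField

variable {g : Coord → Tensor2 ℝ} {J : Coord → Tensor2 ℂ} {U : Coord → Tensor2 ℝ}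
  {D : Set Coord} {y : Coord}

theorem mem_nhds (h : IsUmbilicalField g J U D) (hy : y ∈ D) : D ∈ nhds y :=
  h.metric.isOpen.mem_nhds hy

theorem mixed_smooth (h : IsUmbilicalField g J U D) (hy : y ∈ D) :
    MatSmoothAt (fun z => cplx2 (g z)⁻¹ * J z) y :=
  (h.metric.cplx_inv hy).mul (h.canon_smooth y hy)

theorem proj_smooth (h : IsUmbilicalField g J U D) (hy : y ∈ D) (a b : Fin 4) :
    ContDiffAt ℝ ∞ (fun z => planeProj g U z a b) y := by
  simp only [planeProj, Matrix.mul_apply]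
  exact ContDiffAt.sum fun i _ => (h.metric.inv_smooth hy a i).mul <| ContDiffAt.sum fun j _ =>
    (ContDiffAt.sum fun k _ => (h.plane_smooth y hy i k).mul (h.metric.inv_smooth hy k j)).mul
      (h.plane_smooth y hy j b)

theorem proj_smooth_cplx (h : IsUmbilicalField g J U D) (hy : y ∈ D) :
    MatSmoothAt (fun z => cplx2 (planeProj g U z)) y :=
  fun a b => (h.proj_smooth hy a b).ofReal

theorem lower_mixed (h : IsUmbilicalField g J U D) (hy : y ∈ D) :
    cplx2 (g y) * (cplx2 (g y)⁻¹ * J y) = J y := by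
  rw [cplx2_inv, ← mul_assoc,
    Matrix.mul_nonsing_inv _ (isUnit_iff_ne_zero.2 (h.metric.cplx_det_ne hy)), one_mul]

theorem cov2_eq_lower (h : IsUmbilicalField g J U D) (hy : y ∈ D) (a : Fin 4) :
    cov2 g J y a = cplx2 (g y) * covEnd g (fun z => cplx2 (g z)⁻¹ * J z) y a := by
  rw [← h.metric.cov2_lower hy (h.mixed_smooth hy)]
  exact cov2_congr (Filter.eventually_of_mem (h.mem_nhds hy) fun z hz =>
    (h.lower_mixed hz).symm) a

theorem cov2_skew (h : IsUmbilicalField g J U D) (hy : y ∈ D) (a : Fin 4) :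
    (cov2 g J y a).transpose = -cov2 g J y a := by
  rw [← cov2_transpose, ← cov2_neg]
  refine cov2_congr (Filter.eventually_of_mem (h.mem_nhds hy) fun z hz => ?_) a
  obtain ⟨E, hE⟩ := h.frame z hz
  exact hE.canon_skew

theorem covEnd_anticomm (h : IsUmbilicalField g J U D) (hy : y ∈ D) (a : Fin 4) :
    covEnd g (fun z => cplx2 (g z)⁻¹ * J z) y a * (cplx2 (g y)⁻¹ * J y) +
      (cplx2 (g y)⁻¹ * J y) * covEnd g (fun z => cplx2 (g z)⁻¹ * J z) y a = 0 := by
  rw [← covEnd_mul (h.mixed_smooth hy) (h.mixed_smooth hy), ← covEnd_one (g := g) (y := y) a]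
  refine covEnd_congr (Filter.eventually_of_mem (h.mem_nhds hy) fun z hz => ?_) a
  obtain ⟨E, hE⟩ := h.frame z hz
  simp only [cplx2_inv]
  exact hE.canon_sq

theorem covEnd_proj (h : IsUmbilicalField g J U D) (hy : y ∈ D) (a : Fin 4) :
    covEnd g (fun z => cplx2 (g z)⁻¹ * J z) y a * cplx2 (planeProj g U y) +
      (cplx2 (g y)⁻¹ * J y) * covEnd g (fun z => cplx2 (planeProj g U z)) y a =
    covEnd g (fun z => cplx2 (planeProj g U z)) y a * (cplx2 (g y)⁻¹ * J y) +
      cplx2 (planeProj g U y) * covEnd g (fun z => cplx2 (g z)⁻¹ * J z) y a := by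
  rw [← covEnd_mul (h.mixed_smooth hy) (h.proj_smooth_cplx hy),
    ← covEnd_mul (h.proj_smooth_cplx hy) (h.mixed_smooth hy)]
  refine covEnd_congr (Filter.eventually_of_mem (h.mem_nhds hy) fun z hz => ?_) a
  obtain ⟨E, hE⟩ := h.frame z hz
  simp only [cplx2_inv, planeProj_cplx]
  exact hE.canon_comm_proj

/-- The zeros of β and γ are the umbilicity conditions: e₀, e₁ are the null vectors of V and e₂, e₃
those of H, and each contributes one vanishing component. -/
theorem null_frame_form (h : IsUmbilicalField g J U D) (hy : y ∈ D) {E : Tensor2 ℂ}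
    (hE : IsNullFrame (cplx2 (g y)) (J y) (cplx2 (U y)) E) :
    ∃ β γ : Fin 4 → ℂ, β 0 = 0 ∧ β 2 = 0 ∧ γ 1 = 0 ∧ γ 3 = 0 ∧ ∀ i, pull3 E (cov2 g J y) i =
      !![0, 0, β i, 0; 0, 0, 0, γ i; -β i, 0, 0, 0; 0, -γ i, 0, 0] := by
  set F := coframe (cplx2 (g y)) E with hF
  set T := fun z => cplx2 (g z)⁻¹ * J z with hT
  set v := fun z => cplx2 (planeProj g U z) with hv
  set c : Fin 4 → Tensor2 ℂ := fun i => F * (∑ a, E a i • covEnd g T y a) * E with hc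
  set p : Fin 4 → Tensor2 ℂ := fun i => F * (∑ a, E a i • covEnd g v y a) * E with hp
  have cm : ∀ A B, F * (A * B) * E = (F * A * E) * (F * B * E) := hE.conj_mul
  have hTy : F * T y * E = Matrix.diagonal ![1, -1, 1, -1] := by
    simp only [hT, cplx2_inv]; exact hE.conj_canon
  have hvy : F * v y * E = Matrix.diagonal ![1, 1, 0, 0] := by
    simp only [hv, planeProj_cplx]; exact hE.conj_proj
  have hb : ∀ i, pull3 E (cov2 g J y) i = nullMetric * c i := by
    intro i
    simp only [pull3, h.cov2_eq_lower hy, hc, ← Matrix.mul_smul, ← Matrix.mul_sum]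
    rw [← mul_assoc E.transpose, IsNullFrame.transpose_mul_metric]
    simp only [mul_assoc]; rfl
  have hs : ∀ i, (nullMetric * c i).transpose = -(nullMetric * c i) := by
    intro i
    rw [← hb]
    simp only [pull3, Matrix.transpose_mul, Matrix.transpose_transpose, Matrix.transpose_sum,
      Matrix.transpose_smul, h.cov2_skew hy, smul_neg, Finset.sum_neg_distrib, mul_neg, neg_mul,
      mul_assoc]
  have h1 : ∀ i, c i * Matrix.diagonal ![1, -1, 1, -1] +
      Matrix.diagonal ![1, -1, 1, -1] * c i = 0 := by
    intro i
    have : ∑ a, E a i • (covEnd g T y a * T y + T y * covEnd g T y a) = 0 :=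
      Finset.sum_eq_zero fun a _ => by rw [h.covEnd_anticomm hy, smul_zero]
    rw [sum_smul_mul_add_mul] at this
    have := congrArg (fun X => F * X * E) this
    rw [mul_add, add_mul, cm _ (T y), cm (T y), hTy, mul_zero, zero_mul] at this
    exact this
  have h2 : ∀ i, c i * Matrix.diagonal ![1, 1, 0, 0] + Matrix.diagonal ![1, -1, 1, -1] * p i =
      p i * Matrix.diagonal ![1, -1, 1, -1] + Matrix.diagonal ![1, 1, 0, 0] * c i := by
    intro i
    have : ∑ a, E a i • (covEnd g T y a * v y + T y * covEnd g v y a) =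
        ∑ a, E a i • (covEnd g v y a * T y + v y * covEnd g T y a) :=
      Finset.sum_congr rfl fun a _ => by rw [h.covEnd_proj hy]
    rw [sum_smul_mul_add_mul, sum_smul_mul_add_mul] at this
    have := congrArg (fun X => F * X * E) this
    rw [mul_add, add_mul, mul_add, add_mul, cm _ (v y), cm (T y), cm _ (T y), cm (v y), hTy,
      hvy] at this
    exact this
  have hvv : v y * v y = v y := by
    simp only [hv, planeProj_cplx]; exact hE.proj_idem
  have hvE : v y * E = E * Matrix.diagonal ![1, 1, 0, 0] := by
    rw [← hvy, ← mul_assoc, ← mul_assoc, hE.mul_coframe, one_mul]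
  have hFv : F * v y = Matrix.diagonal ![1, 1, 0, 0] * F := by
    rw [← hvy, mul_assoc, hE.mul_coframe, mul_one]
  have hnull : ∀ i, dotProduct (fun a => E a i) ((cplx2 (g y)).mulVec fun a => E a i) =
      nullMetric i i := by
    intro i
    rw [← hE.metric, mul_assoc, Matrix.mul_apply]; rfl
  have col : ∀ (X : Tensor2 ℂ) i, X.mulVec (fun a => E a i) = fun a => (X * E) a i :=
    fun X i => rfl
  have hn : ∀ i, nullMetric i i = 0 := by
    intro i; fin_cases i <;> simp [nullMetric]
  -- For a null vector e_i of the time-like plane, (∇_i v) e_i has no component along the orthogonal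
  -- plane.
  have pV : ∀ i : Fin 4, (![1, 1, 0, 0] : Fin 4 → ℂ) i = 1 → ∀ k : Fin 4,
      (1 - (![1, 1, 0, 0] : Fin 4 → ℂ) k) * p i k i = 0 := by
    intro i hi k
    have hu : (v y).mulVec (fun a => E a i) = fun a => E a i := by
      rw [col, hvE]; funext a; rw [Matrix.mul_diagonal, hi, mul_one]
    have := umbilical_null (planeProj g U) (h.proj_smooth hy) hvv (h.umbilical y hy)
      (fun a => E a i) hu (by rw [hnull, hn])
    rw [Matrix.mulVec_mulVec, col] at this
    have h3 : F * ((1 - v y) * (∑ a, E a i • covEnd g v y a)) * E =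
        (1 - Matrix.diagonal ![1, 1, 0, 0]) * p i := by
      rw [← mul_assoc, mul_sub, mul_one, hFv]
      simp only [hp, sub_mul, one_mul, mul_assoc]
    have h4 := congrFun (congrFun h3 k) i
    have hz : ∀ a, ((1 - v y) * (∑ a, E a i • covEnd g v y a) * E) a i = 0 :=
      fun a => congrFun this a
    rw [mul_assoc, Matrix.mul_apply, Finset.sum_eq_zero fun a _ => by rw [hz, mul_zero]] at h4
    rw [sub_mul, one_mul, Matrix.sub_apply, Matrix.diagonal_mul] at h4
    linear_combination -h4
  -- The same for the orthogonal plane, whose projector is 1 − v; its derivative is −∇v, so the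
  -- statement is again about `p`.
  have pH : ∀ i : Fin 4, (![1, 1, 0, 0] : Fin 4 → ℂ) i = 0 → ∀ k : Fin 4,
      (![1, 1, 0, 0] : Fin 4 → ℂ) k * p i k i = 0 := by
    intro i hi k
    have hw : ∀ z, cplx2 (1 - planeProj g U z) = 1 - v z := fun z => cplx2_one_sub _
    have hu : (cplx2 (1 - planeProj g U y)).mulVec (fun a => E a i) = fun a => E a i := by
      rw [hw, Matrix.sub_mulVec, Matrix.one_mulVec, col, hvE]
      funext a; rw [Pi.sub_apply, Matrix.mul_diagonal, hi, mul_zero, sub_zero]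
    have hww : cplx2 (1 - planeProj g U y) * cplx2 (1 - planeProj g U y) =
        cplx2 (1 - planeProj g U y) := by
      rw [hw, mul_sub, mul_one, sub_mul, one_mul, hvv, sub_self, sub_zero]
    have := umbilical_null (fun z => 1 - planeProj g U z)
      (fun a b => contDiffAt_const.sub (h.proj_smooth hy a b)) hww (h.umbilical_compl y hy)
      (fun a => E a i) hu (by rw [hnull, hn])
    have hcv : ∀ a, covEnd g (fun z => cplx2 (1 - planeProj g U z)) y a = -covEnd g v y a := by
      intro a
      have e := matPd_sub (A := fun _ => (1 : Tensor2 ℂ)) (B := v) (MatSmoothAt.const 1)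
        (h.proj_smooth_cplx hy) a
      rw [matPd_const, zero_sub] at e
      have e' : (fun z => cplx2 (1 - planeProj g U z)) = fun z => 1 - v z := funext hw
      rw [e', covEnd, covEnd, e]
      noncomm_ring
    rw [hw, sub_sub_cancel, Matrix.mulVec_mulVec, col,
      Finset.sum_congr rfl fun a _ => by rw [hcv, smul_neg], Finset.sum_neg_distrib] at this
    have h3 : F * (v y * -(∑ a, E a i • covEnd g v y a)) * E =
        -(Matrix.diagonal ![1, 1, 0, 0] * p i) := by
      rw [← mul_assoc, hFv]
      simp only [hp, mul_neg, neg_mul, mul_assoc]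
    have h4 := congrFun (congrFun h3 k) i
    have hz : ∀ a, (v y * -(∑ a, E a i • covEnd g v y a) * E) a i = 0 :=
      fun a => congrFun this a
    rw [mul_assoc, Matrix.mul_apply, Finset.sum_eq_zero fun a _ => by rw [hz, mul_zero]] at h4
    rw [Matrix.neg_apply, Matrix.diagonal_mul] at h4
    linear_combination h4
  simp only [hb]
  refine frame_form_of_umbilical hs h1 h2 ?_ ?_ ?_ ?_
  · simpa using pV 0 (by simp) 3
  · simpa using pV 1 (by simp) 2
  · simpa using pH 2 (by simp) 1
  · simpa using pH 3 (by simp) 0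

/-- The covariant derivative of the canonical self-dual 2-form of an umbilical structure. -/
theorem cov2_canon (h : IsUmbilicalField g J U D) (hy : y ∈ D) (a : Fin 4) :
    cov2 g J y a =
      -(Matrix.vecMulVec (cplx2 (g y) a) (leeForm g J y)
        - Matrix.vecMulVec (leeForm g J y) (cplx2 (g y) a)
        + (Matrix.vecMulVec (J y a) (dualLeeForm g J y)
        - Matrix.vecMulVec (dualLeeForm g J y) (J y a))) := by
  obtain ⟨E, hE⟩ := h.frame y hy
  refine hE.pull3_inj (B := fun a => -(Matrix.vecMulVec (cplx2 (g y) a) (leeForm g J y)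
        - Matrix.vecMulVec (leeForm g J y) (cplx2 (g y) a)
        + (Matrix.vecMulVec (J y a) (dualLeeForm g J y)
        - Matrix.vecMulVec (dualLeeForm g J y) (J y a)))) (fun i => ?_) a
  rw [pull3_neg, pull3_add, pull3_sub, pull3_sub, pull3_vecMulVec_left, pull3_vecMulVec_right,
    pull3_vecMulVec_left, pull3_vecMulVec_right, hE.metric, hE.canon]
  obtain ⟨β, γ, b0, b2, c1, c3, hb⟩ := h.null_frame_form hy hE
  -- Each of the four functions that survive umbilicity occurs in exactly one component of the
  -- divergence; hence δJ determines ∇J.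
  have hl : Matrix.vecMul (leeForm g J y) E = (1 / 2 : ℂ) • ![β 3, γ 2, -β 1, -γ 0] := by
    have e1 : leeForm g J y = (-1 / 2 : ℂ) • fun b =>
        ∑ a, ∑ c, (E * nullMetric * E.transpose) a c * cov2 g J y c a b := by
      funext b
      rw [leeForm, codiff2, Pi.smul_apply, cplx2_inv, hE.inv_metric]
      simp only [cov2_apply, smul_eq_mul]
      ring
    ext j
    rw [e1, Matrix.smul_vecMul, Pi.smul_apply, pull3_contract]
    simp only [hb]
    fin_cases j <;> simp [Fin.sum_univ_four, nullMetric, b0, b2, c1, c3] <;> ring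
  -- Contraction with J changes the sign of the components 1 and 3.
  have hk : Matrix.vecMul (dualLeeForm g J y) E = (1 / 2 : ℂ) • ![β 3, -γ 2, -β 1, γ 0] := by
    have : (cplx2 (g y)⁻¹ * J y) * E = E * Matrix.diagonal ![1, -1, 1, -1] := by
      rw [← hE.conj_canon, ← mul_assoc, ← mul_assoc, hE.mul_coframe, one_mul, cplx2_inv]
    rw [dualLeeForm, Matrix.vecMul_vecMul, this, ← Matrix.vecMul_vecMul, hl]
    ext j
    rw [Matrix.vecMul_diagonal]
    fin_cases j <;> simp
  rw [hb, hl, hk]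
  ext j k
  simp only [Matrix.neg_apply, Matrix.add_apply, Matrix.sub_apply, Matrix.vecMulVec_apply,
    Pi.smul_apply, smul_eq_mul]
  fin_cases i <;> fin_cases j <;> fin_cases k <;>
    simp [nullMetric, nullSD, b0, b2, c1, c3] <;> ring

end IsUmbilicalField

/-! ### Components of 4-tensors in a frame -/

/-- The components of a 2-tensor in a frame. -/
def pull2 (E A : Tensor2 ℂ) : Tensor2 ℂ := E.transpose * A * E

/-- The components of a 4-tensor in a frame. -/
def pull4 (E : Tensor2 ℂ) (P : Tensor4 ℂ) : Tensor4 ℂ := fun i j k l =>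
  ∑ a, ∑ b, ∑ c, ∑ d, E a i * E b j * E c k * E d l * P a b c d

/-- A 4-tensor as a matrix with pairs of indices. -/
def flat (P : Tensor4 ℂ) : Matrix (Fin 4 × Fin 4) (Fin 4 × Fin 4) ℂ :=
  Matrix.of fun x y => P x.1 x.2 y.1 y.2

theorem flat_inj {P Q : Tensor4 ℂ} (h : flat P = flat Q) : P = Q := by
  funext a b c d
  exact congrFun (congrFun h (a, b)) (c, d)

theorem pull2_apply (E A : Tensor2 ℂ) (i j : Fin 4) :
    pull2 E A i j = ∑ a, ∑ b, E a i * E b j * A a b := by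
  simp only [pull2, Matrix.mul_apply, Matrix.transpose_apply, Finset.sum_mul]
  rw [Finset.sum_comm]
  exact Finset.sum_congr rfl fun a _ => Finset.sum_congr rfl fun b _ => by ring

section

variable (E : Tensor2 ℂ)

/-- With indices grouped in pairs a change of frame is a matrix congruence by E ⊗ E, so injectivity
and compatibility with composition reduce to matrix algebra. -/
theorem flat_pull4 (P : Tensor4 ℂ) :
    flat (pull4 E P) = (E ⊗ₖ E).transpose * flat P * (E ⊗ₖ E) := by
  ext ⟨i, j⟩ ⟨k, l⟩
  simp only [flat, Matrix.of_apply, pull4, Matrix.mul_apply, Matrix.transpose_apply,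
    Matrix.kroneckerMap_apply, Fintype.sum_prod_type, Finset.sum_mul]
  have e : ∀ f : Fin 4 → Fin 4 → Fin 4 → Fin 4 → ℂ, ∑ c, ∑ d, ∑ a, ∑ b, f a b c d =
      ∑ a, ∑ b, ∑ c, ∑ d, f a b c d := by
    intro f
    rw [Finset.sum_congr rfl fun c _ => Finset.sum_comm, Finset.sum_comm]
    refine Finset.sum_congr rfl fun a _ => ?_
    rw [Finset.sum_congr rfl fun c _ => Finset.sum_comm, Finset.sum_comm]
  rw [e]
  exact Finset.sum_congr rfl fun a _ => Finset.sum_congr rfl fun b _ =>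
    Finset.sum_congr rfl fun c _ => Finset.sum_congr rfl fun d _ => by ring

theorem pull4_swap_left (P : Tensor4 ℂ) (i j k l : Fin 4) :
    pull4 E (fun a b c d => P b a c d) i j k l = pull4 E P j i k l := by
  simp only [pull4]
  rw [Finset.sum_comm]
  exact Finset.sum_congr rfl fun a _ => Finset.sum_congr rfl fun b _ =>
    Finset.sum_congr rfl fun c _ => Finset.sum_congr rfl fun d _ => by ring

theorem pull4_swap_mid (P : Tensor4 ℂ) (i j k l : Fin 4) :
    pull4 E (fun a b c d => P a c b d) i j k l = pull4 E P i k j l := by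
  simp only [pull4]
  refine Finset.sum_congr rfl fun a _ => ?_
  rw [Finset.sum_comm]
  exact Finset.sum_congr rfl fun b _ =>
    Finset.sum_congr rfl fun c _ => Finset.sum_congr rfl fun d _ => by ring

theorem pull4_swap_right (P : Tensor4 ℂ) (i j k l : Fin 4) :
    pull4 E (fun a b c d => P a b d c) i j k l = pull4 E P i j l k := by
  simp only [pull4]
  refine Finset.sum_congr rfl fun a _ => Finset.sum_congr rfl fun b _ => ?_
  rw [Finset.sum_comm]
  exact Finset.sum_congr rfl fun c _ => Finset.sum_congr rfl fun d _ => by ring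

theorem pull4_add (P Q : Tensor4 ℂ) : pull4 E (P + Q) = pull4 E P + pull4 E Q := by
  funext i j k l
  simp only [pull4, Pi.add_apply, mul_add, Finset.sum_add_distrib]

theorem pull4_smul (c : ℂ) (P : Tensor4 ℂ) : pull4 E (c • P) = c • pull4 E P := by
  funext i j k l
  simp only [pull4, Pi.smul_apply, smul_eq_mul, Finset.mul_sum]
  exact Finset.sum_congr rfl fun a _ => Finset.sum_congr rfl fun b _ =>
    Finset.sum_congr rfl fun c _ => Finset.sum_congr rfl fun d _ => by ring

theorem pull4_neg (P : Tensor4 ℂ) : pull4 E (-P) = -pull4 E P := by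
  rw [← neg_one_smul ℂ P, pull4_smul, neg_one_smul]

theorem pull4_sub (P Q : Tensor4 ℂ) : pull4 E (P - Q) = pull4 E P - pull4 E Q := by
  rw [sub_eq_add_neg, pull4_add, pull4_neg, ← sub_eq_add_neg]

theorem pull4_tensorProd (A B : Tensor2 ℂ) :
    pull4 E (tensorProd A B) = tensorProd (pull2 E A) (pull2 E B) := by
  funext i j k l
  simp only [pull4, tensorProd, pull2_apply, Finset.sum_mul]
  simp only [Finset.mul_sum]
  exact Finset.sum_congr rfl fun a _ => Finset.sum_congr rfl fun b _ =>
    Finset.sum_congr rfl fun c _ => Finset.sum_congr rfl fun d _ => by ring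

theorem pull4_prod (A B : Tensor2 ℂ) (i j k l : Fin 4) :
    pull4 E (fun a b c d => A a b * B c d) i j k l = pull2 E A i j * pull2 E B k l :=
  congrFun (congrFun (congrFun (congrFun (pull4_tensorProd E A B) i) j) k) l

theorem pull4_prod_mid (A B : Tensor2 ℂ) (i j k l : Fin 4) :
    pull4 E (fun a b c d => A a c * B b d) i j k l = pull2 E A i k * pull2 E B j l := by
  rw [pull4_swap_mid E (fun a b c d => A a b * B c d), pull4_prod]

theorem pull4_prod_cross (A B : Tensor2 ℂ) (i j k l : Fin 4) :
    pull4 E (fun a b c d => A a d * B b c) i j k l = pull2 E A i l * pull2 E B j k := by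
  rw [pull4_swap_right E (fun a b c d => A a c * B b d), pull4_prod_mid]

/-- The last two indices of a 4-tensor transform like those of a matrix. -/
theorem pull4_eq (P : Tensor4 ℂ) (i j : Fin 4) :
    Matrix.of (pull4 E P i j) = E.transpose * (∑ a, ∑ b, (E a i * E b j) • Matrix.of (P a b)) * E := by
  ext k l
  have := pull2_apply E (∑ a, ∑ b, (E a i * E b j) • Matrix.of (P a b)) k l
  rw [pull2] at this
  rw [this]
  simp only [Matrix.of_apply, pull4, Matrix.sum_apply, Matrix.smul_apply, smul_eq_mul,
    Finset.mul_sum]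
  have e : ∀ f : Fin 4 → Fin 4 → Fin 4 → Fin 4 → ℂ, ∑ c, ∑ d, ∑ a, ∑ b, f a b c d =
      ∑ a, ∑ b, ∑ c, ∑ d, f a b c d := by
    intro f
    rw [Finset.sum_congr rfl fun c _ => Finset.sum_comm, Finset.sum_comm]
    refine Finset.sum_congr rfl fun a _ => ?_
    rw [Finset.sum_congr rfl fun c _ => Finset.sum_comm, Finset.sum_comm]
  rw [e]
  exact Finset.sum_congr rfl fun a _ => Finset.sum_congr rfl fun b _ =>
    Finset.sum_congr rfl fun c _ => Finset.sum_congr rfl fun d _ => by ring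

end

theorem flat_compForm (q : Tensor2 ℂ) (P Q : Tensor4 ℂ) :
    flat (compForm q P Q) = (1 / 2 : ℂ) • (flat P * (q ⊗ₖ q) * flat Q) := by
  ext ⟨a, b⟩ ⟨c, d⟩
  simp only [flat, Matrix.of_apply, compForm, Matrix.smul_apply, Matrix.mul_apply,
    Matrix.kroneckerMap_apply, Fintype.sum_prod_type, Finset.sum_mul, smul_eq_mul]
  congr 1
  have e : ∀ f : Fin 4 → Fin 4 → Fin 4 → Fin 4 → ℂ, ∑ c, ∑ d, ∑ a, ∑ b, f a b c d =
      ∑ a, ∑ b, ∑ c, ∑ d, f a b c d := by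
    intro f
    rw [Finset.sum_congr rfl fun c _ => Finset.sum_comm, Finset.sum_comm]
    refine Finset.sum_congr rfl fun a _ => ?_
    rw [Finset.sum_congr rfl fun c _ => Finset.sum_comm, Finset.sum_comm]
  rw [e]
  exact Finset.sum_congr rfl fun a _ => Finset.sum_congr rfl fun b _ =>
    Finset.sum_congr rfl fun c _ => Finset.sum_congr rfl fun d _ => by ring

theorem applyForm_eq (q : Tensor2 ℂ) (P : Tensor4 ℂ) (F : Tensor2 ℂ) (a b : Fin 4) :
    applyForm q P F a b = (1 / 2) * ∑ m, ∑ n, P a b m n * (q * F * q.transpose) m n := by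
  simp only [applyForm, LinearMap.coe_mk, AddHom.coe_mk, Matrix.of_apply]
  congr 1
  refine Finset.sum_congr rfl fun m _ => Finset.sum_congr rfl fun n _ => ?_
  simp only [Matrix.mul_apply, Matrix.transpose_apply, Finset.sum_mul, Finset.mul_sum]
  rw [Finset.sum_comm]
  exact Finset.sum_congr rfl fun r _ => Finset.sum_congr rfl fun s _ => by ring

theorem nullMetric_transpose : nullMetric.transpose = nullMetric := by
  ext i j; fin_cases i <;> fin_cases j <;> rfl

namespace IsNullFrame

variable {g J U E : Tensor2 ℂ}

theorem pull4_inj (h : IsNullFrame g J U E) {P Q : Tensor4 ℂ} (e : pull4 E P = pull4 E Q) :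
    P = Q := by
  apply flat_inj
  have e := congrArg flat e
  rw [flat_pull4, flat_pull4] at e
  set F := coframe g E
  have h1 : (E ⊗ₖ E) * (F ⊗ₖ F) = 1 := by
    rw [← Matrix.mul_kronecker_mul, h.mul_coframe, Matrix.one_kronecker_one]
  have h2 : (F ⊗ₖ F).transpose * (E ⊗ₖ E).transpose = 1 := by
    rw [← Matrix.transpose_mul, h1, Matrix.transpose_one]
  have := congrArg (fun X => (F ⊗ₖ F).transpose * X * (F ⊗ₖ F)) e
  simpa only [← mul_assoc, h2, one_mul, mul_assoc _ (E ⊗ₖ E), h1, mul_one] using this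

theorem pull4_compForm (h : IsNullFrame g J U E) (P Q : Tensor4 ℂ) :
    pull4 E (compForm g⁻¹ P Q) = compForm nullMetric (pull4 E P) (pull4 E Q) := by
  apply flat_inj
  rw [flat_pull4, flat_compForm, flat_compForm, flat_pull4, flat_pull4, h.inv_metric]
  have : (E * nullMetric * E.transpose) ⊗ₖ (E * nullMetric * E.transpose) =
      (E ⊗ₖ E) * (nullMetric ⊗ₖ nullMetric) * (E ⊗ₖ E).transpose := by
    rw [Matrix.mul_kronecker_mul, Matrix.mul_kronecker_mul, Matrix.kroneckerMap_transpose]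
  rw [this]
  simp only [Matrix.mul_smul, Matrix.smul_mul, mul_assoc]

theorem pull2_applyForm (h : IsNullFrame g J U E) (P : Tensor4 ℂ) (F : Tensor2 ℂ) :
    pull2 E (applyForm g⁻¹ P F) = applyForm nullMetric (pull4 E P) (pull2 E F) := by
  ext i j
  have hq : g⁻¹ * F * g⁻¹.transpose =
      E * (nullMetric * pull2 E F * nullMetric.transpose) * E.transpose := by
    rw [h.inv_metric, pull2]
    simp only [Matrix.transpose_mul, Matrix.transpose_transpose, mul_assoc]
  set X := nullMetric * pull2 E F * nullMetric.transpose
  rw [pull2_apply, applyForm_eq]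
  simp only [applyForm_eq, hq, pull4, Finset.mul_sum, Finset.sum_mul]
  have hX : ∀ m n, (E * X * E.transpose) m n = ∑ k, ∑ l, E m k * E n l * X k l := by
    intro m n
    simp only [Matrix.mul_apply, Matrix.transpose_apply, Finset.sum_mul]
    rw [Finset.sum_comm]
    exact Finset.sum_congr rfl fun a _ => Finset.sum_congr rfl fun b _ => by ring
  simp only [hX, Finset.mul_sum]
  have e : ∀ f : Fin 4 → Fin 4 → Fin 4 → Fin 4 → Fin 4 → Fin 4 → ℂ,
      ∑ a, ∑ b, ∑ m, ∑ n, ∑ k, ∑ l, f a b m n k l =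
      ∑ k, ∑ l, ∑ a, ∑ b, ∑ m, ∑ n, f a b m n k l := by
    intro f
    rw [← Fintype.sum_prod_type', Finset.sum_congr rfl fun (x : Fin 4 × Fin 4) _ =>
      (Fintype.sum_prod_type' (f := fun m n => ∑ k, ∑ l, f x.1 x.2 m n k l)).symm,
      ← Finset.sum_product', Finset.sum_congr rfl fun x _ =>
      (Fintype.sum_prod_type' (f := fun k l => f x.1.1 x.1.2 x.2.1 x.2.2 k l)).symm,
      Finset.sum_comm, Fintype.sum_prod_type]
    simp only [Fintype.sum_prod_type, Finset.univ_product_univ]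
  rw [e]
  refine Finset.sum_congr rfl fun k _ => Finset.sum_congr rfl fun l _ =>
    Finset.sum_congr rfl fun a _ => Finset.sum_congr rfl fun b _ =>
    Finset.sum_congr rfl fun m _ => Finset.sum_congr rfl fun n _ => by ring

/-- Contraction of the last index with an endomorphism. -/
theorem pull4_mulRight (h : IsNullFrame g J U E) (P : Tensor4 ℂ) (T : Tensor2 ℂ)
    (i j k l : Fin 4) :
    pull4 E (fun a b c d => ∑ m, P a b c m * T m d) i j k l =
      ∑ m, pull4 E P i j k m * (coframe g E * T * E) m l := by
  have h1 := pull4_eq E (fun a b c d => ∑ m, P a b c m * T m d) i j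
  have h2 : ∀ a b, Matrix.of (fun c d => ∑ m, P a b c m * T m d) = Matrix.of (P a b) * T :=
    fun a b => by ext c d; simp [Matrix.mul_apply]
  simp only [h2, ← Matrix.smul_mul, ← Finset.sum_mul] at h1
  have h3 : E.transpose * ((∑ a, ∑ b, (E a i * E b j) • Matrix.of (P a b)) * T) * E =
      (E.transpose * (∑ a, ∑ b, (E a i * E b j) • Matrix.of (P a b)) * E) *
        (coframe g E * T * E) := by
    simp only [mul_assoc, ← mul_assoc E (coframe g E), h.mul_coframe, one_mul]
  rw [h3, ← pull4_eq] at h1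
  exact congrFun (congrFun h1 k) l

end IsNullFrame

/-! ### Alternating 4-tensors -/

/-- A 4-tensor is alternating. -/
structure IsAlt4 (P : Tensor4 ℂ) : Prop where
  left : ∀ a b c d, P b a c d = -P a b c d
  mid : ∀ a b c d, P a c b d = -P a b c d
  right : ∀ a b c d, P a b d c = -P a b c d

/-- The sign of the pair `(a, b)`. -/
def pairSign (a b : Fin 4) : ℤ := if a < b then 1 else if b < a then -1 else 0

/-- The Levi-Civita symbol. -/
def leviCivita (a b c d : Fin 4) : ℤ :=
  pairSign a b * pairSign a c * pairSign a d * (pairSign b c * pairSign b d) * pairSign c d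

theorem IsAlt4.pull {P : Tensor4 ℂ} (h : IsAlt4 P) (E : Tensor2 ℂ) : IsAlt4 (pull4 E P) where
  left a b c d := by
    have : (fun a b c d => P b a c d) = -P := by funext a b c d; exact h.left a b c d
    rw [← pull4_swap_left, this, pull4_neg]; rfl
  mid a b c d := by
    have : (fun a b c d => P a c b d) = -P := by funext a b c d; exact h.mid a b c d
    rw [← pull4_swap_mid, this, pull4_neg]; rfl
  right a b c d := by
    have : (fun a b c d => P a b d c) = -P := by funext a b c d; exact h.right a b c d
    rw [← pull4_swap_right, this, pull4_neg]; rfl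

theorem IsAlt4.eq_leviCivita {P : Tensor4 ℂ} (h : IsAlt4 P) (a b c d : Fin 4) :
    P a b c d = leviCivita a b c d * P 0 1 2 3 := by
  have ab : ∀ a c d, P a a c d = 0 := fun a c d => by
    linear_combination (1 / 2) * h.left a a c d
  have bc : ∀ a b d, P a b b d = 0 := fun a b d => by
    linear_combination (1 / 2) * h.mid a b b d
  have cd : ∀ a b c, P a b c c = 0 := fun a b c => by
    linear_combination (1 / 2) * h.right a b c c
  have ac : ∀ a b d, P a b a d = 0 := fun a b d => by rw [h.mid, ab, neg_zero]
  have bd : ∀ a b c, P a b c b = 0 := fun a b c => by rw [h.right, bc, neg_zero]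
  have ad : ∀ a b c, P a b c a = 0 := fun a b c => by rw [h.right, ac, neg_zero]
  -- The strict inequalities orient the transpositions, so that `simp` sorts the indices and
  -- terminates.
  have l : ∀ a b c d, a < b → P b a c d = -P a b c d := fun a b c d _ => h.left a b c d
  have m : ∀ a b c d, b < c → P a c b d = -P a b c d := fun a b c d _ => h.mid a b c d
  have r : ∀ a b c d, c < d → P a b d c = -P a b c d := fun a b c d _ => h.right a b c d
  fin_cases a <;> fin_cases b <;> first
    | (simp [ab, leviCivita, pairSign]; done)
    | (fin_cases c <;> first
        | (simp [ac, bc, leviCivita, pairSign]; done)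
        | (fin_cases d <;> simp [ad, bd, cd, l, m, r, leviCivita, pairSign]))

/-- The classical octahedron argument: a signed sum of four cyclic identities in which the skew
symmetries cancel everything except the two members of the pair. -/
theorem IsSmoothMetric.riemann_pair {g : Coord → Tensor2 ℝ} {D : Set Coord} {y : Coord}
    (hg : IsSmoothMetric g D) (hy : y ∈ D) (a b c d : Fin 4) :
    cplx4 (riemann g y) a b c d = cplx4 (riemann g y) c d a b := by
  set r := cplx4 (riemann g y)
  have L : ∀ a b c d, r a b c d = -r b a c d := hg.riemann_skew_left hy
  have R : ∀ a b c d, r a b c d = -r a b d c := IsSmoothMetric.riemann_skew_right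
  have C : ∀ a b c d, r a b c d + r a c d b + r a d b c = 0 := hg.riemann_cyclic
  have LR : ∀ a b c d, r a b c d = r b a d c := fun a b c d => by
    linear_combination L a b c d - R b a c d
  linear_combination (1 / 2) * (C a b c d + C b a d c - C c d a b - C d c b a)
    + (1 / 2) * (LR a b c d - LR c d a b - LR a c d b - LR a d b c - LR b d c a - LR b c a d)

/-! ### The second derivative of the canonical 2-form and its integrability conditions. -/

/-- The antisymmetric product of two covectors. -/
def wedge (u w : Fin 4 → ℂ) : Tensor2 ℂ := Matrix.vecMulVec u w - Matrix.vecMulVec w u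

theorem wedge_apply (u w : Fin 4 → ℂ) (c d : Fin 4) :
    wedge u w c d = u c * w d - u d * w c := by
  simp [wedge, Matrix.vecMulVec_apply, mul_comm]

theorem cov2_wedge {g : Coord → Tensor2 ℝ} {y : Coord} {u w : Coord → Fin 4 → ℂ}
    (hu : VecSmoothAt u y) (hw : VecSmoothAt w y) (a : Fin 4) :
    cov2 g (fun z => wedge (u z) (w z)) y a =
      wedge (cov1 g u y a) (w y) + wedge (u y) (cov1 g w y a) := by
  have h : cov2 g (fun z => wedge (u z) (w z)) y a =
      cov2 g (fun z => Matrix.vecMulVec (u z) (w z)) y a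
      - cov2 g (fun z => Matrix.vecMulVec (w z) (u z)) y a := by
    simp only [wedge, cov2, matPd_sub (hu.vecMulVec hw) (hw.vecMulVec hu)]
    noncomm_ring
  rw [h, cov2_vecMulVec hu hw, cov2_vecMulVec hw hu]
  simp only [wedge]
  abel

namespace IsUmbilicalField

variable {g : Coord → Tensor2 ℝ} {J : Coord → Tensor2 ℂ} {U : Coord → Tensor2 ℝ}
  {D : Set Coord} {y : Coord}

theorem cov2_canon_wedge (h : IsUmbilicalField g J U D) (hy : y ∈ D) (a : Fin 4) :
    cov2 g J y a = -(wedge (cplx2 (g y) a) (leeForm g J y)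
        + wedge (J y a) (dualLeeForm g J y)) :=
  h.cov2_canon hy a

theorem leeForm_smooth (h : IsUmbilicalField g J U D) (hy : y ∈ D) :
    VecSmoothAt (leeForm g J) y := by
  intro b
  simp only [leeForm, codiff2, ← cov2_apply]
  refine contDiffAt_const.mul (ContDiffAt.neg ?_)
  exact ContDiffAt.sum fun a _ => ContDiffAt.sum fun c _ =>
    (h.metric.cplx_inv hy a c).mul (h.metric.cov2_smooth hy (h.canon_smooth y hy) c a b)

theorem dualLeeForm_smooth (h : IsUmbilicalField g J U D) (hy : y ∈ D) :
    VecSmoothAt (dualLeeForm g J) y :=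
  (h.leeForm_smooth hy).vecMul (h.mixed_smooth hy)

theorem leeForm_eq (h : IsUmbilicalField g J U D) (hy : y ∈ D) :
    leeForm g J y = Matrix.vecMul (dualLeeForm g J y) (cplx2 (g y)⁻¹ * J y) := by
  obtain ⟨E, hE⟩ := h.frame y hy
  rw [dualLeeForm, Matrix.vecMul_vecMul, cplx2_inv, hE.canon_sq, Matrix.vecMul_one]

/-- Since the mixed J is an involution, ½δJ is recovered from the dual 1-form by contraction with J.
Its derivative is thus known from that of the dual form and from ∇J, and ∇χ remains the only new
unknown. -/
theorem cov1_leeForm (h : IsUmbilicalField g J U D) (hy : y ∈ D) (a : Fin 4) :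
    cov1 g (leeForm g J) y a =
      Matrix.vecMul (cov1 g (dualLeeForm g J) y a) (cplx2 (g y)⁻¹ * J y)
      + Matrix.vecMul (dualLeeForm g J y) (cplx2 (g y)⁻¹ * cov2 g J y a) := by
  have e : cov1 g (leeForm g J) y a =
      cov1 g (fun z => Matrix.vecMul (dualLeeForm g J z) (cplx2 (g z)⁻¹ * J z)) y a := by
    have he : leeForm g J =ᶠ[nhds y]
        fun z => Matrix.vecMul (dualLeeForm g J z) (cplx2 (g z)⁻¹ * J z) :=
      Filter.eventually_of_mem (h.mem_nhds hy) fun z hz => h.leeForm_eq hz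
    have hv : vecPd a (leeForm g J) y =
        vecPd a (fun z => Matrix.vecMul (dualLeeForm g J z) (cplx2 (g z)⁻¹ * J z)) y :=
      funext fun i => pd_congr (he.mono fun z hz => congrFun hz i) a
    rw [cov1, cov1, hv, h.leeForm_eq hy]
  rw [e, cov1_vecMul (h.dualLeeForm_smooth hy) (h.mixed_smooth hy), h.cov2_eq_lower hy,
    ← mul_assoc, cplx2_inv,
    Matrix.nonsing_inv_mul _ (isUnit_iff_ne_zero.2 (h.metric.cplx_det_ne hy)), one_mul]

/-- `cov2_canon` holds near `y`, so it may be differentiated. The index `b` is treated as a label,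
which produces the last sum; that sum is symmetric in `a`, `b` and will cancel in the commutator. -/
theorem cov2_cov2_canon (h : IsUmbilicalField g J U D) (hy : y ∈ D) (a b : Fin 4) :
    cov2 g (fun z => cov2 g J z b) y a =
      -(wedge (cplx2 (g y) b) (cov1 g (leeForm g J) y a)
        + wedge (cov2 g J y a b) (dualLeeForm g J y)
        + wedge (J y b) (cov1 g (dualLeeForm g J) y a))
      + ∑ d, gam g y a d b • cov2 g J y d := by
  have e : (fun z => cov2 g J z b) =ᶠ[nhds y] fun z =>
      -(wedge (cplx2 (g z) b) (leeForm g J z) + wedge (J z b) (dualLeeForm g J z)) :=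
    Filter.eventually_of_mem (h.mem_nhds hy) fun z hz => h.cov2_canon_wedge hz b
  have hl := h.leeForm_smooth hy
  have hk := h.dualLeeForm_smooth hy
  have hg := (h.metric.cplx hy).row b
  have hJ := (h.canon_smooth y hy).row b
  have s : ∀ {u w : Coord → Fin 4 → ℂ}, VecSmoothAt u y → VecSmoothAt w y →
      MatSmoothAt (fun z => wedge (u z) (w z)) y :=
    fun hu hw => (hu.vecMulVec hw).sub (hw.vecMulVec hu)
  have hadd : cov2 g (fun z => wedge (cplx2 (g z) b) (leeForm g J z)
      + wedge (J z b) (dualLeeForm g J z)) y a =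
      cov2 g (fun z => wedge (cplx2 (g z) b) (leeForm g J z)) y a
      + cov2 g (fun z => wedge (J z b) (dualLeeForm g J z)) y a := by
    simp only [cov2, matPd_add (s hg hl) (s hJ hk)]
    noncomm_ring
  rw [cov2_congr e, cov2_neg, hadd, cov2_wedge hg hl, cov2_wedge hJ hk, cov1_row, cov1_row,
    h.metric.cov2_metric hy]
  ext c d
  simp only [Matrix.add_apply, Matrix.neg_apply, wedge_apply, Pi.add_apply, Pi.smul_apply,
    smul_eq_mul, Matrix.zero_apply, Matrix.smul_apply, h.cov2_canon_wedge hy, mul_neg, mul_add,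
    mul_sub, Fin.sum_univ_four]
  ring

/-- The integrability conditions of the equation satisfied by the canonical 2-form. -/
theorem curvature_identity (h : IsUmbilicalField g J U D) (hy : y ∈ D) (a b c d : Fin 4) :
    (wedge (cplx2 (g y) b) (cov1 g (leeForm g J) y a)
        + wedge (cov2 g J y a b) (dualLeeForm g J y)
        + wedge (J y b) (cov1 g (dualLeeForm g J) y a)) c d
      - (wedge (cplx2 (g y) a) (cov1 g (leeForm g J) y b)
        + wedge (cov2 g J y b a) (dualLeeForm g J y)
        + wedge (J y a) (cov1 g (dualLeeForm g J) y b)) c d =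
    ∑ m, cplx4 (riemann g y) a b d m * (cplx2 (g y)⁻¹ * J y) m c
      - ∑ m, cplx4 (riemann g y) a b c m * (cplx2 (g y)⁻¹ * J y) m d := by
  have h1 := h.metric.cov2_comm hy (h.canon_smooth y hy) a b
  rw [h.cov2_cov2_canon hy, h.cov2_cov2_canon hy] at h1
  -- Vanishing torsion makes the label terms of the two second derivatives equal.
  have hgam : ∀ d, gam g y a d b = gam g y b d a := fun d =>
    congrArg Complex.ofReal (h.metric.christoffel_symm y d a b)
  simp only [hgam] at h1
  have h2 := congrFun (congrFun h1 c) d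
  set T := cplx2 (g y)⁻¹ * J y with hT
  have hJ : J y = cplx2 (g y) * T := (h.lower_mixed hy).symm
  have hJs : (J y).transpose = -J y := by
    obtain ⟨E, hE⟩ := h.frame y hy
    exact hE.canon_skew
  have hgs : (cplx2 (g y)).transpose = cplx2 (g y) := by
    ext i j; exact congrArg Complex.ofReal (h.metric.symm y j i)
  have hJ' : J y = -(T.transpose * cplx2 (g y)) := by
    rw [← neg_eq_iff_eq_neg, ← hJs, hJ, Matrix.transpose_mul, hgs]
  have hR : (curvMat g y a b).transpose * cplx2 (g y) = -(cplx2 (g y) * curvMat g y a b) :=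
    eq_neg_of_add_eq_zero_left (h.metric.curvMat_skew hy a b)
  -- Writing J once as gT and once as −Tᵀg brings the curvature in with all indices lowered.
  have h3 : (curvMat g y a b).transpose * J y + J y * curvMat g y a b =
      -((cplx2 (g y) * curvMat g y a b) * T)
      - T.transpose * (cplx2 (g y) * curvMat g y a b) := by
    calc _ = (curvMat g y a b).transpose * (cplx2 (g y) * T)
          + -(T.transpose * cplx2 (g y)) * curvMat g y a b := by rw [← hJ, ← hJ']
      _ = _ := by
        rw [← mul_assoc, hR, neg_mul, neg_mul, ← sub_eq_add_neg, mul_assoc T.transpose]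
  rw [h3] at h2
  simp only [Matrix.sub_apply, Matrix.add_apply, Matrix.neg_apply,
    Matrix.mul_apply (M := cplx2 (g y) * curvMat g y a b), Matrix.mul_apply (M := T.transpose),
    Matrix.transpose_apply, IsSmoothMetric.lower_curvMat] at h2
  have e1 : ∑ m, cplx4 (riemann g y) c m a b * T m d =
      ∑ m, cplx4 (riemann g y) a b c m * T m d :=
    Finset.sum_congr rfl fun m _ => by rw [h.metric.riemann_pair hy]
  have e2 : ∑ m, T m c * cplx4 (riemann g y) m d a b =
      -∑ m, cplx4 (riemann g y) a b d m * T m c := by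
    rw [← Finset.sum_neg_distrib]
    refine Finset.sum_congr rfl fun m _ => ?_
    rw [h.metric.riemann_pair hy, IsSmoothMetric.riemann_skew_right]; ring
  rw [e1, e2] at h2
  simp only [Matrix.add_apply]
  linear_combination -h2

end IsUmbilicalField

/-! ### The integrability conditions in a null frame -/

theorem pull4_prod31 (E : Tensor2 ℂ) (B : Fin 4 → Tensor2 ℂ) (w : Fin 4 → ℂ) (i j k l : Fin 4) :
    pull4 E (fun a b c d => B a b c * w d) i j k l = pull3 E B i j k * Matrix.vecMul w E l := by
  have h : pull3 E B i j k = ∑ a, ∑ b, ∑ c, E a i * E b j * E c k * B a b c := by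
    have := pull2_apply E (∑ a, E a i • B a) j k
    rw [pull2] at this
    rw [pull3, this]
    simp only [Matrix.sum_apply, Matrix.smul_apply, smul_eq_mul, Finset.mul_sum]
    rw [Finset.sum_congr rfl fun b _ => Finset.sum_comm, Finset.sum_comm]
    exact Finset.sum_congr rfl fun a _ => Finset.sum_congr rfl fun b _ =>
      Finset.sum_congr rfl fun c _ => by ring
  rw [h]
  simp only [pull4, Matrix.vecMul, dotProduct, Finset.sum_mul]
  simp only [Finset.mul_sum]
  exact Finset.sum_congr rfl fun a _ => Finset.sum_congr rfl fun b _ =>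
    Finset.sum_congr rfl fun c _ => Finset.sum_congr rfl fun d _ => by ring

/-- The frame components of the covariant derivative of the canonical 2-form, in terms of the
1-form `k`. -/
def frameCov (k : Fin 4 → ℂ) (i : Fin 4) : Tensor2 ℂ :=
  -(wedge (nullMetric i) (Matrix.vecMul k (Matrix.diagonal ![1, -1, 1, -1])) + wedge (nullSD i) k)

/-- The frame components of the covariant derivative of `½ δJ`. -/
def frameLee (k : Fin 4 → ℂ) (X : Tensor2 ℂ) (i : Fin 4) : Fin 4 → ℂ :=
  Matrix.vecMul (X i) (Matrix.diagonal ![1, -1, 1, -1])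
    + Matrix.vecMul k (nullMetric * frameCov k i)

/-- The frame components of the second covariant derivative of the canonical 2-form, up to
sign. -/
def frameHess (k : Fin 4 → ℂ) (X : Tensor2 ℂ) (i j : Fin 4) : Tensor2 ℂ :=
  wedge (nullMetric j) (frameLee k X i) + wedge (frameCov k i j) k + wedge (nullSD j) (X i)

namespace IsUmbilicalField

variable {g : Coord → Tensor2 ℝ} {J : Coord → Tensor2 ℂ} {U : Coord → Tensor2 ℝ}
  {D : Set Coord} {y : Coord} {E : Tensor2 ℂ}

theorem conj_mixed (hE : IsNullFrame (cplx2 (g y)) (J y) (cplx2 (U y)) E) :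
    coframe (cplx2 (g y)) E * (cplx2 (g y)⁻¹ * J y) * E = Matrix.diagonal ![1, -1, 1, -1] := by
  rw [cplx2_inv]; exact hE.conj_canon

theorem mixed_mul_frame (hE : IsNullFrame (cplx2 (g y)) (J y) (cplx2 (U y)) E) :
    (cplx2 (g y)⁻¹ * J y) * E = E * Matrix.diagonal ![1, -1, 1, -1] := by
  rw [← conj_mixed hE, ← mul_assoc, ← mul_assoc, hE.mul_coframe, one_mul]

theorem pull3_cov2 (h : IsUmbilicalField g J U D) (hy : y ∈ D)
    (hE : IsNullFrame (cplx2 (g y)) (J y) (cplx2 (U y)) E) (i : Fin 4) :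
    pull3 E (cov2 g J y) i = frameCov (Matrix.vecMul (dualLeeForm g J y) E) i := by
  have e : cov2 g J y = fun a => -((Matrix.vecMulVec (cplx2 (g y) a) (leeForm g J y)
        - Matrix.vecMulVec (leeForm g J y) (cplx2 (g y) a))
        + (Matrix.vecMulVec (J y a) (dualLeeForm g J y)
        - Matrix.vecMulVec (dualLeeForm g J y) (J y a))) := funext fun a => h.cov2_canon hy a
  have hl : Matrix.vecMul (leeForm g J y) E =
      Matrix.vecMul (Matrix.vecMul (dualLeeForm g J y) E) (Matrix.diagonal ![1, -1, 1, -1]) := by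
    rw [h.leeForm_eq hy, Matrix.vecMul_vecMul, mixed_mul_frame hE, Matrix.vecMul_vecMul]
  rw [e, pull3_neg, pull3_add, pull3_sub, pull3_sub, pull3_vecMulVec_left, pull3_vecMulVec_right,
    pull3_vecMulVec_left, pull3_vecMulVec_right, hE.metric, hE.canon, hl]
  rfl

theorem pull2_cov1_leeForm (h : IsUmbilicalField g J U D) (hy : y ∈ D)
    (hE : IsNullFrame (cplx2 (g y)) (J y) (cplx2 (U y)) E) (i : Fin 4) :
    pull2 E (Matrix.of (cov1 g (leeForm g J) y)) i =
      frameLee (Matrix.vecMul (dualLeeForm g J y) E)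
        (pull2 E (Matrix.of (cov1 g (dualLeeForm g J) y))) i := by
  set k := dualLeeForm g J
  set T := cplx2 (g y)⁻¹ * J y with hT
  have row : ∀ A : Tensor2 ℂ, pull2 E A i = Matrix.vecMul (∑ a, E a i • A a) E := by
    intro A
    have : E.transpose * A = Matrix.of fun i => ∑ a, E a i • A a := by
      ext i j; simp [Matrix.mul_apply]
    rw [pull2, this]
    rfl
  rw [frameLee, row, row, Matrix.vecMul_vecMul, ← mixed_mul_frame hE, ← Matrix.vecMul_vecMul,
    ← pull3_cov2 h hy hE, pull3]
  have e1 : Matrix.vecMul (Matrix.vecMul (k y) E)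
      (nullMetric * (E.transpose * (∑ a, E a i • cov2 g J y a) * E)) =
      Matrix.vecMul (∑ a, E a i • Matrix.vecMul (k y) (cplx2 (g y)⁻¹ * cov2 g J y a)) E := by
    have : ∑ a, E a i • Matrix.vecMul (k y) (cplx2 (g y)⁻¹ * cov2 g J y a) =
        Matrix.vecMul (k y) (cplx2 (g y)⁻¹ * ∑ a, E a i • cov2 g J y a) := by
      simp only [Finset.mul_sum, Matrix.mul_smul]
      ext c
      simp only [Matrix.vecMul, dotProduct, Finset.sum_apply, Pi.smul_apply, smul_eq_mul,
        Matrix.sum_apply, Matrix.smul_apply, Finset.mul_sum]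
      rw [Finset.sum_comm]
      exact Finset.sum_congr rfl fun a _ => Finset.sum_congr rfl fun b _ => by ring
    rw [this, cplx2_inv, hE.inv_metric, Matrix.vecMul_vecMul, Matrix.vecMul_vecMul]
    simp only [mul_assoc]
  have e2 : Matrix.vecMul (∑ a, E a i • Matrix.of (cov1 g k y) a) T =
      ∑ a, E a i • Matrix.vecMul (cov1 g k y a) T := by
    rw [Matrix.sum_vecMul]
    exact Finset.sum_congr rfl fun a _ => Matrix.smul_vecMul _ _ _
  rw [e1, e2, ← Matrix.add_vecMul, ← Finset.sum_add_distrib]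
  congr 1
  refine Finset.sum_congr rfl fun a _ => ?_
  rw [← smul_add, hT, ← h.cov1_leeForm hy]
  rfl

/-- The frame components of the integrability conditions. -/
theorem frame_curvature (h : IsUmbilicalField g J U D) (hy : y ∈ D)
    (hE : IsNullFrame (cplx2 (g y)) (J y) (cplx2 (U y)) E) (i j k l : Fin 4) :
    frameHess (Matrix.vecMul (dualLeeForm g J y) E)
        (pull2 E (Matrix.of (cov1 g (dualLeeForm g J) y))) i j k l
      - frameHess (Matrix.vecMul (dualLeeForm g J y) E)
        (pull2 E (Matrix.of (cov1 g (dualLeeForm g J) y))) j i k l =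
    pull4 E (cplx4 (riemann g y)) i j l k * (![1, -1, 1, -1] : Fin 4 → ℂ) k
      - pull4 E (cplx4 (riemann g y)) i j k l * (![1, -1, 1, -1] : Fin 4 → ℂ) l := by
  set X := Matrix.of (cov1 g (dualLeeForm g J) y) with hX
  set Y := Matrix.of (cov1 g (leeForm g J) y) with hY
  set κ := dualLeeForm g J y with hκ
  set T := cplx2 (g y)⁻¹ * J y with hT
  set r := cplx4 (riemann g y) with hr
  set H : Tensor4 ℂ := fun a b c d => wedge (cplx2 (g y) b) (Y a) c d
    + wedge (cov2 g J y a b) κ c d + wedge (J y b) (X a) c d with hH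
  have hHp : ∀ i j k l, pull4 E H i j k l = frameHess (Matrix.vecMul κ E) (pull2 E X) i j k l := by
    intro i j k l
    have e : H = (fun a b c d => Y a d * cplx2 (g y) b c) - (fun a b c d => Y a c * cplx2 (g y) b d)
        + ((fun a b c d => cov2 g J y a b c * κ d) - (fun a b c d => cov2 g J y a b d * κ c))
        + ((fun a b c d => X a d * J y b c) - (fun a b c d => X a c * J y b d)) := by
      funext a b c d
      simp only [hH, wedge_apply, Pi.add_apply, Pi.sub_apply]
      ring
    simp only [e, pull4_add, pull4_sub, Pi.add_apply, Pi.sub_apply, pull4_prod_cross,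
      pull4_prod_mid, pull4_prod31]
    rw [pull4_swap_right E (fun a b c d => cov2 g J y a b c * κ d), pull4_prod31,
      h.pull3_cov2 hy hE]
    have hg : pull2 E (cplx2 (g y)) = nullMetric := hE.metric
    have hj : pull2 E (J y) = nullSD := hE.canon
    rw [hg, hj, hY, h.pull2_cov1_leeForm hy hE]
    simp only [frameHess, Matrix.add_apply, wedge_apply, hX, hκ]
    ring
  have hid : H - (fun a b c d => H b a c d) =
      (fun a b c d => ∑ m, r a b d m * T m c) - (fun a b c d => ∑ m, r a b c m * T m d) := by
    funext a b c d
    exact h.curvature_identity hy a b c d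
  have := congrFun (congrFun (congrFun (congrFun (congrArg (pull4 E) hid) i) j) k) l
  rw [pull4_sub, pull4_sub] at this
  simp only [Pi.sub_apply] at this
  rw [pull4_swap_left E H, pull4_swap_right E (fun a b c d => ∑ m, r a b c m * T m d),
    hE.pull4_mulRight, hE.pull4_mulRight, conj_mixed hE, hHp, hHp] at this
  simpa [Matrix.diagonal_apply] using this

end IsUmbilicalField

/-! ### The Weyl tensor in a null frame -/

/-- The algebraic symmetries of a Riemann tensor. -/
structure IsRiemannLike (r : Tensor4 ℂ) : Prop where
  left : ∀ a b c d, r a b c d = -r b a c d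
  right : ∀ a b c d, r a b c d = -r a b d c
  pair : ∀ a b c d, r a b c d = r c d a b
  cyclic : ∀ a b c d, r a b c d + r a c d b + r a d b c = 0

theorem IsRiemannLike.pull {r : Tensor4 ℂ} (h : IsRiemannLike r) (E : Tensor2 ℂ) :
    IsRiemannLike (pull4 E r) where
  left a b c d := by
    have : (fun a b c d => r b a c d) = -r := by
      funext a b c d; exact h.left b a c d
    rw [← pull4_swap_left E r a b, this, pull4_neg]; simp
  right a b c d := by
    have : (fun a b c d => r a b d c) = -r := by
      funext a b c d; exact h.right a b d c
    rw [← pull4_swap_right E r a b, this, pull4_neg]; simp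
  pair a b c d := by
    have : r = fun a b c d => r c d a b := by
      funext a b c d; exact h.pair a b c d
    calc _ = pull4 E (fun a b c d => r c d a b) a b c d := by rw [← this]
      _ = _ := by
        rw [pull4_swap_mid E (fun a b c d => r b d a c), pull4_swap_left E (fun a b c d => r a d b c),
          pull4_swap_right E (fun a b c d => r a c b d), pull4_swap_mid E r]
  cyclic a b c d := by
    have : r + (fun a b c d => r a c d b) + (fun a b c d => r a d b c) = 0 := by
      funext a b c d; exact h.cyclic a b c d
    have h0 : pull4 E (0 : Tensor4 ℂ) a b c d = 0 := by simp [pull4]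
    rw [← h0, ← this, pull4_add, pull4_add]
    simp only [Pi.add_apply]
    rw [pull4_swap_mid E (fun a b c d => r a b d c), pull4_swap_right E r,
      pull4_swap_right E (fun a b c d => r a c b d), pull4_swap_mid E r]

/-- The Ricci tensor in a null frame. -/
def frameRicci (r : Tensor4 ℂ) : Tensor2 ℂ := Matrix.of fun b d => ∑ a, ∑ e, nullMetric a e * r e b a d

/-- The scalar curvature in a null frame. -/
def frameScalar (r : Tensor4 ℂ) : ℂ := ∑ a, ∑ b, nullMetric a b * frameRicci r a b

/-- The Weyl tensor in a null frame. -/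
noncomputable def frameWeyl (r : Tensor4 ℂ) : Tensor4 ℂ := fun a b c d => r a b c d
  - (1 / 2) * (nullMetric a c * frameRicci r b d - nullMetric a d * frameRicci r b c
      + nullMetric b d * frameRicci r a c - nullMetric b c * frameRicci r a d)
  + frameScalar r / 6 * (nullMetric a c * nullMetric b d - nullMetric a d * nullMetric b c)

/-- With ε = (1,−1,1,−1) the right side of `hc` is −(ε_c + ε_d) r_{ijcd}, so the condition
determines r_{ij02} and r_{ij13} and nothing else. The conclusions are the self-dual components
among these. The two vanishing ones correspond to Ψ₀ and Ψ₄ of the Newman–Penrose formalism. -/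
theorem frame_riemann {r : Tensor4 ℂ} (hr : IsRiemannLike r) {k : Fin 4 → ℂ} {X : Tensor2 ℂ}
    (hc : ∀ i j c d, frameHess k X i j c d - frameHess k X j i c d =
      r i j d c * (![1, -1, 1, -1] : Fin 4 → ℂ) c - r i j c d * (![1, -1, 1, -1] : Fin 4 → ℂ) d) :
    r 0 2 0 2 = 0 ∧ r 1 3 1 3 = 0 ∧
    r 0 2 1 3 = (1 / 2) * (2 * (k 0 * k 1 + k 2 * k 3) + (X 0 1 + X 1 0 + X 2 3 + X 3 2)) ∧
    r 0 1 0 2 + r 2 3 0 2 = X 2 0 - X 0 2 ∧ r 0 1 1 3 + r 2 3 1 3 = X 1 3 - X 3 1 := by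
  have e02 : ∀ i j, r i j 0 2 = -(1 / 2) * (frameHess k X i j 0 2 - frameHess k X j i 0 2) := by
    intro i j
    have := hc i j 0 2
    simp only [Matrix.cons_val] at this
    linear_combination (1 / 2) * this + (1 / 2) * hr.right i j 0 2
  have e13 : ∀ i j, r i j 1 3 = (1 / 2) * (frameHess k X i j 1 3 - frameHess k X j i 1 3) := by
    intro i j
    have := hc i j 1 3
    simp only [Matrix.cons_val] at this
    linear_combination (-1 / 2) * this + (1 / 2) * hr.right i j 1 3
  have p := hr.pair 0 2 1 3
  refine ⟨?_, ?_, ?_, ?_, ?_⟩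
  · rw [e02]
    simp [frameHess, frameLee, frameCov, wedge_apply, nullMetric, nullSD, Matrix.vecMul,
      dotProduct, Matrix.diagonal_apply]
    try ring
  · rw [e13]
    simp [frameHess, frameLee, frameCov, wedge_apply, nullMetric, nullSD, Matrix.vecMul,
      dotProduct, Matrix.diagonal_apply]
    try ring
  -- The two members of the pair involve X₀₁ + X₂₃ and X₁₀ + X₃₂ respectively; their average
  -- contains the full divergence of χ.
  · have : r 0 2 1 3 = (1 / 2) * (r 0 2 1 3 + r 1 3 0 2) := by linear_combination (1 / 2) * p
    rw [this, e02, e13]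
    simp [frameHess, frameLee, frameCov, wedge_apply, nullMetric, nullSD, Matrix.vecMul,
      dotProduct, Fin.sum_univ_four, Matrix.diagonal_apply]
    simp only [Matrix.vecHead, Matrix.vecTail, Function.comp_apply, Fin.succ_zero_eq_one,
      Fin.succ_one_eq_two, Fin.reduceSucc]
    ring
  · rw [e02, e02]
    simp [frameHess, frameLee, frameCov, wedge_apply, nullMetric, nullSD, Matrix.vecMul,
      dotProduct, Fin.sum_univ_four, Matrix.diagonal_apply]
    try ring
  · rw [e13, e13]
    simp [frameHess, frameLee, frameCov, wedge_apply, nullMetric, nullSD, Matrix.vecMul,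
      dotProduct, Fin.sum_univ_four, Matrix.diagonal_apply]
    try ring

/-! ### The projector on self-dual 2-forms in a null frame. -/

/-- A basic self-dual 2-form of a null frame. -/
def nullM : Tensor2 ℂ := !![0, 0, 1, 0; 0, 0, 0, 0; -1, 0, 0, 0; 0, 0, 0, 0]

/-- A basic self-dual 2-form of a null frame. -/
def nullL : Tensor2 ℂ := !![0, 0, 0, 0; 0, 0, 0, 1; 0, 0, 0, 0; 0, -1, 0, 0]

/-- The metric on self-dual 2-forms in a null frame. -/
noncomputable def frameSD : Tensor4 ℂ := fun a b c d =>
  (1 / 2) * (nullMetric a c * nullMetric b d - nullMetric a d * nullMetric b c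
    - (leviCivita a b c d : ℂ))

/-- The frame constants are integers; casting them from ℤ makes `frameSD_eq` decidable. -/
theorem nullMetric_eq (i j : Fin 4) :
    nullMetric i j = ((!![0, 1, 0, 0; 1, 0, 0, 0; 0, 0, 0, 1; 0, 0, 1, 0] : Matrix (Fin 4) (Fin 4) ℤ) i j : ℂ) := by
  fin_cases i <;> fin_cases j <;> simp [nullMetric]

theorem nullSD_eq (i j : Fin 4) :
    nullSD i j = ((!![0, -1, 0, 0; 1, 0, 0, 0; 0, 0, 0, -1; 0, 0, 1, 0] : Matrix (Fin 4) (Fin 4) ℤ) i j : ℂ) := by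
  fin_cases i <;> fin_cases j <;> simp [nullSD]

theorem nullM_eq (i j : Fin 4) :
    nullM i j = ((!![0, 0, 1, 0; 0, 0, 0, 0; -1, 0, 0, 0; 0, 0, 0, 0] : Matrix (Fin 4) (Fin 4) ℤ) i j : ℂ) := by
  fin_cases i <;> fin_cases j <;> simp [nullM]

theorem nullL_eq (i j : Fin 4) :
    nullL i j = ((!![0, 0, 0, 0; 0, 0, 0, 1; 0, 0, 0, 0; 0, -1, 0, 0] : Matrix (Fin 4) (Fin 4) ℤ) i j : ℂ) := by
  fin_cases i <;> fin_cases j <;> simp [nullL]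

/-- The completeness relation of the basis J, M, L, whose only nonzero products are (J, J) = −2 and
(M, L) = 1. -/
theorem frameSD_eq (a b c d : Fin 4) : frameSD a b c d =
    -(1 / 2) * (nullSD a b * nullSD c d) + (nullM a b * nullL c d + nullL a b * nullM c d) := by
  have h : ∀ a b c d : Fin 4,
      (!![0, 1, 0, 0; 1, 0, 0, 0; 0, 0, 0, 1; 0, 0, 1, 0] : Matrix (Fin 4) (Fin 4) ℤ) a c *
        (!![0, 1, 0, 0; 1, 0, 0, 0; 0, 0, 0, 1; 0, 0, 1, 0] : Matrix (Fin 4) (Fin 4) ℤ) b d -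
      (!![0, 1, 0, 0; 1, 0, 0, 0; 0, 0, 0, 1; 0, 0, 1, 0] : Matrix (Fin 4) (Fin 4) ℤ) a d *
        (!![0, 1, 0, 0; 1, 0, 0, 0; 0, 0, 0, 1; 0, 0, 1, 0] : Matrix (Fin 4) (Fin 4) ℤ) b c -
      leviCivita a b c d =
      -((!![0, -1, 0, 0; 1, 0, 0, 0; 0, 0, 0, -1; 0, 0, 1, 0] : Matrix (Fin 4) (Fin 4) ℤ) a b *
        (!![0, -1, 0, 0; 1, 0, 0, 0; 0, 0, 0, -1; 0, 0, 1, 0] : Matrix (Fin 4) (Fin 4) ℤ) c d) +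
      2 * ((!![0, 0, 1, 0; 0, 0, 0, 0; -1, 0, 0, 0; 0, 0, 0, 0] : Matrix (Fin 4) (Fin 4) ℤ) a b *
        (!![0, 0, 0, 0; 0, 0, 0, 1; 0, 0, 0, 0; 0, -1, 0, 0] : Matrix (Fin 4) (Fin 4) ℤ) c d +
        (!![0, 0, 0, 0; 0, 0, 0, 1; 0, 0, 0, 0; 0, -1, 0, 0] : Matrix (Fin 4) (Fin 4) ℤ) a b *
        (!![0, 0, 1, 0; 0, 0, 0, 0; -1, 0, 0, 0; 0, 0, 0, 0] : Matrix (Fin 4) (Fin 4) ℤ) c d) := by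
    decide
  have h1 := congrArg (fun n : ℤ => (n : ℂ)) (h a b c d)
  push_cast at h1
  simp only [← nullMetric_eq, ← nullSD_eq, ← nullM_eq, ← nullL_eq] at h1
  rw [frameSD]
  linear_combination (1 / 2) * h1

/-- Raising an index in a null frame just exchanges 0 with 1 and 2 with 3. -/
theorem sum_nullMetric (f : Fin 4 → Fin 4 → Fin 4 → Fin 4 → ℂ) :
    ∑ m, ∑ n, ∑ r, ∑ s, f m n r s * nullMetric m r * nullMetric n s =
      ∑ m, ∑ n, f m n (![1, 0, 3, 2] m) (![1, 0, 3, 2] n) := by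
  have e : ∀ m r : Fin 4, nullMetric m r = if (![1, 0, 3, 2] : Fin 4 → Fin 4) m = r then 1 else 0 := by
    intro m r; fin_cases m <;> fin_cases r <;> simp [nullMetric]
  simp only [e, mul_ite, mul_one, mul_zero, Finset.sum_ite_eq, Finset.mem_univ, if_true]

theorem compForm_nullMetric (P Q : Tensor4 ℂ) (a b c d : Fin 4) :
    compForm nullMetric P Q a b c d =
      (1 / 2) * ∑ m, ∑ n, P a b m n * Q (![1, 0, 3, 2] m) (![1, 0, 3, 2] n) c d := by
  rw [compForm, ← sum_nullMetric (fun m n r s => P a b m n * Q r s c d)]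
  congr 1
  exact Finset.sum_congr rfl fun m _ => Finset.sum_congr rfl fun n _ =>
      Finset.sum_congr rfl fun r _ => Finset.sum_congr rfl fun s _ => by ring

theorem applyForm_nullMetric (P : Tensor4 ℂ) (F : Tensor2 ℂ) (a b : Fin 4) :
    applyForm nullMetric P F a b =
      (1 / 2) * ∑ m, ∑ n, P a b m n * F (![1, 0, 3, 2] m) (![1, 0, 3, 2] n) := by
  rw [← sum_nullMetric (fun m n r s => P a b m n * F r s)]
  simp only [applyForm, LinearMap.coe_mk, AddHom.coe_mk, Matrix.of_apply]
  congr 1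
  exact Finset.sum_congr rfl fun m _ => Finset.sum_congr rfl fun n _ =>
      Finset.sum_congr rfl fun r _ => Finset.sum_congr rfl fun s _ => by ring

theorem formProd_nullMetric (F H : Tensor2 ℂ) :
    formProd nullMetric F H =
      (1 / 2) * ∑ m, ∑ n, F m n * H (![1, 0, 3, 2] m) (![1, 0, 3, 2] n) := by
  rw [← sum_nullMetric (fun m n r s => F m n * H r s), formProd]
  congr 1
  exact Finset.sum_congr rfl fun m _ => Finset.sum_congr rfl fun n _ =>
      Finset.sum_congr rfl fun r _ => Finset.sum_congr rfl fun s _ => by ring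

/-- The projection retains only P₀₁ + P₂₃, P₀₂ and P₁₃ of the projected index pair. Applied on both
sides it reduces the self-dual Weyl tensor to the nine combinations computed in `frame_sdWeyl`. -/
theorem compForm_frameSD_left {P : Tensor4 ℂ} (hP : ∀ a b c d, P a b c d = -P b a c d)
    (a b c d : Fin 4) : compForm nullMetric frameSD P a b c d =
      -(1 / 2) * (nullSD a b * (P 0 1 c d + P 2 3 c d)) + nullM a b * P 0 2 c d
        + nullL a b * P 1 3 c d := by
  rw [compForm_nullMetric]
  simp only [frameSD_eq, Fin.sum_univ_four]
  simp [nullSD, nullM, nullL]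
  rw [hP 1 0, hP 3 2, hP 2 0, hP 3 1]
  ring

theorem compForm_frameSD_right {P : Tensor4 ℂ} (hP : ∀ a b c d, P a b c d = -P a b d c)
    (a b c d : Fin 4) : compForm nullMetric P frameSD a b c d =
      -(1 / 2) * ((P a b 0 1 + P a b 2 3) * nullSD c d) + P a b 0 2 * nullM c d
        + P a b 1 3 * nullL c d := by
  rw [compForm_nullMetric]
  simp only [frameSD_eq, Fin.sum_univ_four]
  simp [nullSD, nullM, nullL]
  rw [hP _ _ 1 0, hP _ _ 3 2, hP _ _ 2 0, hP _ _ 3 1]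
  ring

/-- The self-dual Weyl tensor in a null frame. -/
theorem frame_sdWeyl {r : Tensor4 ℂ} (hr : IsRiemannLike r) {k : Fin 4 → ℂ} {X : Tensor2 ℂ}
    (hc : ∀ i j c d, frameHess k X i j c d - frameHess k X j i c d =
      r i j d c * (![1, -1, 1, -1] : Fin 4 → ℂ) c - r i j c d * (![1, -1, 1, -1] : Fin 4 → ℂ) d)
    {Ω : ℂ} (hΩ : Ω = (1 / 2) * (2 * (k 0 * k 1 + k 2 * k 3) + (X 0 1 + X 1 0 + X 2 3 + X 3 2))
      - frameScalar r / 12) (a b c d : Fin 4) :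
    compForm nullMetric (compForm nullMetric frameSD (frameWeyl r)) frameSD a b c d =
      Ω * (nullSD a b * nullSD c d) + Ω * (nullM a b * nullL c d + nullL a b * nullM c d)
      + (1 / 2) * (nullSD a b * ((X 0 2 - X 2 0) * nullM c d - (X 1 3 - X 3 1) * nullL c d)
        + ((X 0 2 - X 2 0) * nullM a b - (X 1 3 - X 3 1) * nullL a b) * nullSD c d) := by
  obtain ⟨h1, h2, h3, h4, h5⟩ := frame_riemann hr hc
  have L : ∀ a b c d, frameWeyl r a b c d = -frameWeyl r b a c d := fun a b c d => by
    simp only [frameWeyl]; linear_combination hr.left a b c d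
  have R : ∀ a b c d, frameWeyl r a b c d = -frameWeyl r a b d c := fun a b c d => by
    simp only [frameWeyl]; linear_combination hr.right a b c d
  have ric : ∀ b d, frameRicci r b d = r 1 b 0 d + r 0 b 1 d + r 3 b 2 d + r 2 b 3 d := fun b d => by
    simp [frameRicci, Fin.sum_univ_four, nullMetric]
  have ricS : ∀ b d, frameRicci r b d = frameRicci r d b := fun b d => by
    rw [ric, ric]
    linear_combination hr.pair 1 b 0 d + hr.pair 0 b 1 d + hr.pair 3 b 2 d + hr.pair 2 b 3 d
  have sc : frameScalar r = 2 * (frameRicci r 0 1 + frameRicci r 2 3) := by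
    simp [frameScalar, Fin.sum_univ_four, nullMetric]
    linear_combination ricS 1 0 + ricS 3 2
  have d1 : ∀ a c d, r a a c d = 0 := fun a c d => by
    linear_combination (1 / 2) * hr.left a a c d
  have d2 : ∀ a b c, r a b c c = 0 := fun a b c => by
    linear_combination (1 / 2) * hr.right a b c c
  have r01 : frameRicci r 0 1 = -r 0 1 0 1 + (r 0 3 1 2 + r 0 2 1 3) := by
    rw [ric, d1]
    linear_combination hr.left 1 0 0 1 + hr.left 3 0 2 1 - hr.right 0 3 2 1 + hr.left 2 0 3 1
      - hr.right 0 2 3 1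
  have w02 : frameWeyl r 0 2 0 2 = r 0 2 0 2 := by simp [frameWeyl, nullMetric]
  have w13 : frameWeyl r 1 3 1 3 = r 1 3 1 3 := by simp [frameWeyl, nullMetric]
  have r23 : frameRicci r 2 3 = -r 2 3 2 3 + (r 1 2 0 3 + r 0 2 1 3) := by
    rw [ric, d1]
    linear_combination hr.left 3 2 2 3
  -- The Ricci terms combine to −R/4 and the scalar term is R/6, whence the −R/12 in Ω.
  have wML : frameWeyl r 0 2 1 3 = Ω := by
    simp [frameWeyl, nullMetric]
    linear_combination h3 - hΩ + (1 / 4) * sc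
  have wLM : frameWeyl r 1 3 0 2 = Ω := by
    simp [frameWeyl, nullMetric]
    linear_combination h3 - hΩ + (1 / 4) * sc + hr.pair 1 3 0 2
      - (1 / 2) * (ricS 3 2 + ricS 1 0)
  -- The conditions coming from J do not see this component. The Ricci contractions `r01`, `r23` and
  -- the cyclic identity express it through the M, L component: 𝒲 has trace zero.
  have wJJ : frameWeyl r 0 1 0 1 + frameWeyl r 0 1 2 3 + frameWeyl r 2 3 0 1
      + frameWeyl r 2 3 2 3 = 4 * Ω := by
    simp [frameWeyl, nullMetric]
    linear_combination (1 / 2) * ricS 1 0 + (1 / 2) * ricS 3 2 + r01 + r23 + hr.pair 2 3 0 1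
      + hr.pair 1 2 0 3 + 2 * hr.cyclic 0 1 2 3 - 2 * hr.right 0 2 3 1 + 4 * h3 - 4 * hΩ
  -- The Ricci contributions of the two summands are opposite, by symmetry of the Ricci tensor. The
  -- same happens in the next three identities.
  have wJM : frameWeyl r 0 1 0 2 + frameWeyl r 2 3 0 2 = X 2 0 - X 0 2 := by
    simp [frameWeyl, nullMetric]
    linear_combination h4 + (1 / 2) * ricS 0 2
  have wMJ : frameWeyl r 0 2 0 1 + frameWeyl r 0 2 2 3 = X 2 0 - X 0 2 := by
    simp [frameWeyl, nullMetric]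
    linear_combination h4 + hr.pair 0 2 0 1 + hr.pair 0 2 2 3 + (1 / 2) * ricS 2 0
  have wJL : frameWeyl r 0 1 1 3 + frameWeyl r 2 3 1 3 = X 1 3 - X 3 1 := by
    simp [frameWeyl, nullMetric]
    linear_combination h5 + (1 / 2) * ricS 3 1
  have wLJ : frameWeyl r 1 3 0 1 + frameWeyl r 1 3 2 3 = X 1 3 - X 3 1 := by
    simp [frameWeyl, nullMetric]
    linear_combination h5 + hr.pair 1 3 0 1 + hr.pair 1 3 2 3 + (1 / 2) * ricS 1 3
  rw [compForm_frameSD_right]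
  · simp only [compForm_frameSD_left L]
    rw [h1] at w02
    rw [h2] at w13
    linear_combination (1 / 4) * (nullSD a b * nullSD c d) * wJJ
      + (-1 / 2) * (nullSD a b * nullM c d) * wJM + (-1 / 2) * (nullM a b * nullSD c d) * wMJ
      + (-1 / 2) * (nullSD a b * nullL c d) * wJL + (-1 / 2) * (nullL a b * nullSD c d) * wLJ
      + nullM a b * nullM c d * w02 + nullL a b * nullL c d * w13
      + nullM a b * nullL c d * wML + nullL a b * nullM c d * wLM
  · intro a b c d
    simp only [compForm_frameSD_left L]
    rw [R 0 1, R 2 3, R 0 2, R 1 3]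
    ring

/-! ### Contractions in a null frame -/

theorem contract2 (E A : Tensor2 ℂ) :
    ∑ a, ∑ b, (E * nullMetric * E.transpose) a b * A a b =
      ∑ i, ∑ j, nullMetric i j * pull2 E A i j := by
  have h1 : ∀ a b, (E * nullMetric * E.transpose) a b =
      ∑ i, ∑ j, nullMetric i j * (E a i * E b j) := by
    intro a b
    simp only [Matrix.mul_apply, Matrix.transpose_apply, Finset.sum_mul]
    rw [Finset.sum_comm]
    exact Finset.sum_congr rfl fun i _ => Finset.sum_congr rfl fun j _ => by ring
  simp only [h1, pull2_apply, Finset.sum_mul, Finset.mul_sum]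
  rw [Finset.sum_congr rfl fun a _ => Finset.sum_comm, Finset.sum_comm]
  refine Finset.sum_congr rfl fun i _ => ?_
  rw [Finset.sum_congr rfl fun a _ => Finset.sum_comm, Finset.sum_comm]
  exact Finset.sum_congr rfl fun j _ => Finset.sum_congr rfl fun a _ =>
    Finset.sum_congr rfl fun b _ => by ring

theorem pull2_contract (E : Tensor2 ℂ) (P : Tensor4 ℂ) :
    pull2 E (Matrix.of fun b d => ∑ a, ∑ e, (E * nullMetric * E.transpose) a e * P e b a d) =
      frameRicci (pull4 E P) := by
  ext i j
  have h : ∀ p e', pull4 E P e' i p j =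
      pull2 E (Matrix.of fun a e => ∑ b, ∑ d, E b i * E d j * P e b a d) p e' := by
    intro p e'
    rw [pull2_apply]
    simp only [pull4, Matrix.of_apply, Finset.mul_sum]
    rw [Finset.sum_congr rfl fun e _ => Finset.sum_comm, Finset.sum_comm]
    refine Finset.sum_congr rfl fun a _ => Finset.sum_congr rfl fun e _ => ?_
    exact Finset.sum_congr rfl fun b _ => Finset.sum_congr rfl fun d _ => by ring
  simp only [frameRicci, Matrix.of_apply, h]
  rw [← contract2, pull2_apply]
  simp only [Matrix.of_apply, Finset.mul_sum]
  have e : ∀ f : Fin 4 → Fin 4 → Fin 4 → Fin 4 → ℂ, ∑ c, ∑ d, ∑ a, ∑ b, f a b c d =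
      ∑ a, ∑ b, ∑ c, ∑ d, f a b c d := by
    intro f
    rw [Finset.sum_congr rfl fun c _ => Finset.sum_comm, Finset.sum_comm]
    refine Finset.sum_congr rfl fun a _ => ?_
    rw [Finset.sum_congr rfl fun c _ => Finset.sum_comm, Finset.sum_comm]
  rw [e]
  exact Finset.sum_congr rfl fun a _ => Finset.sum_congr rfl fun b _ =>
    Finset.sum_congr rfl fun c _ => Finset.sum_congr rfl fun d _ => by ring

namespace IsSmoothMetric

variable {g : Coord → Tensor2 ℝ} {D : Set Coord} {y : Coord}

theorem ricci_cplx (hg : IsSmoothMetric g D) (hy : y ∈ D) :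
    cplx2 (ricci g y) = Matrix.of fun b d =>
      ∑ a, ∑ e, (cplx2 (g y))⁻¹ a e * cplx4 (riemann g y) e b a d := by
  ext b d
  have h : ∀ a, ∑ e, (g y)⁻¹ a e * riemann g y e b a d = riemannUp g y a b a d := by
    intro a
    have := congrFun (Matrix.mulVec_mulVec (fun f => riemannUp g y f b a d) (g y)⁻¹ (g y)) a
    rw [Matrix.nonsing_inv_mul _ (isUnit_iff_ne_zero.2 (hg.det_ne y hy)),
      Matrix.one_mulVec] at this
    exact this
  have h' : ricci g y b d = ∑ a, ∑ e, (g y)⁻¹ a e * riemann g y e b a d := by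
    simp only [h, ricci]
  rw [← cplx2_inv]
  simp only [cplx2, cplx4, Matrix.of_apply, h']
  push_cast
  rfl

theorem scalarCurv_cplx : (scalarCurv g y : ℂ) =
    ∑ a, ∑ b, (cplx2 (g y))⁻¹ a b * cplx2 (ricci g y) a b := by
  rw [← cplx2_inv]
  simp only [scalarCurv, cplx2]
  push_cast
  rfl

end IsSmoothMetric

namespace IsUmbilicalField

variable {g : Coord → Tensor2 ℝ} {J : Coord → Tensor2 ℂ} {U : Coord → Tensor2 ℝ}
  {D : Set Coord} {y : Coord} {E : Tensor2 ℂ}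

theorem isRiemannLike (h : IsUmbilicalField g J U D) (hy : y ∈ D) :
    IsRiemannLike (cplx4 (riemann g y)) where
  left := h.metric.riemann_skew_left hy
  right := IsSmoothMetric.riemann_skew_right
  pair := h.metric.riemann_pair hy
  cyclic := h.metric.riemann_cyclic

theorem pull2_ricci (h : IsUmbilicalField g J U D) (hy : y ∈ D)
    (hE : IsNullFrame (cplx2 (g y)) (J y) (cplx2 (U y)) E) :
    pull2 E (cplx2 (ricci g y)) = frameRicci (pull4 E (cplx4 (riemann g y))) := by
  rw [h.metric.ricci_cplx hy, hE.inv_metric, pull2_contract]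

theorem frameScalar_eq (h : IsUmbilicalField g J U D) (hy : y ∈ D)
    (hE : IsNullFrame (cplx2 (g y)) (J y) (cplx2 (U y)) E) :
    (scalarCurv g y : ℂ) = frameScalar (pull4 E (cplx4 (riemann g y))) := by
  rw [IsSmoothMetric.scalarCurv_cplx, hE.inv_metric, contract2, h.pull2_ricci hy hE]
  rfl

theorem pull4_weyl (h : IsUmbilicalField g J U D) (hy : y ∈ D)
    (hE : IsNullFrame (cplx2 (g y)) (J y) (cplx2 (U y)) E) :
    pull4 E (cplx4 (weyl g y)) = frameWeyl (pull4 E (cplx4 (riemann g y))) := by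
  set G := cplx2 (g y) with hG
  set R := cplx2 (ricci g y) with hR
  set s := (scalarCurv g y : ℂ) with hs
  have e : cplx4 (weyl g y) = cplx4 (riemann g y)
      - (1 / 2 : ℂ) • ((fun a b c d => G a c * R b d) - (fun a b c d => G a d * R b c)
        + (fun a b c d => R a c * G b d) - (fun a b c d => R a d * G b c))
      + (s / 6) • ((fun a b c d => G a c * G b d) - (fun a b c d => G a d * G b c)) := by
    funext a b c d
    simp only [cplx4, weyl, Pi.add_apply, Pi.sub_apply, Pi.smul_apply, smul_eq_mul, hG, hR, hs,
      cplx2]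
    push_cast
    ring
  have hgN : pull2 E G = nullMetric := hE.metric
  funext i j k l
  rw [e]
  simp only [pull4_add, pull4_sub, pull4_smul, Pi.add_apply, Pi.sub_apply, Pi.smul_apply,
    smul_eq_mul, pull4_prod_mid, pull4_prod_cross, hgN]
  rw [hR, h.pull2_ricci hy hE, hs, h.frameScalar_eq hy hE, frameWeyl]
  ring

theorem pull4_sdMetric (hE : IsNullFrame (cplx2 (g y)) (J y) (cplx2 (U y)) E) {η : Tensor4 ℝ}
    (hη : ∀ i j k l, pull4 E (cplx4 η) i j k l = -I * leviCivita i j k l) :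
    pull4 E (sdMetric (g y) η) = frameSD := by
  have e : sdMetric (g y) η = (1 / 2 : ℂ) • ((fun a b c d => cplx2 (g y) a c * cplx2 (g y) b d)
      - (fun a b c d => cplx2 (g y) a d * cplx2 (g y) b c) - I • cplx4 η) := by
    funext a b c d
    simp only [sdMetric, formMetric, Pi.sub_apply, Pi.smul_apply, smul_eq_mul, cplx2]
    push_cast
    ring
  have hgN : pull2 E (cplx2 (g y)) = nullMetric := hE.metric
  funext i j k l
  rw [e]
  simp only [pull4_sub, pull4_smul, Pi.sub_apply, Pi.smul_apply,
    smul_eq_mul, pull4_prod_mid, pull4_prod_cross, hgN, hη, frameSD]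
  linear_combination (1 / 2) * (leviCivita i j k l : ℂ) * Complex.I_mul_I

/-- The scalar `Ω` in terms of the dual Lee form. -/
noncomputable def leeScalar (g : Coord → Tensor2 ℝ) (J : Coord → Tensor2 ℂ) (y : Coord) : ℂ :=
  (1 / 2) * ((∑ a, ∑ b, cplx2 (g y)⁻¹ a b * dualLeeForm g J y a * dualLeeForm g J y b)
    - codiff1 g (dualLeeForm g J) y) - (scalarCurv g y : ℂ) / 12

theorem leeScalar_frame (h : IsUmbilicalField g J U D) (hy : y ∈ D)
    (hE : IsNullFrame (cplx2 (g y)) (J y) (cplx2 (U y)) E) {k : Fin 4 → ℂ} {X : Tensor2 ℂ}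
    (hk : k = Matrix.vecMul (dualLeeForm g J y) E)
    (hX : X = pull2 E (Matrix.of (cov1 g (dualLeeForm g J) y))) :
    leeScalar g J y = (1 / 2) * (2 * (k 0 * k 1 + k 2 * k 3) + (X 0 1 + X 1 0 + X 2 3 + X 3 2))
      - frameScalar (pull4 E (cplx4 (riemann g y))) / 12 := by
  have h1 : ∑ a, ∑ b, cplx2 (g y)⁻¹ a b * dualLeeForm g J y a * dualLeeForm g J y b =
      ∑ i, ∑ j, nullMetric i j * (k i * k j) := by
    have := contract2 E (Matrix.vecMulVec (dualLeeForm g J y) (dualLeeForm g J y))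
    rw [← hE.inv_metric, ← cplx2_inv] at this
    have hp : pull2 E (Matrix.vecMulVec (dualLeeForm g J y) (dualLeeForm g J y)) =
        Matrix.vecMulVec k k := by
      rw [pull2, Matrix.mul_vecMulVec, Matrix.vecMulVec_mul, hk, Matrix.mulVec_transpose]
    rw [hp] at this
    simp only [Matrix.vecMulVec_apply, ← mul_assoc] at this
    simp only [← mul_assoc]
    exact this
  have h2 : codiff1 g (dualLeeForm g J) y = -∑ i, ∑ j, nullMetric i j * X i j := by
    have := contract2 E (Matrix.of (cov1 g (dualLeeForm g J) y))
    rw [← hE.inv_metric, ← cplx2_inv, ← hX] at this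
    rw [codiff1, ← this]
    simp only [Matrix.of_apply, cov1_apply]
  rw [leeScalar, h1, h2, h.frameScalar_eq hy hE]
  simp [Fin.sum_univ_four, nullMetric]
  ring

theorem extDeriv1_eq (h : IsUmbilicalField g J U D) (u : Coord → Fin 4 → ℂ) (a b : Fin 4) :
    extDeriv1 u y a b = cov1 g u y a b - cov1 g u y b a := by
  have hs : ∀ d, christoffel g y d a b = christoffel g y d b a := fun d =>
    h.metric.christoffel_symm y d a b
  simp only [cov1_apply, nabla1, extDeriv1, hs]
  ring

/-- Bracketing with J multiplies the entry (i, j) by ε_i + ε_j, with ε = (1,−1,1,−1). So 𝒵 extracts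
from dχ its M and L components, the self-dual part orthogonal to 𝒰. -/
theorem pull2_comm_extDeriv1 (h : IsUmbilicalField g J U D)
    (hE : IsNullFrame (cplx2 (g y)) (J y) (cplx2 (U y)) E) {X : Tensor2 ℂ}
    (hX : X = pull2 E (Matrix.of (cov1 g (dualLeeForm g J) y))) :
    pull2 E (tensorComm (cplx2 (g y)⁻¹) (extDeriv1 (dualLeeForm g J) y) (J y)) =
      (2 : ℂ) • ((X 0 2 - X 2 0) • nullM - (X 1 3 - X 3 1) • nullL) := by
  have hd : pull2 E (extDeriv1 (dualLeeForm g J) y) = X - X.transpose := by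
    have : extDeriv1 (dualLeeForm g J) y = Matrix.of (cov1 g (dualLeeForm g J) y)
        - (Matrix.of (cov1 g (dualLeeForm g J) y)).transpose := by
      ext a b; exact h.extDeriv1_eq _ a b
    rw [this, hX, pull2, pull2]
    simp only [mul_sub, sub_mul, Matrix.transpose_mul, Matrix.transpose_transpose, mul_assoc]
  have hj : pull2 E (J y) = nullSD := hE.canon
  have hc : ∀ A B : Tensor2 ℂ, pull2 E (A * cplx2 (g y)⁻¹ * B) =
      pull2 E A * nullMetric * pull2 E B := by
    intro A B
    rw [cplx2_inv, hE.inv_metric]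
    simp only [pull2, mul_assoc]
  have hs : ∀ A B : Tensor2 ℂ, pull2 E (A - B) = pull2 E A - pull2 E B := by
    intro A B; simp only [pull2, mul_sub, sub_mul]
  rw [tensorComm, hs, hc, hc, hd, hj, mul_assoc, nullMetric_mul_nullSD]
  have hn : nullSD * nullMetric = Matrix.diagonal ![-1, 1, -1, 1] := by
    ext i j
    fin_cases i <;> fin_cases j <;> simp [nullMetric, nullSD, Matrix.mul_apply, Fin.sum_univ_four]
  rw [hn]
  ext i j
  rw [Matrix.sub_apply, Matrix.mul_diagonal, Matrix.diagonal_mul]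
  fin_cases i <;> fin_cases j <;> simp [nullM, nullL] <;> ring

end IsUmbilicalField

/-! ### The canonical 2-form and its concomitants -/

/-- The canonical self-dual 2-form, normalised to have square one. -/
noncomputable def unitSD (g : Coord → Tensor2 ℝ) (η : Coord → Tensor4 ℝ) (U : Coord → Tensor2 ℝ)
    (z : Coord) : Tensor2 ℂ :=
  cplx2 (U z) - I • hodge (g z) (η z) (cplx2 (U z))

theorem inv_sqrt_two_mul_self :
    ((1 / Real.sqrt 2 : ℝ) : ℂ) * ((1 / Real.sqrt 2 : ℝ) : ℂ) = 1 / 2 := by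
  rw [← Complex.ofReal_mul, div_mul_div_comm, Real.mul_self_sqrt (by norm_num)]
  norm_num

section

variable {g : Coord → Tensor2 ℝ} {η : Coord → Tensor4 ℝ} {U : Coord → Tensor2 ℝ}
  {D : Set Coord} {y : Coord} {E : Tensor2 ℂ}

theorem canonSD_eq (z : Coord) :
    canonSD g η U z = ((1 / Real.sqrt 2 : ℝ) : ℂ) • unitSD g η U z := rfl

theorem codiff2_smul (c : ℂ) {F : Coord → Tensor2 ℂ} (hF : MatSmoothAt F y) (b : Fin 4) :
    codiff2 g (fun z => c • F z) y b = c * codiff2 g F y b := by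
  have h : ∀ i a b, nabla2 g (fun z => c • F z) y i a b = c * nabla2 g F y i a b := by
    intro i a b
    have := congrFun (congrFun (matPd_smul c hF i) a) b
    have e : pd i (fun z => (c • F z) a b) y = c * pd i (fun z => F z a b) y := this
    rw [nabla2, nabla2, e]
    simp only [Matrix.smul_apply, smul_eq_mul, mul_sub, Finset.mul_sum, mul_left_comm c]
  simp only [codiff2, h, mul_neg, Finset.mul_sum, mul_left_comm c]

theorem IsSmoothMetric.cplx_inv_symm (hg : IsSmoothMetric g D) (z : Coord) (a b : Fin 4) :
    cplx2 (g z)⁻¹ a b = cplx2 (g z)⁻¹ b a := by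
  have h : (g z).transpose = g z := by ext a b; exact hg.symm z b a
  have h2 : ((g z)⁻¹).transpose = (g z)⁻¹ := by rw [Matrix.transpose_nonsing_inv, h]
  exact congrArg (fun x : ℝ => (x : ℂ)) (congrFun (congrFun h2 b) a)

/-- χ is quadratic in 𝒰 = J/√2, and the two factors 1/√2 give the ½ of `leeForm`. The equality holds
throughout `D`, so it passes to derivatives. -/
theorem IsUmbilicalField.chi_eq (h : IsUmbilicalField g (unitSD g η U) U D) {z : Coord}
    (hz : z ∈ D) : chi g η U z = dualLeeForm g (unitSD g η U) z := by
  funext b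
  simp only [chi, dualLeeForm, leeForm, Matrix.vecMul, dotProduct, Matrix.mul_apply,
    Finset.mul_sum]
  rw [Finset.sum_comm]
  refine Finset.sum_congr rfl fun c _ => Finset.sum_congr rfl fun a _ => ?_
  rw [show canonSD g η U = fun z => ((1 / Real.sqrt 2 : ℝ) : ℂ) • unitSD g η U z from rfl,
    codiff2_smul _ (h.canon_smooth z hz), h.metric.cplx_inv_symm z a c]
  simp only [Matrix.smul_apply, smul_eq_mul]
  linear_combination (cplx2 (g z)⁻¹ c a * codiff2 g (unitSD g η U) z c * unitSD g η U z a b)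
    * inv_sqrt_two_mul_self

theorem IsUmbilicalField.pd_chi (h : IsUmbilicalField g (unitSD g η U) U D) (hy : y ∈ D)
    (a b : Fin 4) : pd a (fun z => chi g η U z b) y =
      pd a (fun z => dualLeeForm g (unitSD g η U) z b) y :=
  pd_congr (Filter.eventually_of_mem (h.mem_nhds hy) fun _ hz => congrFun (h.chi_eq hz) b) a

theorem IsUmbilicalField.omegaScalar_eq (h : IsUmbilicalField g (unitSD g η U) U D)
    (hy : y ∈ D) :
    omegaScalar g η U y = IsUmbilicalField.leeScalar g (unitSD g η U) y := by
  simp only [omegaScalar, IsUmbilicalField.leeScalar, chiSq, codiff1, nabla1, h.chi_eq hy,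
    h.pd_chi hy]

theorem IsUmbilicalField.pull2_zForm (h : IsUmbilicalField g (unitSD g η U) U D) (hy : y ∈ D)
    (hE : IsNullFrame (cplx2 (g y)) (unitSD g η U y) (cplx2 (U y)) E) {X : Tensor2 ℂ}
    (hX : X = pull2 E (Matrix.of (cov1 g (dualLeeForm g (unitSD g η U)) y))) :
    pull2 E (zForm g η U y) = ((1 / Real.sqrt 2 : ℝ) : ℂ) •
      ((X 0 2 - X 2 0) • nullM - (X 1 3 - X 3 1) • nullL) := by
  have h1 : extDeriv1 (chi g η U) y = extDeriv1 (dualLeeForm g (unitSD g η U)) y := by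
    funext a b
    simp only [extDeriv1, h.pd_chi hy]
  have h2 : zForm g η U y = ((1 / 2 : ℂ) * ((1 / Real.sqrt 2 : ℝ) : ℂ)) •
      tensorComm (cplx2 (g y)⁻¹) (extDeriv1 (dualLeeForm g (unitSD g η U)) y)
        (unitSD g η U y) := by
    rw [zForm, h1, canonSD_eq, mul_smul]
    simp only [tensorComm, Matrix.mul_smul, Matrix.smul_mul, smul_sub]
  have h3 : ∀ (c : ℂ) A, pull2 E (c • A) = c • pull2 E A := by
    intro c A; simp only [pull2, Matrix.mul_smul, Matrix.smul_mul]
  rw [h2, h3, h.pull2_comm_extDeriv1 hE hX, smul_smul]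
  congr 1
  ring

end

/-! ### Self-dual 2-forms in a null frame -/

theorem hodge_frame {A : Tensor2 ℂ} {P : Tensor4 ℂ}
    (hP : ∀ i j k l, P i j k l = -I * leviCivita i j k l) (hA : A.transpose = -A) :
    applyForm nullMetric P A =
      I • !![0, A 2 3, A 0 2, -A 0 3; -A 2 3, 0, -A 1 2, A 1 3;
        -A 0 2, A 1 2, 0, A 0 1; A 0 3, -A 1 3, -A 0 1, 0] := by
  have s : ∀ a b, A b a = -A a b := fun a b => congrFun (congrFun hA a) b
  ext a b
  rw [applyForm_nullMetric]
  simp only [hP, Fin.sum_univ_four]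
  fin_cases a <;> fin_cases b <;> simp [leviCivita, pairSign] <;>
    first
    | (rw [s 0 1]; ring) | (rw [s 0 2]; ring) | (rw [s 0 3]; ring)
    | (rw [s 1 2]; ring) | (rw [s 1 3]; ring) | (rw [s 2 3]; ring)

/-- A self-dual 2-form in a null frame, from its three components. -/
noncomputable def sdComb (v : Fin 3 → ℂ) : Tensor2 ℂ :=
  v 0 • nullSD + v 1 • nullM + v 2 • nullL

/-- The three components of a self-dual 2-form in a null frame. -/
def sdCoord (A : Tensor2 ℂ) : Fin 3 → ℂ := ![-A 0 1, A 0 2, A 1 3]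

theorem sdCoord_sdComb (v : Fin 3 → ℂ) : sdCoord (sdComb v) = v := by
  ext i; fin_cases i <;> simp [sdCoord, sdComb, nullSD, nullM, nullL]

theorem sdComb_skew (v : Fin 3 → ℂ) : (sdComb v).transpose = -sdComb v := by
  ext i j
  fin_cases i <;> fin_cases j <;> simp [sdComb, nullSD, nullM, nullL]

/-- In a null frame *A = iA says A₀₃ = A₁₂ = 0 and A₀₁ = A₂₃, which leaves the span of J, M, L. -/
theorem selfDual_frame_iff {A : Tensor2 ℂ} {P : Tensor4 ℂ}
    (hP : ∀ i j k l, P i j k l = -I * leviCivita i j k l) :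
    (A.transpose = -A ∧ applyForm nullMetric P A = I • A) ↔ sdComb (sdCoord A) = A := by
  constructor
  · rintro ⟨hA, h⟩
    rw [hodge_frame hP hA] at h
    have h' := smul_right_injective _ Complex.I_ne_zero h
    have e : ∀ a b, _ = A a b := fun a b => congrFun (congrFun h' a) b
    have s : ∀ a b, A b a = -A a b := fun a b => congrFun (congrFun hA a) b
    have d : ∀ a, A a a = 0 := fun a => by linear_combination (1 / 2) * s a a
    have e01 := e 0 1
    have e03 := e 0 3
    have e12 := e 1 2
    simp at e01 e03 e12
    have z03 : A 0 3 = 0 := by linear_combination (-1 / 2) * e03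
    have z12 : A 1 2 = 0 := by linear_combination (-1 / 2) * e12
    ext a b
    fin_cases a <;> fin_cases b <;>
      simp [sdComb, sdCoord, nullSD, nullM, nullL, d, z03, z12, e01, s 0 1, s 0 2, s 0 3, s 1 2,
        s 1 3, s 2 3]
  · intro h
    have hA : A.transpose = -A := by rw [← h]; exact sdComb_skew _
    refine ⟨hA, ?_⟩
    rw [hodge_frame hP hA, ← h]
    congr 1
    ext a b
    fin_cases a <;> fin_cases b <;> simp [sdComb, sdCoord, nullSD, nullM, nullL]

/-- The self-dual Weyl tensor of an umbilical 2+2 structure in a null frame. -/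
noncomputable def frameTypeI (Ω z w : ℂ) : Tensor4 ℂ := fun a b c d =>
  Ω * (nullSD a b * nullSD c d) + Ω * (nullM a b * nullL c d + nullL a b * nullM c d)
    + (1 / 2) * (nullSD a b * (z * nullM c d - w * nullL c d)
      + (z * nullM a b - w * nullL a b) * nullSD c d)

/-- The matrix of 𝒲 in the basis J, M, L; its entries follow from (J, J) = −2 and (M, L) = 1. -/
theorem applyForm_frameTypeI (Ω z w : ℂ) (v : Fin 3 → ℂ) :
    applyForm nullMetric (frameTypeI Ω z w) (sdComb v) =
      sdComb ((!![-2 * Ω, -w / 2, z / 2; -z, Ω, 0; w, 0, Ω] : Matrix (Fin 3) (Fin 3) ℂ).mulVec v) := by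
  ext a b
  rw [applyForm_nullMetric]
  simp only [Fin.sum_univ_four, frameTypeI, sdComb, Matrix.add_apply, Matrix.smul_apply, smul_eq_mul]
  simp [nullSD, nullM, nullL, Matrix.mulVec, dotProduct, Fin.sum_univ_three]
  ring

/-! ### The spectrum of the self-dual Weyl tensor -/

section

variable {V : Type*} [AddCommGroup V] [Module ℂ V] {n : Type*} [Fintype n] [DecidableEq n]

theorem eq_conj_toLin' (e : V ≃ₗ[ℂ] (n → ℂ)) {f : Module.End ℂ V} {A : Matrix n n ℂ}
    (h : ∀ v, e (f v) = A.mulVec (e v)) : f = e.symm.conj (Matrix.toLin' A) := by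
  ext v
  apply e.injective
  simp [LinearEquiv.conj_apply, h]

theorem trace_eq_of_conj (e : V ≃ₗ[ℂ] (n → ℂ)) {f : Module.End ℂ V} {A : Matrix n n ℂ}
    (h : ∀ v, e (f v) = A.mulVec (e v)) : LinearMap.trace ℂ V f = A.trace := by
  rw [eq_conj_toLin' e h, LinearMap.trace_conj', Matrix.trace_toLin'_eq]

theorem charpoly_eq_of_conj [Module.Finite ℂ V] (e : V ≃ₗ[ℂ] (n → ℂ))
    {f : Module.End ℂ V} {A : Matrix n n ℂ}
    (h : ∀ v, e (f v) = A.mulVec (e v)) : f.charpoly = A.charpoly := by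
  rw [eq_conj_toLin' e h, LinearEquiv.charpoly_conj, Matrix.charpoly_toLin']

/-- The characteristic polynomial is (x − Ω)(x² + Ωx − 2Ω² + ζ). Its quadratic factor has
discriminant 9Ω² − 4ζ, and working with the polynomial covers coinciding eigenvalues and
non-diagonalizable cases uniformly. -/
theorem spectrum_frameTypeI [Module.Finite ℂ V] (e : V ≃ₗ[ℂ] (Fin 3 → ℂ))
    {f : Module.End ℂ V} {Ω z w ζ : ℂ} (hζ : ζ = -(z * w))
    (h : ∀ v, e (f v) =
      (!![-2 * Ω, -w / 2, z / 2; -z, Ω, 0; w, 0, Ω] : Matrix (Fin 3) (Fin 3) ℂ).mulVec (e v)) :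
    LinearMap.trace ℂ V (f ^ 2) = 2 * (3 * Ω ^ 2 - ζ) ∧
    LinearMap.trace ℂ V (f ^ 3) = 3 * Ω * (ζ - 2 * Ω ^ 2) ∧
    ∀ s : ℂ, s ^ 2 = 9 * Ω ^ 2 - 4 * ζ →
      f.charpoly.roots = {Ω, (-Ω + s) / 2, (-Ω - s) / 2} ∧
      ∀ μ : ℂ, Module.End.HasEigenvalue f μ ↔
        μ = Ω ∨ μ = (-Ω + s) / 2 ∨ μ = (-Ω - s) / 2 := by
  set A : Matrix (Fin 3) (Fin 3) ℂ := !![-2 * Ω, -w / 2, z / 2; -z, Ω, 0; w, 0, Ω] with hA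
  have hp : ∀ k : ℕ, ∀ v, e ((f ^ k) v) = (A ^ k).mulVec (e v) := by
    intro k
    induction k with
    | zero => intro v; simp
    | succ k ih =>
      intro v
      rw [pow_succ, Module.End.mul_apply, ih, h, pow_succ, Matrix.mulVec_mulVec]
  refine ⟨?_, ?_, fun s hs => ?_⟩
  · rw [trace_eq_of_conj e (hp 2), pow_two, hζ]
    simp [Matrix.trace, Fin.sum_univ_three, hA]
    ring
  · rw [trace_eq_of_conj e (hp 3), pow_succ, pow_two, hζ]
    simp [Matrix.trace, Fin.sum_univ_three, hA]
    ring
  · have hc : f.charpoly = (Polynomial.X - Polynomial.C Ω) *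
        ((Polynomial.X - Polynomial.C ((-Ω + s) / 2)) *
          (Polynomial.X - Polynomial.C ((-Ω - s) / 2))) := by
      rw [charpoly_eq_of_conj e h]
      refine Polynomial.funext fun x => ?_
      rw [Matrix.eval_charpoly, Matrix.det_fin_three]
      simp [hA, Matrix.scalar_apply]
      linear_combination (1 / 4) * (x - Ω) * hs - (x - Ω) * hζ
    have hr : f.charpoly.roots = {Ω, (-Ω + s) / 2, (-Ω - s) / 2} := by
      have h1 := Polynomial.X_sub_C_ne_zero Ω
      have h2 := Polynomial.X_sub_C_ne_zero ((-Ω + s) / 2)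
      have h3 := Polynomial.X_sub_C_ne_zero ((-Ω - s) / 2)
      rw [hc, Polynomial.roots_mul (mul_ne_zero h1 (mul_ne_zero h2 h3)),
        Polynomial.roots_mul (mul_ne_zero h2 h3), Polynomial.roots_X_sub_C,
        Polynomial.roots_X_sub_C, Polynomial.roots_X_sub_C]
      rfl
    refine ⟨hr, fun μ => ?_⟩
    rw [Module.End.hasEigenvalue_iff_isRoot_charpoly,
      ← Polynomial.mem_roots (LinearMap.charpoly_monic f).ne_zero, hr]
    simp

end

/-! ### The theorem for a field of umbilical structures on a coordinate domain. -/

section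

variable {g : Coord → Tensor2 ℝ} {η : Coord → Tensor4 ℝ} {U : Coord → Tensor2 ℝ}
  {D : Set Coord} {y : Coord} {E : Tensor2 ℂ}

theorem pull2_smul (E : Tensor2 ℂ) (c : ℂ) (A : Tensor2 ℂ) : pull2 E (c • A) = c • pull2 E A := by
  simp only [pull2, Matrix.mul_smul, Matrix.smul_mul]

theorem pull2_add (E A B : Tensor2 ℂ) : pull2 E (A + B) = pull2 E A + pull2 E B := by
  simp only [pull2, Matrix.mul_add, Matrix.add_mul]

namespace IsNullFrame

variable {G J K E : Tensor2 ℂ}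

/-- Every 2-tensor is determined by its components in a null frame, which may be prescribed. -/
theorem pull2_coframe (hE : IsNullFrame G J K E) (A : Tensor2 ℂ) :
    pull2 E (pull2 (coframe G E) A) = A := by
  have h := hE.coframe_mul
  have h' : E.transpose * (coframe G E).transpose = 1 := by
    rw [← Matrix.transpose_mul, h, Matrix.transpose_one]
  simp only [pull2, mul_assoc, h, mul_one]
  rw [← mul_assoc, h', one_mul]

theorem mem_sdForms_iff {g : Tensor2 ℝ} {η : Tensor4 ℝ} (hE : IsNullFrame (cplx2 g) J K E)
    (hη : ∀ i j k l, pull4 E (cplx4 η) i j k l = -I * leviCivita i j k l) {F : Tensor2 ℂ} :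
    F ∈ sdForms g η ↔ sdComb (sdCoord (pull2 E F)) = pull2 E F := by
  rw [← selfDual_frame_iff hη]
  have h1 : F.transpose = -F ↔ (pull2 E F).transpose = -pull2 E F := by
    have e1 : (pull2 E F).transpose = pull2 E F.transpose := by
      simp only [pull2, Matrix.transpose_mul, Matrix.transpose_transpose, mul_assoc]
    have e2 : -pull2 E F = pull2 E (-F) := by simp only [pull2, mul_neg, neg_mul]
    rw [e1, e2]
    exact ⟨congrArg _, hE.pull_inj⟩
  have h2 : hodge g η F = I • F ↔
      applyForm nullMetric (pull4 E (cplx4 η)) (pull2 E F) = I • pull2 E F := by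
    rw [← hE.pull2_applyForm, ← pull2_smul, ← cplx2_inv]
    exact ⟨congrArg _, hE.pull_inj⟩
  exact and_congr h1 h2

theorem formProd_pull2 (hE : IsNullFrame G J K E) (F H : Tensor2 ℂ) :
    formProd G⁻¹ F H = formProd nullMetric (pull2 E F) (pull2 E H) := by
  have h : ∀ q F H : Tensor2 ℂ,
      formProd q F H = (1 / 2) * (F.transpose * (q * (H * q.transpose))).trace := by
    intro q F H
    rw [formProd]
    simp only [Matrix.trace, Matrix.diag, Matrix.mul_apply, Matrix.transpose_apply, Finset.mul_sum]
    rw [Finset.sum_comm]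
    exact Finset.sum_congr rfl fun a _ => Finset.sum_congr rfl fun b _ =>
      Finset.sum_congr rfl fun c _ => Finset.sum_congr rfl fun d _ => by ring
  rw [h, h, hE.inv_metric, Matrix.transpose_mul, Matrix.transpose_mul, Matrix.transpose_transpose,
    nullMetric_transpose, pull2, pull2]
  simp only [← mul_assoc]
  rw [Matrix.trace_mul_comm]
  simp only [Matrix.transpose_mul, Matrix.transpose_transpose, mul_assoc]

/-- The components of self-dual 2-forms in a null frame. -/
noncomputable def sdEquiv {g : Tensor2 ℝ} {η : Tensor4 ℝ} (hE : IsNullFrame (cplx2 g) J K E)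
    (hη : ∀ i j k l, pull4 E (cplx4 η) i j k l = -I * leviCivita i j k l) :
    sdForms g η ≃ₗ[ℂ] (Fin 3 → ℂ) where
  toFun F := sdCoord (pull2 E F)
  map_add' F H := by
    ext i
    fin_cases i <;> simp [sdCoord, pull2_add, add_comm]
  map_smul' c F := by
    ext i
    fin_cases i <;> simp [sdCoord, pull2_smul]
  invFun v := ⟨pull2 (coframe (cplx2 g) E) (sdComb v), by
    rw [hE.mem_sdForms_iff hη, hE.pull2_coframe, sdCoord_sdComb]⟩
  left_inv F := by
    apply Subtype.ext
    refine hE.pull_inj ?_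
    change pull2 E (pull2 _ _) = pull2 E F
    rw [hE.pull2_coframe]
    exact (hE.mem_sdForms_iff hη).1 F.2
  right_inv v := by
    simp only [hE.pull2_coframe, sdCoord_sdComb]

end IsNullFrame

/-- Everything is compared through its components in the null frame `E` at `y`, where 𝒲 depends only
on Ω and on the two components `z`, `w` of dχ. -/
theorem sdWeyl_of_isUmbilicalField (h : IsUmbilicalField g (unitSD g η U) U D) (hy : y ∈ D)
    (hE : IsNullFrame (cplx2 (g y)) (unitSD g η U y) (cplx2 (U y)) E)
    (hη : ∀ i j k l, pull4 E (cplx4 (η y)) i j k l = -I * leviCivita i j k l) :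
    let V := sdForms (g y) (η y)
    let 𝒰 := canonSD g η U y
    let Ω := omegaScalar g η U y
    let 𝒵 := zForm g η U y
    let ζ := formProd (cplx2 (g y)⁻¹) 𝒵 𝒵
    sdWeyl g η y = (3 * Ω) • tensorProd 𝒰 𝒰 + Ω • sdMetric (g y) (η y)
        + (tensorProd 𝒰 𝒵 + tensorProd 𝒵 𝒰) ∧
    ∃ hW : ∀ F ∈ V, sdWeylEnd g η y F ∈ V,
      let 𝒲 : Module.End ℂ V := (sdWeylEnd g η y).restrict hW
      LinearMap.trace ℂ V (𝒲 ^ 2) = 2 * (3 * Ω ^ 2 - ζ) ∧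
      LinearMap.trace ℂ V (𝒲 ^ 3) = 3 * Ω * (ζ - 2 * Ω ^ 2) ∧
      ∀ w : ℂ, w ^ 2 = 9 * Ω ^ 2 - 4 * ζ →
        (LinearMap.charpoly 𝒲).roots = {Ω, (-Ω + w) / 2, (-Ω - w) / 2} ∧
        ∀ μ : ℂ, Module.End.HasEigenvalue 𝒲 μ ↔
          μ = Ω ∨ μ = (-Ω + w) / 2 ∨ μ = (-Ω - w) / 2 := by
  intro V 𝒰 Ω 𝒵 ζ
  obtain ⟨X, hX⟩ : ∃ X, X = pull2 E (Matrix.of (cov1 g (dualLeeForm g (unitSD g η U)) y)) :=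
    ⟨_, rfl⟩
  set z := X 0 2 - X 2 0 with hz
  set w := X 1 3 - X 3 1 with hw
  have hΩ := (h.omegaScalar_eq hy).trans (h.leeScalar_frame hy hE rfl hX)
  have hSD : pull4 E (sdMetric (g y) (η y)) = frameSD := IsUmbilicalField.pull4_sdMetric hE hη
  have hWe : pull4 E (sdWeyl g η y) = frameTypeI Ω z w := by
    rw [sdWeyl, cplx2_inv, hE.pull4_compForm, hE.pull4_compForm, hSD, h.pull4_weyl hy hE]
    funext a b c d
    exact frame_sdWeyl ((h.isRiemannLike hy).pull E)
      (fun i j c d => by rw [hX]; exact h.frame_curvature hy hE i j c d) hΩ a b c d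
  have hZ : pull2 E 𝒵 = _ := h.pull2_zForm hy hE hX
  have hU : pull2 E 𝒰 = ((1 / Real.sqrt 2 : ℝ) : ℂ) • nullSD := by
    rw [show 𝒰 = _ from canonSD_eq y, pull2_smul]
    exact congrArg _ hE.canon
  -- 𝒵 = (zM − wL)/√2 and (M, L) = 1 is the only nonzero product of M and L.
  have hζ : ζ = -(z * w) := by
    rw [show ζ = formProd _ 𝒵 𝒵 from rfl, cplx2_inv, hE.formProd_pull2, hZ, formProd_nullMetric]
    have := inv_sqrt_two_mul_self
    generalize ((1 / Real.sqrt 2 : ℝ) : ℂ) = c at this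
    simp only [Fin.sum_univ_four, Matrix.smul_apply, Matrix.sub_apply, smul_eq_mul, ← hz, ← hw]
    simp [nullM, nullL]
    linear_combination (-2 * z * w) * this
  have act : ∀ F, pull2 E (sdWeylEnd g η y F) =
      applyForm nullMetric (frameTypeI Ω z w) (pull2 E F) := by
    intro F
    rw [sdWeylEnd, cplx2_inv, hE.pull2_applyForm, hWe]
  have hW : ∀ F ∈ V, sdWeylEnd g η y F ∈ V := by
    intro F hF
    have hF' := (hE.mem_sdForms_iff hη).1 hF
    refine (hE.mem_sdForms_iff hη).2 ?_
    rw [act, ← hF', applyForm_frameTypeI, sdCoord_sdComb]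
  refine ⟨hE.pull4_inj ?_, hW, ?_⟩
  · rw [hWe]
    simp only [pull4_add, pull4_smul, pull4_tensorProd, hSD, hZ, hU]
    funext a b c d
    simp only [Pi.add_apply, Pi.smul_apply, tensorProd, frameSD_eq, frameTypeI, smul_eq_mul,
      Matrix.smul_apply, Matrix.sub_apply]
    have := inv_sqrt_two_mul_self
    generalize ((1 / Real.sqrt 2 : ℝ) : ℂ) = s at this
    -- 3Ω 𝒰⊗𝒰 contributes (3/2)Ω J⊗J and Ω𝒢 contributes −½Ω J⊗J, which add up to Ω J⊗J. The
    -- multiplier uses (1/√2)² = ½ in every product of 𝒰 with 𝒰 or 𝒵.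
    linear_combination (-3 * Ω * (nullSD a b * nullSD c d)
      - nullSD a b * (z * nullM c d - w * nullL c d)
      - (z * nullM a b - w * nullL a b) * nullSD c d) * this
  · have : Module.Finite ℂ V := Module.Finite.equiv (hE.sdEquiv hη).symm
    refine spectrum_frameTypeI (hE.sdEquiv hη) hζ fun v => ?_
    change sdCoord (pull2 E (sdWeylEnd g η y v)) = _
    rw [act, ← (hE.mem_sdForms_iff hη).1 v.2, applyForm_frameTypeI, sdCoord_sdComb]
    rfl

end

/-! ### Orthonormal frames and null frames -/

theorem cplx2_mul (A B : Tensor2 ℝ) : cplx2 (A * B) = cplx2 A * cplx2 B :=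
  map_mul Complex.ofRealHom.mapMatrix A B

theorem pull4_mul (A C : Tensor2 ℂ) (P : Tensor4 ℂ) :
    pull4 (A * C) P = pull4 C (pull4 A P) := by
  apply flat_inj
  simp only [flat_pull4, Matrix.mul_kronecker_mul, Matrix.transpose_mul, mul_assoc]

/-- The complex null frame of the Minkowski space. -/
noncomputable def nullBasis : Tensor2 ℂ :=
  ((1 / Real.sqrt 2 : ℝ) : ℂ) • !![1, -1, 0, 0; 1, 1, 0, 0; 0, 0, 1, 1; 0, 0, I, -I]

theorem pull2_nullBasis (A : Tensor2 ℂ) : pull2 nullBasis A =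
    (1 / 2 : ℂ) • pull2 !![1, -1, 0, 0; 1, 1, 0, 0; 0, 0, 1, 1; 0, 0, I, -I] A := by
  simp only [pull2, nullBasis, Matrix.transpose_smul, Matrix.smul_mul, Matrix.mul_smul, smul_smul,
    inv_sqrt_two_mul_self]

theorem pull2_nullBasis_minkowski :
    pull2 nullBasis (cplx2 (Matrix.of minkowski)) = nullMetric := by
  rw [pull2_nullBasis]
  ext i j
  rw [Matrix.smul_apply, pull2_apply]
  simp only [Fin.sum_univ_four]
  fin_cases i <;> fin_cases j <;> simp [cplx2, minkowski, nullMetric] <;> norm_num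

theorem pull2_nullBasis_plane : pull2 nullBasis nullPlane = nullPlane := by
  rw [pull2_nullBasis]
  ext i j
  rw [Matrix.smul_apply, pull2_apply]
  simp only [Fin.sum_univ_four]
  fin_cases i <;> fin_cases j <;> simp [nullPlane] <;> norm_num

/-- An alternating 4-tensor is scaled by the determinant of the frame, and `nullBasis` has
determinant −i. -/
theorem pull4_nullBasis {P : Tensor4 ℂ} (hP : IsAlt4 P) (h1 : P 0 1 2 3 = 1) (i j k l : Fin 4) :
    pull4 nullBasis P i j k l = -I * leviCivita i j k l := by
  have d : ∀ a b c, P a b c c = 0 := fun a b c => by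
    linear_combination (1 / 2) * hP.right a b c c
  have d' : ∀ a b c, P a a b c = 0 := fun a b c => by
    linear_combination (1 / 2) * hP.left a a b c
  have hc := inv_sqrt_two_mul_self
  have inner : ∀ a b, ∑ c, ∑ d, nullBasis c 2 * nullBasis d 3 * P a b c d = -I * P a b 2 3 := by
    intro a b
    rw [nullBasis]
    generalize ((1 / Real.sqrt 2 : ℝ) : ℂ) = s at hc
    simp [Fin.sum_univ_four, d, hP.right a b 2 3]
    linear_combination (-2 * I * P a b 2 3) * hc
  have outer : ∑ a, ∑ b, nullBasis a 0 * nullBasis b 1 * P a b 2 3 = P 0 1 2 3 := by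
    rw [nullBasis]
    generalize ((1 / Real.sqrt 2 : ℝ) : ℂ) = s at hc
    simp [Fin.sum_univ_four, d', hP.left 0 1 2 3]
    linear_combination (2 * P 0 1 2 3) * hc
  have h : pull4 nullBasis P 0 1 2 3 = -I := by
    have : pull4 nullBasis P 0 1 2 3 = ∑ a, ∑ b, nullBasis a 0 * nullBasis b 1 *
        ∑ c, ∑ d, nullBasis c 2 * nullBasis d 3 * P a b c d := by
      simp only [pull4, Finset.mul_sum, mul_assoc]
    have h2 : -I = -I * ∑ a, ∑ b, nullBasis a 0 * nullBasis b 1 * P a b 2 3 := by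
      rw [outer, h1, mul_one]
    rw [this, h2, Finset.mul_sum]
    refine Finset.sum_congr rfl fun a _ => ?_
    rw [Finset.mul_sum]
    refine Finset.sum_congr rfl fun b _ => ?_
    rw [inner]
    ring
  rw [(hP.pull _).eq_leviCivita, h, mul_comm]

/-- An adapted orthonormal frame gives rise to an adapted null frame. -/
theorem exists_isNullFrame {g K A : Tensor2 ℝ} {η : Tensor4 ℝ}
    (hg : A.transpose * g * A = Matrix.of minkowski)
    (hK : pull2 (cplx2 A) (cplx2 K) = nullPlane) (hη : IsAlt4 (cplx4 η))
    (h1 : pull4 (cplx2 A) (cplx4 η) 0 1 2 3 = 1) :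
    ∃ E, IsNullFrame (cplx2 g) (cplx2 K - I • hodge g η (cplx2 K)) (cplx2 K) E ∧
      ∀ i j k l, pull4 E (cplx4 η) i j k l = -I * leviCivita i j k l := by
  set E := cplx2 A * nullBasis with hE
  have pm : ∀ B, pull2 E B = pull2 nullBasis (pull2 (cplx2 A) B) := by
    intro B
    simp only [pull2, hE, Matrix.transpose_mul, mul_assoc]
  have hG : pull2 E (cplx2 g) = nullMetric := by
    rw [pm, ← pull2_nullBasis_minkowski, ← hg, cplx2_mul, cplx2_mul]
    rfl
  have hP : pull2 E (cplx2 K) = nullPlane := by rw [pm, hK, pull2_nullBasis_plane]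
  have hV : ∀ i j k l, pull4 E (cplx4 η) i j k l = -I * leviCivita i j k l := by
    intro i j k l
    rw [hE, pull4_mul]
    exact pull4_nullBasis (hη.pull _) h1 i j k l
  have hF : coframe (cplx2 g) E * E = 1 := by
    rw [coframe, mul_assoc, mul_assoc, ← mul_assoc E.transpose]
    exact (congrArg _ hG).trans nullMetric_mul_self
  -- The frame calculus for the Hodge dual requires an `IsNullFrame`, whose `canon` field is what is
  -- being proved. This auxiliary instance uses the 2-form having the desired components by
  -- construction.
  have h0 : IsNullFrame (cplx2 g) (pull2 (coframe (cplx2 g) E) nullSD) (cplx2 K) E := by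
    refine ⟨hG, ?_, hP⟩
    have h' : E.transpose * (coframe (cplx2 g) E).transpose = 1 := by
      rw [← Matrix.transpose_mul, hF, Matrix.transpose_one]
    simp only [pull2, mul_assoc, hF, mul_one]
    rw [← mul_assoc, h', one_mul]
  refine ⟨E, ⟨hG, ?_, hP⟩, hV⟩
  have hs : nullPlane.transpose = -nullPlane := by
    ext i j
    fin_cases i <;> fin_cases j <;> simp [nullPlane]
  change pull2 E _ = _
  rw [sub_eq_add_neg, ← neg_smul, pull2_add, pull2_smul, hP, hodge, cplx2_inv, h0.pull2_applyForm,
    hP, hodge_frame hV hs, smul_smul, neg_mul, Complex.I_mul_I, neg_neg, one_smul]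
  ext i j
  fin_cases i <;> fin_cases j <;> simp [nullPlane, nullSD]

section

variable {T : Type*} [AddCommGroup T] [Module ℝ T]

/-- The orthogonal complement of a time-like vector is space-like. -/
theorem pos_of_orthogonal_timelike (b : Module.Basis (Fin 4) ℝ T) {B : T →ₗ[ℝ] T →ₗ[ℝ] ℝ}
    (hb : ∀ i j, B (b i) (b j) = minkowski i j) {e w : T} (he : B e e = -1) (hw : B e w = 0)
    (h0 : w ≠ 0) : 0 < B w w := by
  have hB : ∀ x y, B x y = -(b.repr x 0 * b.repr y 0) + b.repr x 1 * b.repr y 1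
      + b.repr x 2 * b.repr y 2 + b.repr x 3 * b.repr y 3 := by
    intro x y
    conv_lhs => rw [← b.sum_repr x, ← b.sum_repr y]
    simp only [map_sum, map_smul, LinearMap.sum_apply, LinearMap.smul_apply, hb, smul_eq_mul]
    simp [minkowski, Fin.sum_univ_four]
    ring
  rw [hB] at he hw ⊢
  have hne : ¬(b.repr w 0 = 0 ∧ b.repr w 1 = 0 ∧ b.repr w 2 = 0 ∧ b.repr w 3 = 0) := by
    rintro ⟨h0', h1, h2, h3⟩
    apply h0
    rw [← b.sum_repr w, Fin.sum_univ_four, h0', h1, h2, h3]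
    simp
  generalize b.repr w 0 = w0, b.repr w 1 = w1, b.repr w 2 = w2, b.repr w 3 = w3,
    b.repr e 0 = a0, b.repr e 1 = a1, b.repr e 2 = a2, b.repr e 3 = a3 at *
  have ha : 0 < a0 * a0 := by nlinarith [sq_nonneg a1, sq_nonneg a2, sq_nonneg a3]
  -- Writing bold letters for space parts, orthogonality gives a₀w₀ = 𝐚·𝐰 and the norm of e gives
  -- a₀² = 1 + |𝐚|². So the right side is (1 + |𝐚|²)|𝐰|² − (𝐚·𝐰)², and Cauchy–Schwarz applies.
  have key : w1 ^ 2 + w2 ^ 2 + w3 ^ 2 ≤ a0 * a0 * (-(w0 * w0) + w1 * w1 + w2 * w2 + w3 * w3) := by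
    have : a0 * w0 = a1 * w1 + a2 * w2 + a3 * w3 := by linarith
    have e2 : a0 * a0 * (w0 * w0) = (a1 * w1 + a2 * w2 + a3 * w3) ^ 2 := by
      rw [← this]; ring
    have e3 : a0 * a0 = 1 + a1 ^ 2 + a2 ^ 2 + a3 ^ 2 := by linarith
    have e4 : a0 * a0 * (-(w0 * w0) + w1 * w1 + w2 * w2 + w3 * w3) =
        (1 + a1 ^ 2 + a2 ^ 2 + a3 ^ 2) * (w1 ^ 2 + w2 ^ 2 + w3 ^ 2)
          - (a1 * w1 + a2 * w2 + a3 * w3) ^ 2 := by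
      rw [← e2, ← e3]; ring
    rw [e4]
    nlinarith [sq_nonneg (a1 * w2 - a2 * w1), sq_nonneg (a1 * w3 - a3 * w1),
      sq_nonneg (a2 * w3 - a3 * w2)]
  have hs : 0 < w1 ^ 2 + w2 ^ 2 + w3 ^ 2 := by
    rcases (by positivity : 0 ≤ w1 ^ 2 + w2 ^ 2 + w3 ^ 2).lt_or_eq with h | h
    · exact h
    · exfalso
      have z1 : w1 = 0 := by nlinarith [sq_nonneg w1, sq_nonneg w2, sq_nonneg w3]
      have z2 : w2 = 0 := by nlinarith [sq_nonneg w1, sq_nonneg w2, sq_nonneg w3]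
      have z3 : w3 = 0 := by nlinarith [sq_nonneg w1, sq_nonneg w2, sq_nonneg w3]
      refine hne ⟨?_, z1, z2, z3⟩
      have : a0 * w0 = 0 := by rw [z1, z2, z3] at hw; linarith
      rcases mul_eq_zero.1 this with h' | h'
      · rw [h'] at ha; simp at ha
      · exact h'
  exact pos_of_mul_pos_right (hs.trans_le key) ha.le

/-- There is a unit vector orthogonal to a time-like vector and to at most two other vectors. -/
theorem exists_unit_orthogonal (b : Module.Basis (Fin 4) ℝ T) {B : T →ₗ[ℝ] T →ₗ[ℝ] ℝ}
    (hb : ∀ i j, B (b i) (b j) = minkowski i j) {e : T} (he : B e e = -1) (u v : T) :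
    ∃ w, B e w = 0 ∧ B u w = 0 ∧ B v w = 0 ∧ B w w = 1 := by
  have : Module.Finite ℝ T := Module.Finite.of_basis b
  -- Three linear functionals on a four-dimensional space have a common nonzero zero.
  obtain ⟨x, hx, hx0⟩ := Submodule.exists_mem_ne_zero_of_ne_bot
    (LinearMap.ker_ne_bot_of_finrank_lt (f := LinearMap.pi ![B e, B u, B v])
      (by rw [Module.finrank_eq_card_basis b]; simp))
  have hx' : ∀ i, (![B e, B u, B v] : Fin 3 → T →ₗ[ℝ] ℝ) i x = 0 := fun i => by
    exact congrFun (LinearMap.mem_ker.1 hx) i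
  have h1 : B e x = 0 := hx' 0
  have h2 : B u x = 0 := hx' 1
  have h3 : B v x = 0 := hx' 2
  have hp := pos_of_orthogonal_timelike b hb he h1 hx0
  refine ⟨(Real.sqrt (B x x))⁻¹ • x, by simp [h1], by simp [h2], by simp [h3], ?_⟩
  have hs := Real.mul_self_sqrt hp.le
  have hs0 : Real.sqrt (B x x) ≠ 0 := (Real.sqrt_pos.2 hp).ne'
  simp only [map_smul, LinearMap.smul_apply, smul_eq_mul]
  field_simp
  rw [pow_two, hs]

theorem linearIndependent_of_minkowski {B : T →ₗ[ℝ] T →ₗ[ℝ] ℝ} {e : Fin 4 → T}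
    (he : ∀ i j, B (e i) (e j) = minkowski i j) : LinearIndependent ℝ e := by
  rw [Fintype.linearIndependent_iff]
  intro c hc i
  have := congrArg (B (e i)) hc
  simp only [map_sum, map_smul, he, map_zero, smul_eq_mul, minkowski, mul_ite, mul_zero,
    Finset.sum_ite_eq, Finset.mem_univ, if_true] at this
  split_ifs at this <;> linarith

/-- Complete (e₀, e₁) to an orthonormal frame; reversing the last vector, if necessary, makes it
positively oriented. -/
theorem exists_adapted_frame (b : Module.Basis (Fin 4) ℝ T) {B : T →ₗ[ℝ] T →ₗ[ℝ] ℝ}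
    (hs : ∀ u w, B u w = B w u) {f : Fin 4 → T} (hf : ∀ i j, B (f i) (f j) = minkowski i j)
    {vol : T [⋀^Fin 4]→ₗ[ℝ] ℝ}
    (hv : ∀ e : Fin 4 → T, (∀ i j, B (e i) (e j) = minkowski i j) → |vol e| = 1)
    {e₀ e₁ : T} (h00 : B e₀ e₀ = -1) (h11 : B e₁ e₁ = 1) (h01 : B e₀ e₁ = 0) :
    ∃ e : Fin 4 → T, e 0 = e₀ ∧ e 1 = e₁ ∧ (∀ i j, B (e i) (e j) = minkowski i j) ∧
      vol e = 1 := by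
  obtain ⟨b', hb'⟩ : ∃ b' : Module.Basis (Fin 4) ℝ T, ∀ i, b' i = f i :=
    ⟨basisOfLinearIndependentOfCardEqFinrank (linearIndependent_of_minkowski hf)
      (by rw [Module.finrank_eq_card_basis b]), fun i => by simp⟩
  have hbb : ∀ i j, B (b' i) (b' j) = minkowski i j := by simpa only [hb'] using hf
  -- Only two orthogonality conditions are needed here, so e₁ is passed twice.
  obtain ⟨e₂, h02, h12, -, h22⟩ := exists_unit_orthogonal b' hbb h00 e₁ e₁
  obtain ⟨e₃, h03, h13, h23, h33⟩ := exists_unit_orthogonal b' hbb h00 e₁ e₂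
  have key : ∀ s : ℝ, s * s = 1 → ∀ i j,
      B ((![e₀, e₁, e₂, s • e₃] : Fin 4 → T) i) ((![e₀, e₁, e₂, s • e₃] : Fin 4 → T) j) =
        minkowski i j := by
    intro s hss i j
    fin_cases i <;> fin_cases j <;>
      simp [minkowski, h00, h11, h22, h33, h01, h02, h03, h12, h13, h23, hs e₁ e₀, hs e₂ e₀,
        hs e₃ e₀, hs e₂ e₁, hs e₃ e₁, hs e₃ e₂, hss]
  have h1 := hv _ (key 1 (by norm_num))
  rcases (abs_eq zero_le_one).1 h1 with h | h
  · exact ⟨_, rfl, rfl, key 1 (by norm_num), h⟩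
  · refine ⟨_, rfl, rfl, key (-1) (by norm_num), ?_⟩
    have e : ∀ s : ℝ, (![e₀, e₁, e₂, s • e₃] : Fin 4 → T) =
        Function.update ![e₀, e₁, e₂, e₃] 3 (s • e₃) := by
      intro s; ext i; fin_cases i <;> rfl
    rw [e, AlternatingMap.map_update_smul] at h ⊢
    rw [smul_eq_mul] at h ⊢
    linarith

end

/-! ### Frames in a chart -/

section

variable {T : Type*} [AddCommGroup T] [Module ℝ T]

theorem bilin_frame (b : Module.Basis (Fin 4) ℝ T) (B : T →ₗ[ℝ] T →ₗ[ℝ] ℝ) (e : Fin 4 → T) :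
    (b.toMatrix e).transpose * (Matrix.of fun a c => B (b a) (b c)) * b.toMatrix e =
      Matrix.of fun i j => B (e i) (e j) := by
  ext i j
  rw [Matrix.of_apply]
  conv_rhs => rw [← b.sum_toMatrix_smul_self e i, ← b.sum_toMatrix_smul_self e j]
  simp only [map_sum, map_smul, LinearMap.sum_apply, LinearMap.smul_apply, smul_eq_mul,
    Matrix.mul_apply, Matrix.transpose_apply, Matrix.of_apply, Finset.sum_mul, Finset.mul_sum]
  exact Finset.sum_congr rfl fun a _ => Finset.sum_congr rfl fun b _ => by ring

theorem AlternatingMap.map_update_sum_smul (f : T [⋀^Fin 4]→ₗ[ℝ] ℝ) (m : Fin 4 → T) (i : Fin 4)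
    (c : Fin 4 → ℝ) (v : Fin 4 → T) :
    f (Function.update m i (∑ a, c a • v a)) = ∑ a, c a * f (Function.update m i (v a)) := by
  have := map_sum (f.toMultilinearMap.toLinearMap m i) (fun a => c a • v a) Finset.univ
  simp only [map_smul] at this
  exact this

theorem alternating_frame (b : Module.Basis (Fin 4) ℝ T) (f : T [⋀^Fin 4]→ₗ[ℝ] ℝ) (e : Fin 4 → T) :
    f e = ∑ i, ∑ j, ∑ k, ∑ l, b.toMatrix e i 0 * b.toMatrix e j 1 * b.toMatrix e k 2 *
      b.toMatrix e l 3 * f ![b i, b j, b k, b l] := by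
  have h0 : ∀ (c : Fin 4 → ℝ) (v : Fin 4 → T) x y z, f ![∑ a, c a • v a, x, y, z] =
      ∑ a, c a * f ![v a, x, y, z] := fun c v x y z => by
    have u : ∀ t, Function.update ![0, x, y, z] 0 t = ![t, x, y, z] := fun t => by
      ext i : 1; fin_cases i <;> rfl
    simpa only [u] using f.map_update_sum_smul ![0, x, y, z] 0 c v
  have h1 : ∀ (c : Fin 4 → ℝ) (v : Fin 4 → T) x y z, f ![x, ∑ a, c a • v a, y, z] =
      ∑ a, c a * f ![x, v a, y, z] := fun c v x y z => by
    have u : ∀ t, Function.update ![x, 0, y, z] 1 t = ![x, t, y, z] := fun t => by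
      ext i : 1; fin_cases i <;> rfl
    simpa only [u] using f.map_update_sum_smul ![x, 0, y, z] 1 c v
  have h2 : ∀ (c : Fin 4 → ℝ) (v : Fin 4 → T) x y z, f ![x, y, ∑ a, c a • v a, z] =
      ∑ a, c a * f ![x, y, v a, z] := fun c v x y z => by
    have u : ∀ t, Function.update ![x, y, 0, z] 2 t = ![x, y, t, z] := fun t => by
      ext i : 1; fin_cases i <;> rfl
    simpa only [u] using f.map_update_sum_smul ![x, y, 0, z] 2 c v
  have h3 : ∀ (c : Fin 4 → ℝ) (v : Fin 4 → T) x y z, f ![x, y, z, ∑ a, c a • v a] =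
      ∑ a, c a * f ![x, y, z, v a] := fun c v x y z => by
    have u : ∀ t, Function.update ![x, y, z, 0] 3 t = ![x, y, z, t] := fun t => by
      ext i : 1; fin_cases i <;> rfl
    simpa only [u] using f.map_update_sum_smul ![x, y, z, 0] 3 c v
  have he : e = ![∑ a, b.toMatrix e a 0 • b a, ∑ a, b.toMatrix e a 1 • b a,
      ∑ a, b.toMatrix e a 2 • b a, ∑ a, b.toMatrix e a 3 • b a] := by
    simp only [b.sum_toMatrix_smul_self]
    ext i; fin_cases i <;> rfl
  conv_lhs => rw [he]
  simp only [h0, h1, h2, h3, Finset.mul_sum, mul_assoc]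

end

section

variable {M : Type*} [TopologicalSpace M] [ChartedSpace Coord M]

theorem FourForm.isAlt4_comps (η : FourForm M) (φ : OpenPartialHomeomorph M Coord) (z : Coord) :
    IsAlt4 (cplx4 (η.comps φ z)) where
  left a b c d := by
    have h := (η (φ.symm z)).map_swap ![coordVec φ z a, coordVec φ z b, coordVec φ z c,
      coordVec φ z d] (i := 0) (j := 1) (by decide)
    have e : ![coordVec φ z a, coordVec φ z b, coordVec φ z c, coordVec φ z d] ∘ Equiv.swap 0 1 =
        ![coordVec φ z b, coordVec φ z a, coordVec φ z c, coordVec φ z d] := by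
      ext i : 1; fin_cases i <;> rfl
    rw [e] at h
    simp only [cplx4, FourForm.comps, h, Complex.ofReal_neg]
  mid a b c d := by
    have h := (η (φ.symm z)).map_swap ![coordVec φ z a, coordVec φ z b, coordVec φ z c,
      coordVec φ z d] (i := 1) (j := 2) (by decide)
    have e : ![coordVec φ z a, coordVec φ z b, coordVec φ z c, coordVec φ z d] ∘ Equiv.swap 1 2 =
        ![coordVec φ z a, coordVec φ z c, coordVec φ z b, coordVec φ z d] := by
      ext i : 1; fin_cases i <;> rfl
    rw [e] at h
    simp only [cplx4, FourForm.comps, h, Complex.ofReal_neg]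
  right a b c d := by
    have h := (η (φ.symm z)).map_swap ![coordVec φ z a, coordVec φ z b, coordVec φ z c,
      coordVec φ z d] (i := 2) (j := 3) (by decide)
    have e : ![coordVec φ z a, coordVec φ z b, coordVec φ z c, coordVec φ z d] ∘ Equiv.swap 2 3 =
        ![coordVec φ z a, coordVec φ z b, coordVec φ z d, coordVec φ z c] := by
      ext i : 1; fin_cases i <;> rfl
    rw [e] at h
    simp only [cplx4, FourForm.comps, h, Complex.ofReal_neg]

/-- The derivative of the inverse chart is a linear isomorphism and carries the standard basis to
the coordinate vectors. -/
theorem exists_coordBasis [IsManifold (𝓡 4) ∞ M] {φ : OpenPartialHomeomorph M Coord}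
    (hφ : φ ∈ IsManifold.maximalAtlas (𝓡 4) ∞ M) {z : Coord} (hz : z ∈ φ.target) :
    ∃ b : Module.Basis (Fin 4) ℝ (TangentSpace (𝓡 4) (φ.symm z)), ∀ i, b i = coordVec φ z i := by
  have hd : φ.MDifferentiable (𝓡 4) (𝓡 4) :=
    ⟨(contMDiffOn_of_mem_maximalAtlas hφ).mdifferentiableOn (by simp),
      (contMDiffOn_symm_of_mem_maximalAtlas hφ).mdifferentiableOn (by simp)⟩
  have hz' : z ∈ φ.symm.source := hz
  let L : Coord ≃ₗ[ℝ] TangentSpace (𝓡 4) (φ.symm z) := (hd.symm.mfderiv hz').toLinearEquiv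
  refine ⟨(EuclideanSpace.basisFun (Fin 4) ℝ).toBasis.map L, fun i => ?_⟩
  have h : (EuclideanSpace.basisFun (Fin 4) ℝ).toBasis i = EuclideanSpace.single i 1 := by
    rw [OrthonormalBasis.coe_toBasis, EuclideanSpace.basisFun_apply]
  exact congrArg L h

namespace OrientedSpacetime

variable [IsManifold (𝓡 4) ∞ M] {S : OrientedSpacetime M} {U : BilinField M}
  {φ : OpenPartialHomeomorph M Coord} {z : Coord}

theorem exists_adapted_matrix (hU : S.IsCanonical U)
    (hφ : φ ∈ IsManifold.maximalAtlas (𝓡 4) ∞ M) (hz : z ∈ φ.target) :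
    ∃ A : Tensor2 ℝ, A.transpose * S.metric.comps φ z * A = Matrix.of minkowski ∧
      pull2 (cplx2 A) (cplx2 (U.comps φ z)) = nullPlane ∧
      pull4 (cplx2 A) (cplx4 (S.vol.comps φ z)) 0 1 2 3 = 1 := by
  obtain ⟨b, hb⟩ := exists_coordBasis hφ hz
  obtain ⟨f, hf⟩ := S.metric_signature (φ.symm z)
  obtain ⟨e₀, e₁, h00, h11, h01, hU'⟩ := hU.2 (φ.symm z)
  obtain ⟨e, rfl, rfl, he, hv⟩ := exists_adapted_frame b (S.metric_symm _) hf (S.vol_unit _)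
    h00 h11 h01
  have hc : ∀ B : BilinField M, (b.toMatrix e).transpose * B.comps φ z * b.toMatrix e =
      Matrix.of fun i j => B (φ.symm z) (e i) (e j) := by
    intro B
    rw [← bilin_frame b]
    simp only [hb]
    rfl
  refine ⟨b.toMatrix e, ?_, ?_, ?_⟩
  · rw [hc]
    ext i j
    exact he i j
  · have : pull2 (cplx2 (b.toMatrix e)) (cplx2 (U.comps φ z)) =
        cplx2 (Matrix.of fun i j => U (φ.symm z) (e i) (e j)) := by
      rw [← hc, cplx2_mul, cplx2_mul]
      rfl
    rw [this]
    ext i j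
    simp only [cplx2, Matrix.of_apply, hU', he]
    fin_cases i <;> fin_cases j <;> simp [minkowski, nullPlane]
  · rw [alternating_frame b] at hv
    have := congrArg (fun x : ℝ => (x : ℂ)) hv
    simp only [hb] at this
    push_cast at this
    exact this

theorem isSmoothMetric (S : OrientedSpacetime M) (hU : S.IsCanonical U)
    (hφ : φ ∈ IsManifold.maximalAtlas (𝓡 4) ∞ M) :
    IsSmoothMetric (S.metric.comps φ) φ.target where
  isOpen := φ.open_target
  symm _ _ _ := S.metric_symm _ _ _
  smooth z hz a b := (S.metric_smooth φ hφ a b).contDiffAt (φ.open_target.mem_nhds hz)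
  det_ne z hz h0 := by
    obtain ⟨A, hA, -⟩ := exists_adapted_matrix hU hφ hz
    -- An orthonormal frame A gives (det A)² det g = −1, so g is nondegenerate.
    have := congrArg Matrix.det hA
    rw [Matrix.det_mul, Matrix.det_mul, h0, mul_zero, zero_mul] at this
    have hm : Matrix.of minkowski = Matrix.diagonal ![-1, 1, 1, 1] := by
      ext i j
      fin_cases i <;> fin_cases j <;> simp [minkowski]
    rw [hm, Matrix.det_diagonal] at this
    simp [Fin.prod_univ_four] at this

theorem isUmbilicalField (hU : S.IsUmbilical U)
    (hφ : φ ∈ IsManifold.maximalAtlas (𝓡 4) ∞ M) :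
    IsUmbilicalField (S.metric.comps φ)
      (unitSD (S.metric.comps φ) (S.vol.comps φ) (U.comps φ)) (U.comps φ) φ.target := by
  have hg := S.isSmoothMetric hU.1 hφ
  have hp : ∀ z ∈ φ.target, ∀ a b, ContDiffAt ℝ ∞ (fun x => U.comps φ x a b) z :=
    fun z hz a b => (hU.1.1 φ hφ a b).contDiffAt (φ.open_target.mem_nhds hz)
  refine ⟨hg, fun z hz => ?_, hp, fun z hz => ?_,
    fun z hz a b c => (hU.2 φ hφ z hz a b c).1, fun z hz a b c => (hU.2 φ hφ z hz a b c).2⟩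
  · have hη : ∀ a b c d, ContDiffAt ℝ ∞ (fun x => cplx4 (S.vol.comps φ x) a b c d) z :=
      fun a b c d =>
        ((S.vol_smooth φ hφ a b c d).contDiffAt (φ.open_target.mem_nhds hz)).ofReal
    have hq := hg.cplx_inv hz
    have hU' : MatSmoothAt (fun x => cplx2 (U.comps φ x)) z := fun a b => (hp z hz a b).ofReal
    refine hU'.sub (MatSmoothAt.smul I fun a b => ?_)
    exact contDiffAt_const.mul <| ContDiffAt.sum fun m _ => ContDiffAt.sum fun n _ =>
      ContDiffAt.sum fun r _ => ContDiffAt.sum fun s _ =>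
        (((hη a b m n).mul (hq m r)).mul (hq n s)).mul (hU' r s)
  · obtain ⟨A, h1, h2, h3⟩ := exists_adapted_matrix hU.1 hφ hz
    obtain ⟨E, hE, -⟩ := exists_isNullFrame h1 h2 (S.vol.isAlt4_comps φ z) h3
    exact ⟨E, hE⟩

end OrientedSpacetime

end

theorem mainTheorem3 {M : Type*} [TopologicalSpace M] [ChartedSpace Coord M]
    [IsManifold (𝓡 4) ∞ M] (S : OrientedSpacetime M) (U : BilinField M)
    (hU : S.IsUmbilical U)
    (φ : OpenPartialHomeomorph M Coord) (hφ : φ ∈ IsManifold.maximalAtlas (𝓡 4) ∞ M)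
    (y : Coord) (hy : y ∈ φ.target) :
    let g := S.metric.comps φ
    let η := S.vol.comps φ
    let V := sdForms (g y) (η y)
    let 𝒰 := canonSD g η (U.comps φ) y
    let Ω := omegaScalar g η (U.comps φ) y
    let 𝒵 := zForm g η (U.comps φ) y
    let ζ := formProd (cplx2 (g y)⁻¹) 𝒵 𝒵
    sdWeyl g η y = (3 * Ω) • tensorProd 𝒰 𝒰 + Ω • sdMetric (g y) (η y)
        + (tensorProd 𝒰 𝒵 + tensorProd 𝒵 𝒰) ∧
    ∃ hW : ∀ F ∈ V, sdWeylEnd g η y F ∈ V,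
      let 𝒲 : Module.End ℂ V := (sdWeylEnd g η y).restrict hW
      LinearMap.trace ℂ V (𝒲 ^ 2) = 2 * (3 * Ω ^ 2 - ζ) ∧
      LinearMap.trace ℂ V (𝒲 ^ 3) = 3 * Ω * (ζ - 2 * Ω ^ 2) ∧
      ∀ w : ℂ, w ^ 2 = 9 * Ω ^ 2 - 4 * ζ →
        (LinearMap.charpoly 𝒲).roots = {Ω, (-Ω + w) / 2, (-Ω - w) / 2} ∧
        ∀ μ : ℂ, Module.End.HasEigenvalue 𝒲 μ ↔
          μ = Ω ∨ μ = (-Ω + w) / 2 ∨ μ = (-Ω - w) / 2 := by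
  obtain ⟨A, h1, h2, h3⟩ := OrientedSpacetime.exists_adapted_matrix hU.1 hφ hy
  obtain ⟨E, hE, hη⟩ := exists_isNullFrame h1 h2 (S.vol.isAlt4_comps φ y) h3
  exact sdWeyl_of_isUmbilicalField (OrientedSpacetime.isUmbilicalField hU hφ) hy hE hη
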